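/- Let $p$ be a prime, $\mathbb F$ a perfect field of characteristic $p$, and $L$ a nilpotent Lie algebra over $\mathbb F$ with $1\le\dim L\le 4$. A $[p]$-map on $L$ is a map $x\mapsto x^{[p]}$ from $L$ to $L$ such that, for all $a,b\in L$ and $\alpha\in\mathbb F$, $(\operatorname{ad}a)^p=\operatorname{ad}a^{[p]}$, $(\alpha a)^{[p]}=\alpha^pa^{[p]}$ and $(a+b)^{[p]}=a^{[p]}+b^{[p]}+\sum_{i=1}^{p-1}s_i(a,b)$, where $s_i(a,b)\in L$ is defined by $(\operatorname{ad}(a\otimes X+b\otimes 1))^{p-1}(a\otimes 1)=\sum_{i=1}^{p-1}i\,s_i(a,b)\otimes X^{i-1}$ in $L\otimes\mathbb F[X]$. $L$ is restrictable if it has a $[p]$-map. A $[p]$-map is $[p]$-nilpotent if some iterate of it is zero on $L$. Two $[p]$-maps $\varphi_1,\varphi_2$ are equivalent if there is $A\in\operatorname{Aut}(L)$ with $A(\varphi_1(x))=\varphi_2(A(x))$ for all $x\in L$. **Theorem.** $L$ has a basis $x_1,\dots,x_n$ ($n=\dim L$) with one of the bracket tables below (brackets of basis vectors that are not displayed, and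 not determined by antisymmetry, are zero). For every such basis, the equivalence classes of the $[p]$-nilpotent $[p]$-maps on $L$ are as listed. That is: each line below is the table of values on the basis (values not displayed are $0$) of exactly one $[p]$-map, and this map is $[p]$-nilpotent; every $[p]$-nilpotent $[p]$-map on $L$ is equivalent to one in the list; and different entries of a list are inequivalent, except that entries of the same line with different parameters are equivalent exactly as stated. In characteristic $2$ put $\mathbb K=\{\delta+\delta^2\mid\delta\in\mathbb F\}$; in characteristic $3$ put $\mathbb K_\beta=\{\beta\delta^3+\delta\mid\delta\in\mathbb F\}$. (1/1) $\dim L=1$: (a) $x_1^{[p]}=0$. (2/1) $\dim L=2$ ($L$ is abelian): (a) all values $0$; (b) $x_1^{[p]}=x_2$. (3/1) $\dim L=3$, $L$ abelian: (a) all values $0$; (b) $x_1^{[p]}=x_2$; (c) $x_1^{[p]}=x_2$, $x_2^{[p]}=x_3$. (3/2) $L=L_{3,2}=\langle x_1,x_2,x_3\mid[x_1,x_2]=x_3\rangle$. If $p\ge3$: (a) all values $0$; (b) $x_1^{[p]}=x_3$. If $p=2$: (a) $x_1^{[2]}=x_3$, $x_2^{[2]}=\xi x_3$, with $\xi\in\mathbb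 F$; $\xi_1,\xi_2$ give equivalent maps if and only if $\xi_1+\xi_2\in\mathbb K$. (4/1) $\dim L=4$, $L$ abelian: (a) all values $0$; (b) $x_1^{[p]}=x_2$; (c) $x_1^{[p]}=x_2$, $x_3^{[p]}=x_4$; (d) $x_1^{[p]}=x_2$, $x_2^{[p]}=x_3$; (e) $x_1^{[p]}=x_2$, $x_2^{[p]}=x_3$, $x_3^{[p]}=x_4$. (4/2) $L=L_{4,2}=\langle x_1,x_2,x_3,x_4\mid[x_1,x_2]=x_3\rangle$. If $p\ge3$: (a) all values $0$; (b) $x_1^{[p]}=x_3$; (c) $x_1^{[p]}=x_4$; (d) $x_1^{[p]}=x_3$, $x_2^{[p]}=x_4$; (e) $x_3^{[p]}=x_4$; (f) $x_3^{[p]}=x_4$, $x_2^{[p]}=x_3$; (g) $x_4^{[p]}=x_3$; (h) $x_4^{[p]}=x_3$, $x_2^{[p]}=x_4$. If $p=2$: (a) $x_1^{[2]}=x_3$, $x_2^{[2]}=\xi x_3$; (b) $x_1^{[2]}=x_4$; (c) $x_1^{[2]}=x_3$, $x_2^{[2]}=x_4$; (d) $x_3^{[2]}=x_4$, $x_1^{[2]}=x_3$,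 $x_2^{[2]}=\xi x_3$; (e) $x_4^{[2]}=x_3$; (f) $x_4^{[2]}=x_3$, $x_2^{[2]}=x_4$. Here $\xi\in\mathbb F$, and in each of (a) and (d) the parameters $\xi_1,\xi_2$ give equivalent maps if and only if $\xi_1+\xi_2\in\mathbb K$. (4/3) $L=L_{4,3}=\langle x_1,x_2,x_3,x_4\mid[x_1,x_2]=x_3,\ [x_1,x_3]=x_4\rangle$. If $p\ge5$: (a) all values $0$; (b) $x_1^{[p]}=x_4$; (c) $x_2^{[p]}=\xi x_4$ with $\xi\in\mathbb F^*$; (d) $x_3^{[p]}=x_4$. In (c), $\xi_1,\xi_2$ give equivalent maps if and only if $\xi_1\xi_2^{-1}$ is a square in $\mathbb F$. If $p=3$: (a) all values $0$; (b) $x_3^{[3]}=x_4$; (c) $x_1^{[3]}=\alpha x_4$, $x_2^{[3]}=\beta x_4$ with $\alpha\in\mathbb F$, $\beta\in\mathbb F^*$. In (c), $(\alpha_1,\beta_1)$ and $(\alpha_2,\beta_2)$ give equivalent maps if and only if there is $s\in\mathbb F$ with $s^2=\beta_2/\beta_1$ such that $\alpha_1+\alpha_2s\in\mathbb K_{\beta_1}$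 or $\alpha_1-\alpha_2s\in\mathbb K_{\beta_1}$. If $p=2$, then $L$ is not restrictable. -/

import Mathlib

open scoped Polynomial TensorProduct

noncomputable section

namespace RestrictedLie

section PMaps

variable {F L : Type*} [Field F] [LieRing L] [LieAlgebra F L]

/-- The coefficient of `X ^ n` of an element of `F[X] ⊗ L`: the linear map sending
`f ⊗ a` to `(f.coeff n) • a`. -/
def coeffX (F L : Type*) [Field F] [LieRing L] [LieAlgebra F L] (n : ℕ) :
    F[X] ⊗[F] L →ₗ[F] L :=
  (TensorProduct.lid F L).toLinearMap ∘ₗ (Polynomial.lcoeff F n).rTensor L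

/-- Jacobson's terms `s_i(a, b)`: in the Lie algebra `F[X] ⊗ L` over `F[X]`,
the coefficient of `X ^ (i - 1)` of `(ad (X ⊗ a + 1 ⊗ b)) ^ (p - 1) (1 ⊗ a)` is `i s_i(a, b)`.
Used for `1 ≤ i ≤ p - 1` over a field of characteristic `p`, where `i` is invertible. -/
def jacobsonTerm (F : Type*) {L : Type*} [Field F] [LieRing L] [LieAlgebra F L]
    (p : ℕ) (a b : L) (i : ℕ) : L :=
  (i : F)⁻¹ • coeffX F L (i - 1)
    (((LieAlgebra.ad F[X] (F[X] ⊗[F] L)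
      ((Polynomial.X : F[X]) ⊗ₜ[F] a + (1 : F[X]) ⊗ₜ[F] b)) ^ (p - 1))
        ((1 : F[X]) ⊗ₜ[F] a))

/-- `φ` is a `[p]`-map on the Lie algebra `L` over the field `F` (of characteristic `p`). -/
structure IsPMap (F : Type*) {L : Type*} [Field F] [LieRing L] [LieAlgebra F L]
    (p : ℕ) (φ : L → L) : Prop where
  ad_pow : ∀ a : L, (LieAlgebra.ad F L a) ^ p = LieAlgebra.ad F L (φ a)
  map_smul : ∀ (c : F) (a : L), φ (c • a) = c ^ p • φ a
  map_add : ∀ a b : L,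
    φ (a + b) = φ a + φ b + ∑ i ∈ Finset.Icc 1 (p - 1), jacobsonTerm F p a b i

/-- `L` affords a `[p]`-map. -/
def Restrictable (F L : Type*) [Field F] [LieRing L] [LieAlgebra F L] (p : ℕ) : Prop :=
  ∃ φ : L → L, IsPMap F p φ

/-- Some iterate of `φ` vanishes on all of `L`. -/
def IsPNilpotent {L : Type*} [LieRing L] (φ : L → L) : Prop :=
  ∃ n : ℕ, ∀ a : L, φ^[n] a = 0

/-- Two maps are equivalent when they are conjugate under the automorphism group of `L`. -/
def Equivalent (F : Type*) {L : Type*} [Field F] [LieRing L] [LieAlgebra F L]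
    (φ₁ φ₂ : L → L) : Prop :=
  ∃ A : L ≃ₗ⁅F⁆ L, ∀ a : L, A (φ₁ a) = φ₂ (A a)

/-- `φ` is a `[p]`-map whose values on the basis `x` are the entries of `v`. -/
def Realizes {n : ℕ} (p : ℕ) (x : Module.Basis (Fin n) F L) (v : Fin n → L) (φ : L → L) : Prop :=
  IsPMap F p φ ∧ ∀ k, φ (x k) = v k

/-- The list `v` of prescribed values on the basis `x`, indexed by `ι`, describes all equivalence
classes of the `[p]`-maps that make `L` a `[p]`-nilpotent restricted Lie algebra, and two members
of the list are equivalent exactly when their indices are related by `r`: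
* every member of the list is given by one and only one `[p]`-map, which is `[p]`-nilpotent;
* every `[p]`-nilpotent `[p]`-map is equivalent to some member of the list;
* the members with indices `i`, `j` are equivalent if and only if `r i j`. -/
structure Classifies {n : ℕ} {ι : Type*} (p : ℕ) (x : Module.Basis (Fin n) F L)
    (v : ι → Fin n → L) (r : ι → ι → Prop) : Prop where
  exists_unique : ∀ i, ∃! φ : L → L, Realizes p x (v i) φ
  nilpotent : ∀ i φ, Realizes p x (v i) φ → IsPNilpotent φ
  complete : ∀ φ : L → L, IsPMap F p φ → IsPNilpotent φ →
    ∃ i ψ, Realizes p x (v i) ψ ∧ Equivalent F φ ψ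
  equivalent_iff : ∀ i j φ ψ, Realizes p x (v i) φ → Realizes p x (v j) ψ →
    (Equivalent F φ ψ ↔ r i j)

end PMaps

section Algebras

/-! The basis vectors `x₁, x₂, x₃, x₄` are `x 0, x 1, x 2, x 3`; brackets of basis vectors that are
not listed in a presentation are zero. -/

variable {F L : Type*} [Field F] [LieRing L] [LieAlgebra F L]

/-- `L = ⟨x₁, x₂, x₃ ∣ [x₁, x₂] = x₃⟩`, the Heisenberg algebra `L_{3,2}`. -/
structure IsL32 (x : Module.Basis (Fin 3) F L) : Prop where
  lie_12 : ⁅x 0, x 1⁆ = x 2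
  lie_13 : ⁅x 0, x 2⁆ = 0
  lie_23 : ⁅x 1, x 2⁆ = 0

/-- `L = ⟨x₁, x₂, x₃, x₄ ∣ [x₁, x₂] = x₃⟩`, the algebra `L_{4,2}`. -/
structure IsL42 (x : Module.Basis (Fin 4) F L) : Prop where
  lie_12 : ⁅x 0, x 1⁆ = x 2
  lie_13 : ⁅x 0, x 2⁆ = 0
  lie_14 : ⁅x 0, x 3⁆ = 0
  lie_23 : ⁅x 1, x 2⁆ = 0
  lie_24 : ⁅x 1, x 3⁆ = 0
  lie_34 : ⁅x 2, x 3⁆ = 0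

/-- `L = ⟨x₁, x₂, x₃, x₄ ∣ [x₁, x₂] = x₃, [x₁, x₃] = x₄⟩`, the filiform algebra `L_{4,3}`. -/
structure IsL43 (x : Module.Basis (Fin 4) F L) : Prop where
  lie_12 : ⁅x 0, x 1⁆ = x 2
  lie_13 : ⁅x 0, x 2⁆ = x 3
  lie_14 : ⁅x 0, x 3⁆ = 0
  lie_23 : ⁅x 1, x 2⁆ = 0
  lie_24 : ⁅x 1, x 3⁆ = 0
  lie_34 : ⁅x 2, x 3⁆ = 0

end Algebras

section Parameters

/-- The Artin–Schreier subspace `K = {δ + δ² ∣ δ ∈ F}`. -/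
def artinSchreier (F : Type*) [Field F] : Set F := {t | ∃ δ : F, t = δ + δ ^ 2}

/-- The subspace `K_β = {β δ³ + δ ∣ δ ∈ F}`. -/
def cubicSubspace {F : Type*} [Field F] (β : F) : Set F := {t | ∃ δ : F, t = β * δ ^ 3 + δ}

/-- The index set of the list for `L_{4,2}` in characteristic `2`. -/
inductive Index42Two (F : Type*) : Type _
  | a (ξ : F)
  | b
  | c
  | d (ξ : F)
  | e
  | f

/-- The index set of the list for `L_{4,3}` in characteristic at least `5`. -/
inductive Index43Big (F : Type*) [Field F] : Type _
  | a
  | b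
  | c (ξ : Fˣ)
  | d

/-- The index set of the list for `L_{4,3}` in characteristic `3`. -/
inductive Index43Three (F : Type*) [Field F] : Type _
  | a
  | b
  | c (α : F) (β : Fˣ)

variable {F L : Type*} [Field F] [LieRing L] [LieAlgebra F L]

def Index42Two.values (x : Module.Basis (Fin 4) F L) : Index42Two F → Fin 4 → L
  | .a ξ => ![x 2, ξ • x 2, 0, 0]
  | .b => ![x 3, 0, 0, 0]
  | .c => ![x 2, x 3, 0, 0]
  | .d ξ => ![x 2, ξ • x 2, x 3, 0]
  | .e => ![0, 0, 0, x 2]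
  | .f => ![0, x 3, 0, x 2]

def Index42Two.Rel : Index42Two F → Index42Two F → Prop
  | .a ξ₁, .a ξ₂ => ξ₁ + ξ₂ ∈ artinSchreier F
  | .b, .b => True
  | .c, .c => True
  | .d ξ₁, .d ξ₂ => ξ₁ + ξ₂ ∈ artinSchreier F
  | .e, .e => True
  | .f, .f => True
  | _, _ => False

def Index43Big.values (x : Module.Basis (Fin 4) F L) : Index43Big F → Fin 4 → L
  | .a => ![0, 0, 0, 0]
  | .b => ![x 3, 0, 0, 0]
  | .c ξ => ![0, (ξ : F) • x 3, 0, 0]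
  | .d => ![0, 0, x 3, 0]

def Index43Big.Rel : Index43Big F → Index43Big F → Prop
  | .a, .a => True
  | .b, .b => True
  | .c ξ₁, .c ξ₂ => IsSquare ((ξ₁ : F) * (ξ₂ : F)⁻¹)
  | .d, .d => True
  | _, _ => False

def Index43Three.values (x : Module.Basis (Fin 4) F L) : Index43Three F → Fin 4 → L
  | .a => ![0, 0, 0, 0]
  | .b => ![0, 0, x 3, 0]
  | .c α β => ![α • x 3, (β : F) • x 3, 0, 0]

def Index43Three.Rel : Index43Three F → Index43Three F → Prop
  | .a, .a => True
  | .b, .b => True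
  | .c α₁ β₁, .c α₂ β₂ => ∃ s : F, s ^ 2 = (β₂ : F) / (β₁ : F) ∧
      (α₁ + α₂ * s ∈ cubicSubspace (β₁ : F) ∨ α₁ - α₂ * s ∈ cubicSubspace (β₁ : F))
  | _, _ => False

end Parameters

end RestrictedLie

end

/-! Two `[p]`-maps on `L` have the same additive defect, Jacobson's sum. Hence a `[p]`-map is
determined by its values on a basis (`IsPMap.ext_basis`), and one `[p]`-map vanishing on a basis
yields all those with prescribed central values there, by adding a central `p`-semilinear map
(`existsUnique_realizes`). On the algebras at hand Jacobson's sum is explicit: it vanishes unless `p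
= 2` in class two or `p = 3` in class three (in class three only `p ≥ 3` occurs), so the map
vanishing on the basis is zero or a single monomial of degree `p` times a central basis vector.

Equivalence is thus a matter of bases: a map is equivalent to an entry of the list exactly when it
takes the values of that entry on some basis with the same bracket table. `classifies_of_tables`
reduces every case to finding such bases and to separating the entries.

Bases are found by linear algebra of `p`-semilinear maps. Perfectness supplies the `p`-th roots
needed to correct a vector by one whose image is known, and `[p]`-nilpotency excludes invariant sets
avoiding zero (`IsPNilpotent.zero_mem`). In the abelian case this is a Jordan form for a nilpotent
semilinear map.

Entries are separated by invariants: the nilpotency index, the rank, and the position of the kernel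
and the image relative to the centre and the derived algebra. The continuous parameters need more.
In characteristic 2 the coefficient of `[x₁, x₂]` is a quadratic form, and its Arf invariant is the
class of `ξ` modulo the Artin–Schreier subspace. For `L_{4,3}` the automorphisms are computed on the
generators, and comparison of coefficients (`Equivalent.exists_coeff_eq`) gives the stated
relations. -/

namespace RestrictedLie

/-! ### Jacobson's terms in small nilpotency class, and their naturality. -/

section Jacobson

variable {F L : Type*} [Field F] [LieRing L] [LieAlgebra F L]

@[simp]
lemma coeffX_tmul (n : ℕ) (f : F[X]) (a : L) : coeffX F L n (f ⊗ₜ[F] a) = f.coeff n • a := by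
  simp [coeffX]

/-- The sum of Jacobson's terms. -/
noncomputable def jacobsonSum (F : Type*) {L : Type*} [Field F] [LieRing L] [LieAlgebra F L]
    (p : ℕ) (a b : L) : L :=
  ∑ i ∈ Finset.Icc 1 (p - 1), jacobsonTerm F p a b i

lemma ad_generic_pow_one (a b : L) :
    LieAlgebra.ad F[X] (F[X] ⊗[F] L) ((Polynomial.X : F[X]) ⊗ₜ[F] a + (1 : F[X]) ⊗ₜ[F] b)
      ((1 : F[X]) ⊗ₜ[F] a) = (1 : F[X]) ⊗ₜ[F] ⁅b, a⁆ := by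
  simp [LieAlgebra.ad_apply]

lemma ad_generic_pow_two (a b : L) :
    ((LieAlgebra.ad F[X] (F[X] ⊗[F] L)
      ((Polynomial.X : F[X]) ⊗ₜ[F] a + (1 : F[X]) ⊗ₜ[F] b)) ^ 2) ((1 : F[X]) ⊗ₜ[F] a) =
      (Polynomial.X : F[X]) ⊗ₜ[F] ⁅a, ⁅b, a⁆⁆ + (1 : F[X]) ⊗ₜ[F] ⁅b, ⁅b, a⁆⁆ := by
  rw [pow_two, Module.End.mul_apply, ad_generic_pow_one]
  simp [LieAlgebra.ad_apply]

lemma jacobsonSum_two (a b : L) : jacobsonSum F 2 a b = ⁅b, a⁆ := by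
  simp only [jacobsonSum, jacobsonTerm, Nat.add_one_sub_one, Finset.Icc_self,
    Finset.sum_singleton, pow_one, ad_generic_pow_one, coeffX_tmul]
  simp

lemma jacobsonSum_three [CharP F 3] (a b : L) :
    jacobsonSum F 3 a b = ⁅b, ⁅b, a⁆⁆ + ⁅a, ⁅a, b⁆⁆ := by
  -- This inverse turns the second term `2⁻¹ [a, [b, a]]` into `[a, [a, b]]`.
  have h2 : (2 : F)⁻¹ = -1 := by
    have h3 : (3 : F) = 0 := by exact_mod_cast CharP.cast_eq_zero F 3
    have : (2 : F) = -1 := by linear_combination h3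
    rw [this, inv_neg, inv_one]
  have hI : Finset.Icc 1 (3 - 1) = {1, 2} := rfl
  rw [jacobsonSum, hI, Finset.sum_pair (by norm_num)]
  have hp : 3 - 1 = 2 := rfl
  simp only [jacobsonTerm, hp, ad_generic_pow_two]
  rw [map_add, map_add, coeffX_tmul, coeffX_tmul, coeffX_tmul, coeffX_tmul, ← lie_skew a b]
  push_cast
  rw [h2]
  simp only [Polynomial.coeff_X_zero, Polynomial.coeff_X_one, Polynomial.coeff_one, one_ne_zero,
    if_false, if_true, zero_smul, one_smul, zero_add, add_zero, inv_one, neg_smul, lie_neg]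

/-- Every term is a coefficient of the `(p - 1)`-st power, which factors through the `m`-th because
`m ≤ p - 1`. So `[p]`-maps are additive on Lie algebras of class less than `p`. -/
lemma jacobsonSum_eq_zero_of_pow {p m : ℕ} (a b : L) (hm : m < p)
    (h : ((LieAlgebra.ad F[X] (F[X] ⊗[F] L)
      ((Polynomial.X : F[X]) ⊗ₜ[F] a + (1 : F[X]) ⊗ₜ[F] b)) ^ m) ((1 : F[X]) ⊗ₜ[F] a) = 0) :
    jacobsonSum F p a b = 0 := by
  obtain ⟨k, hk⟩ := Nat.exists_eq_add_of_le (Nat.le_sub_one_of_lt hm)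
  refine Finset.sum_eq_zero fun i _ => ?_
  rw [jacobsonTerm, hk, add_comm m k, pow_add, Module.End.mul_apply, h]
  simp

lemma jacobsonSum_of_abelian {p : ℕ} (hp : 1 < p) (h : ∀ a b : L, ⁅a, b⁆ = 0) (a b : L) :
    jacobsonSum F p a b = 0 :=
  jacobsonSum_eq_zero_of_pow (m := 1) a b hp (by rw [pow_one, ad_generic_pow_one, h]; simp)

lemma jacobsonSum_of_class_two {p : ℕ} (hp : 2 < p) (h : ∀ a b c : L, ⁅a, ⁅b, c⁆⁆ = 0)
    (a b : L) : jacobsonSum F p a b = 0 :=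
  jacobsonSum_eq_zero_of_pow (m := 2) a b hp (by rw [ad_generic_pow_two, h, h]; simp)

lemma jacobsonSum_of_class_three {p : ℕ} (hp : 3 < p)
    (h : ∀ a b c d : L, ⁅a, ⁅b, ⁅c, d⁆⁆⁆ = 0) (a b : L) : jacobsonSum F p a b = 0 :=
  jacobsonSum_eq_zero_of_pow (m := 3) a b hp (by
    rw [pow_succ', Module.End.mul_apply, ad_generic_pow_two]
    simp [LieAlgebra.ad_apply, h])

variable {L' : Type*} [LieRing L'] [LieAlgebra F L']

lemma lTensor_ad (A : L →ₗ⁅F⁆ L') (u v : F[X] ⊗[F] L) :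
    (A : L →ₗ[F] L').lTensor F[X] (LieAlgebra.ad F[X] (F[X] ⊗[F] L) u v) =
      LieAlgebra.ad F[X] (F[X] ⊗[F] L') ((A : L →ₗ[F] L').lTensor F[X] u)
        ((A : L →ₗ[F] L').lTensor F[X] v) := by
  induction u with
  | zero => simp
  | add u₁ u₂ h₁ h₂ => simp only [map_add, LinearMap.add_apply, h₁, h₂]
  | tmul f a =>
    induction v with
    | zero => simp
    | add v₁ v₂ h₁ h₂ => simp only [map_add, h₁, h₂]
    | tmul g b => simp [LieAlgebra.ad_apply]

lemma coeffX_lTensor (A : L →ₗ⁅F⁆ L') (n : ℕ) (u : F[X] ⊗[F] L) :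
    coeffX F L' n ((A : L →ₗ[F] L').lTensor F[X] u) = A (coeffX F L n u) := by
  induction u with
  | zero => simp
  | add u₁ u₂ h₁ h₂ => simp [h₁, h₂]
  | tmul f a => simp

lemma lTensor_ad_pow (A : L →ₗ⁅F⁆ L') (u v : F[X] ⊗[F] L) (n : ℕ) :
    (A : L →ₗ[F] L').lTensor F[X] (((LieAlgebra.ad F[X] (F[X] ⊗[F] L) u) ^ n) v) =
      ((LieAlgebra.ad F[X] (F[X] ⊗[F] L') ((A : L →ₗ[F] L').lTensor F[X] u)) ^ n)
        ((A : L →ₗ[F] L').lTensor F[X] v) := by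
  induction n with
  | zero => simp
  | succ n ih =>
    rw [pow_succ', pow_succ', Module.End.mul_apply, Module.End.mul_apply, lTensor_ad, ih]

/-- Extension of scalars makes `A` commute with the generic adjoint map and with taking
coefficients. This is what makes conjugates of `[p]`-maps again `[p]`-maps. -/
lemma map_jacobsonSum (A : L →ₗ⁅F⁆ L') (p : ℕ) (a b : L) :
    A (jacobsonSum F p a b) = jacobsonSum F p (A a) (A b) := by
  simp only [jacobsonSum, map_sum]
  refine Finset.sum_congr rfl fun i _ => ?_
  simp only [jacobsonTerm, map_smul]
  rw [← coeffX_lTensor, lTensor_ad_pow]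
  simp

end Jacobson

/-! ### `[p]`-maps, their values on a basis, and the reduction of the classification to bases. -/

section PMaps

variable {F L : Type*} [Field F] [LieRing L] [LieAlgebra F L] {p : ℕ} {φ ψ : L → L}

lemma IsPMap.add (h : IsPMap F p φ) (a b : L) : φ (a + b) = φ a + φ b + jacobsonSum F p a b :=
  h.map_add a b

lemma IsPMap.lie_eq_zero (h : IsPMap F p φ) (hL : ∀ a : L, (LieAlgebra.ad F L a) ^ p = 0)
    (a b : L) : ⁅φ a, b⁆ = 0 := by
  have := h.ad_pow a
  rw [hL] at this
  simpa using (LinearMap.congr_fun this b).symm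

lemma IsPMap.map_zero (h : IsPMap F p φ) (hp : p ≠ 0) : φ 0 = 0 := by
  simpa [hp] using h.map_smul 0 0

/-- Conjugating a `[p]`-map by an automorphism gives a `[p]`-map. -/
lemma IsPMap.conj (h : IsPMap F p φ) (A : L ≃ₗ⁅F⁆ L) :
    IsPMap F p (fun a => A (φ (A.symm a))) where
  ad_pow a := by
    ext b
    have key : ∀ (n : ℕ) (c b : L), ((LieAlgebra.ad F L (A c)) ^ n) (A b) =
        A (((LieAlgebra.ad F L c) ^ n) b) := by
      intro n c b
      induction n with
      | zero => simp
      | succ n ih =>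
        rw [pow_succ', pow_succ', Module.End.mul_apply, Module.End.mul_apply, ih,
          LieAlgebra.ad_apply, LieAlgebra.ad_apply, LieEquiv.map_lie]
    have := key p (A.symm a) (A.symm b)
    rw [A.apply_symm_apply, A.apply_symm_apply, h.ad_pow (A.symm a)] at this
    rw [this, LieAlgebra.ad_apply, LieAlgebra.ad_apply, LieEquiv.map_lie, A.apply_symm_apply]
  map_smul c a := by simp [h.map_smul]
  map_add a b := by
    have := map_jacobsonSum (A : L →ₗ⁅F⁆ L) p (A.symm a) (A.symm b)
    simp only [LieEquiv.coe_toLieHom, LieEquiv.apply_symm_apply] at this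
    change A (φ (A.symm (a + b))) = _ + _ + jacobsonSum F p a b
    rw [_root_.map_add, h.add, _root_.map_add, _root_.map_add, this]

/-- The defect of additivity is the same for both maps, so agreement passes to sums and to scalar
multiples. -/
lemma IsPMap.ext_basis {ι : Type*} (hp : p ≠ 0) (x : Module.Basis ι F L) (h : IsPMap F p φ)
    (h' : IsPMap F p ψ) (hx : ∀ k, φ (x k) = ψ (x k)) : φ = ψ := by
  funext a
  have ha : a ∈ Submodule.span F (Set.range x) := by simp [x.span_eq]
  induction ha using Submodule.span_induction with
  | mem a ha => obtain ⟨k, rfl⟩ := ha; exact hx k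
  | zero => rw [h.map_zero hp, h'.map_zero hp]
  | add a b _ _ iha ihb => rw [h.add, h'.add, iha, ihb]
  | smul c a _ iha => rw [h.map_smul, h'.map_smul, iha]

/-- The `p`-semilinear map with prescribed values on a basis. -/
noncomputable def semilinearExtension {ι : Type*} [Fintype ι] (p : ℕ) (x : Module.Basis ι F L)
    (v : ι → L) (a : L) : L :=
  ∑ k, (x.repr a k) ^ p • v k

lemma semilinearExtension_add {ι : Type*} [Fintype ι] [CharP F p] [Fact p.Prime]
    (x : Module.Basis ι F L) (v : ι → L) (a b : L) :
    semilinearExtension p x v (a + b) =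
      semilinearExtension p x v a + semilinearExtension p x v b := by
  simp [semilinearExtension, add_pow_char, add_smul, Finset.sum_add_distrib]

lemma semilinearExtension_basis {ι : Type*} [Fintype ι] [DecidableEq ι] (hp : p ≠ 0)
    (x : Module.Basis ι F L) (v : ι → L) (k : ι) :
    semilinearExtension p x v (x k) = v k := by
  simp [semilinearExtension, Finsupp.single_apply, ite_pow, hp]

/-- Adding a central `p`-semilinear map to a `[p]`-map gives a `[p]`-map. -/
lemma IsPMap.add_semilinearExtension {ι : Type*} [Fintype ι] [CharP F p] [Fact p.Prime]
    (h : IsPMap F p φ) (x : Module.Basis ι F L) (v : ι → L) (hv : ∀ k (a : L), ⁅v k, a⁆ = 0) :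
    IsPMap F p (fun a => φ a + semilinearExtension p x v a) where
  ad_pow a := by
    rw [h.ad_pow]
    ext b
    simp [semilinearExtension, hv]
  map_smul c a := by simp [h.map_smul, semilinearExtension, mul_pow, mul_smul, Finset.smul_sum]
  map_add a b := by
    change _ = _ + _ + jacobsonSum F p a b
    rw [h.add, semilinearExtension_add]
    abel

/-- If there is a `[p]`-map vanishing on a basis, then there is one with arbitrary prescribed
central values on that basis. -/
lemma existsUnique_realizes [CharP F p] [Fact p.Prime] {n : ℕ} (x : Module.Basis (Fin n) F L)
    (h : IsPMap F p φ) (h0 : ∀ k, φ (x k) = 0) (v : Fin n → L)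
    (hv : ∀ k (a : L), ⁅v k, a⁆ = 0) : ∃! ψ : L → L, Realizes p x v ψ := by
  have hp : p ≠ 0 := (Fact.out : p.Prime).ne_zero
  have key := h.add_semilinearExtension x v hv
  refine ⟨_, ⟨key, fun k => ?_⟩, fun ψ hψ => hψ.1.ext_basis hp x key fun k => ?_⟩
  · simp [h0, semilinearExtension_basis hp]
  · simp [hψ.2, h0, semilinearExtension_basis hp]

lemma Equivalent.symm (h : Equivalent F φ ψ) : Equivalent F ψ φ := by
  obtain ⟨A, hA⟩ := h
  exact ⟨A.symm, fun a => by
    rw [LieEquiv.symm_apply_eq, hA, A.apply_symm_apply]⟩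

lemma Equivalent.refl (φ : L → L) : Equivalent F φ φ := ⟨LieEquiv.refl, fun _ => rfl⟩

/-- The Lie algebra automorphism carrying one basis to another with the same brackets. -/
noncomputable def lieEquivOfBases {ι : Type*} (x y : Module.Basis ι F L)
    (h : ∀ i j, x.equiv y (Equiv.refl ι) ⁅x i, x j⁆ = ⁅y i, y j⁆) : L ≃ₗ⁅F⁆ L :=
  { x.equiv y (Equiv.refl ι) with
    map_lie' := by
      let e : L →ₗ[F] L := x.equiv y (Equiv.refl ι)
      intro a b
      have : (LieModule.toEnd F L L : L →ₗ[F] Module.End F L).compr₂ e =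
          ((LieModule.toEnd F L L : L →ₗ[F] Module.End F L).compl₁₂ e e) := by
        refine x.ext fun i => x.ext fun j => ?_
        simpa [e] using h i j
      exact LinearMap.congr_fun (LinearMap.congr_fun this a) b }

lemma lieEquivOfBases_apply {ι : Type*} (x y : Module.Basis ι F L)
    (h : ∀ i j, x.equiv y (Equiv.refl ι) ⁅x i, x j⁆ = ⁅y i, y j⁆) (a : L) :
    lieEquivOfBases x y h a = x.equiv y (Equiv.refl ι) a := rfl

/-- A `[p]`-map with the values of a table on a basis having the same brackets as `x` is
equivalent to the map realizing the table on `x`. -/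
lemma exists_realizes_equivalent {n : ℕ} (x y : Module.Basis (Fin n) F L)
    (hxy : ∀ i j, x.equiv y (Equiv.refl _) ⁅x i, x j⁆ = ⁅y i, y j⁆) (hφ : IsPMap F p φ)
    (v : Fin n → L) (hv : ∀ k, φ (y k) = x.equiv y (Equiv.refl _) (v k)) :
    ∃ ψ, Realizes p x v ψ ∧ Equivalent F φ ψ := by
  have hx : ∀ k, lieEquivOfBases x y hxy (x k) = y k := fun k => by
    simp [lieEquivOfBases_apply]
  refine ⟨_, ⟨hφ.conj (lieEquivOfBases x y hxy).symm, fun k => ?_⟩,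
    (lieEquivOfBases x y hxy).symm, fun a => ?_⟩
  · rw [LieEquiv.symm_symm, hx, LieEquiv.symm_apply_eq, hv, lieEquivOfBases_apply]
  · simp only [LieEquiv.symm_symm, LieEquiv.apply_symm_apply]

/-- A way to establish a classification: `S` expresses the bracket table. -/
lemma classifies_of_tables [CharP F p] [Fact p.Prime] {n : ℕ} {ι : Type*}
    (S : Module.Basis (Fin n) F L → Prop)
    (hS : ∀ x y : Module.Basis (Fin n) F L, S x → S y → ∀ i j, x.equiv y (Equiv.refl _) ⁅x i, x j⁆ = ⁅y i, y j⁆)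
    (v : Module.Basis (Fin n) F L → ι → Fin n → L)
    (hvS : ∀ (x y : Module.Basis (Fin n) F L) i k, x.equiv y (Equiv.refl _) (v x i k) = v y i k)
    (x : Module.Basis (Fin n) F L) (hx : S x)
    (hφ : ∃ φ : L → L, IsPMap F p φ ∧ ∀ k, φ (x k) = 0) (r : ι → ι → Prop)
    (hv : ∀ i k (a : L), ⁅v x i k, a⁆ = 0)
    (nilpotent : ∀ i φ, Realizes p x (v x i) φ → IsPNilpotent φ)
    (complete : ∀ φ : L → L, IsPMap F p φ → IsPNilpotent φ →
      ∃ i y, S y ∧ ∀ k, φ (y k) = v y i k)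
    (sufficient : ∀ i j φ, r i j → i ≠ j → Realizes p x (v x j) φ →
      ∃ y, S y ∧ ∀ k, φ (y k) = v y i k)
    (necessary : ∀ i j φ ψ, Realizes p x (v x i) φ → Realizes p x (v x j) ψ →
      Equivalent F φ ψ → r i j) : Classifies p x (v x) r where
  exists_unique i := by
    obtain ⟨φ, h, h0⟩ := hφ
    exact existsUnique_realizes x h h0 _ (hv i)
  nilpotent := nilpotent
  complete φ h hn := by
    obtain ⟨i, y, hy, hyv⟩ := complete φ h hn
    obtain ⟨ψ, h⟩ := exists_realizes_equivalent x y (hS x y hx hy) h (v x i)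
      fun k => by rw [hyv, hvS]
    exact ⟨i, ψ, h⟩
  equivalent_iff i j φ ψ hi hj := by
    have hp : p ≠ 0 := (Fact.out : p.Prime).ne_zero
    refine ⟨necessary i j φ ψ hi hj, fun hij => ?_⟩
    -- Realizations of one table coincide, so only distinct indices require a change of basis.
    by_cases hne : i = j
    · subst hne
      rw [hi.1.ext_basis hp x hj.1 fun k => by rw [hi.2, hj.2]]
      exact Equivalent.refl _
    -- On `y` the map `ψ` has the values of table `i`. Transported to `x` it realizes that table, so
    -- the result is `φ` by uniqueness.
    · obtain ⟨y, hy, hyv⟩ := sufficient i j ψ hij hne hj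
      obtain ⟨φ', h, h'⟩ := exists_realizes_equivalent x y (hS x y hx hy) hj.1 (v x i)
        fun k => by rw [hyv, hvS]
      rw [hi.1.ext_basis hp x h.1 fun k => by rw [hi.2, h.2]]
      exact h'.symm

/-- A nilpotent map has no nonempty invariant set avoiding zero. -/
lemma IsPNilpotent.zero_mem (h : IsPNilpotent φ) {S : Set L} (hS : ∀ a ∈ S, φ a ∈ S) {a : L}
    (ha : a ∈ S) : (0 : L) ∈ S := by
  obtain ⟨n, hn⟩ := h
  rw [← hn a]
  clear hn
  induction n generalizing a with
  | zero => exact ha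
  | succ n ih => exact ih (hS a ha)

/-- If `c` and `a` were nonzero, the nonzero multiples of `a` would form an invariant set avoiding
zero. -/
lemma IsPNilpotent.eq_zero_of_apply_eq_smul (h : IsPNilpotent φ) (hφ : IsPMap F p φ) {a : L}
    {c : F} (hc : φ a = c • a) : φ a = 0 := by
  by_contra hne
  have hc0 : c ≠ 0 := by rintro rfl; simp [hc] at hne
  have ha : a ≠ 0 := by rintro rfl; simp [hc] at hne
  obtain ⟨d, hd, hd'⟩ := h.zero_mem (S := {b | ∃ d : F, d ≠ 0 ∧ b = d • a}) (a := a) (by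
    rintro _ ⟨d, hd, rfl⟩
    exact ⟨d ^ p * c, mul_ne_zero (pow_ne_zero _ hd) hc0, by
      rw [hφ.map_smul, hc, mul_smul]⟩) ⟨1, one_ne_zero, (one_smul _ _).symm⟩
  exact smul_ne_zero hd ha hd'.symm

lemma exists_pow_eq (p : ℕ) [Fact p.Prime] [CharP F p] [PerfectField F] (c : F) :
    ∃ d : F, d ^ p = c := by
  have := PerfectField.toPerfectRing p (K := F)
  exact (bijective_frobenius F p).2 c

end PMaps

/-! ### Linear algebra: bases with three or four given vectors. -/

section Bases

variable {F V : Type*} [Field F] [AddCommGroup V] [Module F V]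

lemma exists_basis_eq {n : ℕ} (hn : n ≠ 0) (h : Module.finrank F V = n) (v : Fin n → V)
    (hv : LinearIndependent F v) : ∃ y : Module.Basis (Fin n) F V, ∀ k, y k = v k := by
  have : Nonempty (Fin n) := ⟨⟨0, Nat.pos_of_ne_zero hn⟩⟩
  exact ⟨basisOfLinearIndependentOfCardEqFinrank hv (by simp [h]), fun k => by simp⟩

lemma exists_basis_three (h : Module.finrank F V = 3) (v₁ v₂ v₃ : V)
    (hv : ∀ c d e : F, c • v₁ + d • v₂ + e • v₃ = 0 → c = 0 ∧ d = 0 ∧ e = 0) :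
    ∃ y : Module.Basis (Fin 3) F V, y 0 = v₁ ∧ y 1 = v₂ ∧ y 2 = v₃ := by
  obtain ⟨y, hy⟩ := exists_basis_eq three_ne_zero h ![v₁, v₂, v₃] (by
    rw [Fintype.linearIndependent_iff]
    intro g hg
    simp only [Fin.sum_univ_three] at hg
    have := hv _ _ _ hg
    intro i
    fin_cases i <;> simp [this])
  exact ⟨y, hy 0, hy 1, hy 2⟩

lemma exists_basis_four (h : Module.finrank F V = 4) (v₁ v₂ v₃ v₄ : V)
    (hv : ∀ c d e f : F, c • v₁ + d • v₂ + e • v₃ + f • v₄ = 0 →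
      c = 0 ∧ d = 0 ∧ e = 0 ∧ f = 0) :
    ∃ y : Module.Basis (Fin 4) F V, y 0 = v₁ ∧ y 1 = v₂ ∧ y 2 = v₃ ∧ y 3 = v₄ := by
  obtain ⟨y, hy⟩ := exists_basis_eq four_ne_zero h ![v₁, v₂, v₃, v₄] (by
    rw [Fintype.linearIndependent_iff]
    intro g hg
    simp only [Fin.sum_univ_four] at hg
    have := hv _ _ _ _ hg
    intro i
    fin_cases i <;> simp [this])
  exact ⟨y, hy 0, hy 1, hy 2, hy 3⟩

lemma finrank_le_of_forall_eq_sum {n : ℕ} (v : Fin n → V)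
    (hv : ∀ w, ∃ c : Fin n → F, w = ∑ i, c i • v i) : Module.finrank F V ≤ n := by
  have : Submodule.span F (Set.range v) = ⊤ := by
    rw [eq_top_iff]
    rintro w -
    obtain ⟨c, rfl⟩ := hv w
    exact Submodule.sum_mem _ fun i _ =>
      Submodule.smul_mem _ _ (Submodule.subset_span ⟨i, rfl⟩)
  simpa using finrank_le_of_span_eq_top this

lemma exists_ne_smul_add_two (h : 2 < Module.finrank F V) (v₁ v₂ : V) :
    ∃ w : V, ∀ c d : F, w ≠ c • v₁ + d • v₂ := by
  by_contra! hw
  refine absurd (finrank_le_of_forall_eq_sum (F := F) ![v₁, v₂] fun w => ?_) (not_le.2 h)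
  obtain ⟨c, d, h⟩ := hw w
  exact ⟨![c, d], by simpa using h⟩

lemma exists_ne_smul_add_three (h : 3 < Module.finrank F V) (v₁ v₂ v₃ : V) :
    ∃ w : V, ∀ c d e : F, w ≠ c • v₁ + d • v₂ + e • v₃ := by
  by_contra! hw
  refine absurd (finrank_le_of_forall_eq_sum (F := F) ![v₁, v₂, v₃] fun w => ?_) (not_le.2 h)
  obtain ⟨c, d, e, h⟩ := hw w
  exact ⟨![c, d, e], by simpa [Fin.sum_univ_three] using h⟩

lemma eq_smul_of_add_smul_eq_zero {v w : V} {c : F} (hc : c ≠ 0) (h : v + c • w = 0) :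
    w = -c⁻¹ • v := by
  rw [neg_smul, ← smul_neg, eq_inv_smul_iff₀ hc]
  exact eq_neg_of_add_eq_zero_right h

end Bases

/-! ### Nilpotent Lie algebras of dimension at most four. -/

section Structure

variable {F L : Type*} [Field F] [LieRing L] [LieAlgebra F L]

/-- Otherwise every noncentral `y` has a noncentral bracket `[a, y]`, and iteration puts a
noncentral element into every term of the lower central series. -/
lemma exists_mem_second_center (F : Type*) {L : Type*} [Field F] [LieRing L] [LieAlgebra F L]
    [LieRing.IsNilpotent L] (h : ¬ IsLieAbelian L) :
    ∃ y : L, (∃ a : L, ⁅a, y⁆ ≠ 0) ∧ ∀ a b : L, ⁅b, ⁅a, y⁆⁆ = 0 := by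
  by_contra! hc
  have key : ∀ k, ∃ y ∈ LieModule.lowerCentralSeries F L L k, ∃ a : L, ⁅a, y⁆ ≠ 0 := by
    intro k
    induction k with
    | zero =>
      by_contra! h'
      exact h ⟨fun a b => h' b (by simp) a⟩
    | succ k ih =>
      obtain ⟨y, hy, hya⟩ := ih
      obtain ⟨a, b, hb⟩ := hc y hya
      refine ⟨⁅a, y⁆, ?_, b, hb⟩
      rw [LieModule.lowerCentralSeries_succ]
      exact LieSubmodule.lie_mem_lie (LieSubmodule.mem_top a) hy
  obtain ⟨k, hk⟩ := LieModule.IsNilpotent.nilpotent F L L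
  obtain ⟨y, hy, a, ha⟩ := key k
  rw [hk, LieSubmodule.mem_bot] at hy
  simp [hy] at ha

lemma exists_ad_pow_eq_zero (F : Type*) {L : Type*} [Field F] [LieRing L] [LieAlgebra F L]
    [LieRing.IsNilpotent L] (a : L) : ∃ k : ℕ, (LieAlgebra.ad F L a) ^ k = 0 :=
  LieModule.isNilpotent_toEnd_of_isNilpotent F L L a

/-- If `[x, y] = z ≠ 0` is central, then `x`, `y`, `z` are linearly independent modulo any
relation inside the centre. -/
lemma coeff_eq_zero_of_lie {x y z c' : L} (hz : ⁅x, y⁆ = z) (hz0 : z ≠ 0)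
    (hc' : ∀ a : L, ⁅a, c'⁆ = 0) {c d : F} (h : c • x + d • y + c' = 0) :
    c = 0 ∧ d = 0 ∧ c' = 0 := by
  have h1 : ⁅c • x + d • y + c', y⁆ = 0 := by rw [h, zero_lie]
  have h2 : ⁅x, c • x + d • y + c'⁆ = 0 := by rw [h, lie_zero]
  rw [add_lie, ← lie_skew c' y, hc'] at h1
  rw [lie_add, hc'] at h2
  have hc : c = 0 := by simpa [hz, hz0] using h1
  have hd : d = 0 := by simpa [hz, hz0] using h2
  subst hc hd
  simpa using h

/-- In a nilpotent Lie algebra, `[a, b] ≡ c a + d b` modulo an ideal `I` containing neither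
forces `d = 0`. -/
lemma lie_coeff_eq_zero [LieRing.IsNilpotent L] (I : Submodule F L) {a b : L}
    (hI : ∀ i ∈ I, ⁅a, i⁆ ∈ I) (hb : ∀ c d : F, c • a + d • b ∈ I → d = 0) {c d : F}
    (h : ⁅a, b⁆ - (c • a + d • b) ∈ I) : d = 0 := by
  obtain ⟨k, hk⟩ := exists_ad_pow_eq_zero F a
  have key : ∀ n : ℕ, ∃ e : F, (LieAlgebra.ad F L a ^ n) b - (e • a + d ^ n • b) ∈ I := by
    intro n
    induction n with
    | zero => exact ⟨0, by simp⟩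
    | succ n ih =>
      obtain ⟨e, he⟩ := ih
      -- Modulo `I`, `[a, e a + d ^ n b] = d ^ n [a, b]` is `d ^ n (c a + d b)`.
      refine ⟨d ^ n * c, ?_⟩
      have h1 := I.add_mem (hI _ he) (I.smul_mem (d ^ n) h)
      convert h1 using 1
      rw [pow_succ', Module.End.mul_apply, LieAlgebra.ad_apply]
      simp only [lie_sub, lie_add, lie_smul, lie_self, smul_zero, zero_add, smul_sub, smul_add,
        smul_smul, pow_succ]
      abel
  obtain ⟨e, he⟩ := key k
  rw [hk] at he
  have : (-e) • a + (-d ^ k) • b ∈ I := by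
    convert he using 1
    simp only [neg_smul, LinearMap.zero_apply]
    abel
  -- For `k = 0` the relation already says that the coefficient `-1` of `b` is zero, which is
  -- absurd.
  exact (pow_eq_zero_iff (n := k) (by
    rintro rfl
    simpa using hb _ _ this)).1 (neg_eq_zero.1 (hb _ _ this))

/-- The nonabelian nilpotent Lie algebras of dimension at most four. -/
theorem exists_basis_of_not_isLieAbelian [LieRing.IsNilpotent L] (hpos : 1 ≤ Module.finrank F L)
    (hdim : Module.finrank F L ≤ 4) (h : ¬ IsLieAbelian L) :
    (∃ x : Module.Basis (Fin 3) F L, IsL32 x) ∨ (∃ x : Module.Basis (Fin 4) F L, IsL42 x) ∨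
      (∃ x : Module.Basis (Fin 4) F L, IsL43 x) := by
  have : Module.Finite F L := Module.finite_of_finrank_pos hpos
  -- Since `y` lies in the second centre, `z = [x, y]` is central, and `x`, `y`, `z` span a
  -- Heisenberg subalgebra.
  obtain ⟨y, ⟨x, hxy⟩, hy⟩ := exists_mem_second_center F h
  obtain ⟨z, hz⟩ : ∃ z, ⁅x, y⁆ = z := ⟨_, rfl⟩
  have hz0 : z ≠ 0 := hz ▸ hxy
  have hzc : ∀ a : L, ⁅a, z⁆ = 0 := fun a => hz ▸ hy x a
  have hind : ∀ c d e : F, c • x + d • y + e • z = 0 → c = 0 ∧ d = 0 ∧ e = 0 := by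
    intro c d e hc
    obtain ⟨h1, h2, h3⟩ := coeff_eq_zero_of_lie hz hz0 (fun a => by simp [hzc]) hc
    exact ⟨h1, h2, by simpa [hz0] using h3⟩
  have h3 : 3 ≤ Module.finrank F L := by
    have : LinearIndependent F ![x, y, z] := by
      rw [Fintype.linearIndependent_iff]
      intro g hg
      simp only [Fin.sum_univ_three] at hg
      have := hind _ _ _ hg
      intro i
      fin_cases i <;> simp [this]
    simpa using this.fintype_card_le_finrank
  obtain hn | hn : Module.finrank F L = 3 ∨ Module.finrank F L = 4 := by omega
  · left
    obtain ⟨b, h0, h1, h2⟩ := exists_basis_three hn x y z hind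
    exact ⟨b, by rw [h0, h1, h2, hz], by rw [h2, hzc], by rw [h2, hzc]⟩
  right
  have hzc' : ∀ a : L, ⁅z, a⁆ = 0 := fun a => by rw [← lie_skew, hzc, neg_zero]
  -- In dimension four, a central element outside `F z` gives `L_{4,2}`; if the centre is just `F
  -- z`, the algebra is `L_{4,3}`.
  by_cases hZ : ∃ z' : L, (∀ a : L, ⁅a, z'⁆ = 0) ∧ ∀ c : F, z' ≠ c • z
  · left
    obtain ⟨z', hzc2, hz2⟩ := hZ
    obtain ⟨b, h0, h1, h2, h3⟩ := exists_basis_four hn x y z z' (by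
      intro c d e f hc
      rw [add_assoc] at hc
      obtain ⟨h1, h2, h3⟩ := coeff_eq_zero_of_lie hz hz0 (fun a => by simp [hzc, hzc2]) hc
      have hf : f = 0 := by
        by_contra hf
        have := eq_smul_of_add_smul_eq_zero hf h3
        rw [smul_smul] at this
        exact hz2 _ this
      subst hf
      exact ⟨h1, h2, by simpa [hz0] using h3, rfl⟩)
    exact ⟨b, by rw [h0, h1, h2, hz], by rw [h2, hzc], by rw [h3, hzc2], by rw [h2, hzc],
      by rw [h3, hzc2], by rw [h3, hzc2]⟩
  right
  push Not at hZ
  -- For any fourth vector, `[w, y]` is central, hence some `l z = [l x, y]`; subtracting `l x`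
  -- makes it commute with `y`.
  obtain ⟨w, hwy, hw⟩ : ∃ w : L, ⁅w, y⁆ = 0 ∧ ∀ c d e : F, w ≠ c • x + d • y + e • z := by
    obtain ⟨w, hw⟩ := exists_ne_smul_add_three (F := F) (by omega) x y z
    obtain ⟨l, hl⟩ := hZ ⁅w, y⁆ (hy w)
    refine ⟨w - l • x, by simp [hl, hz], fun c d e he => hw (c + l) d e ?_⟩
    rw [sub_eq_iff_eq_add] at he
    rw [he, add_smul]
    abel
  have hind' : ∀ c d e f : F, c • x + d • w + e • y + f • z = 0 →
      c = 0 ∧ d = 0 ∧ e = 0 ∧ f = 0 := by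
    intro c d e f hc
    have hd : d = 0 := by
      by_contra hd
      refine hw (-d⁻¹ * c) (-d⁻¹ * e) (-d⁻¹ * f) ?_
      have := eq_smul_of_add_smul_eq_zero (v := c • x + e • y + f • z) (w := w) hd
        (by rw [← hc]; abel)
      rw [this]
      simp only [smul_add, smul_smul]
    subst hd
    obtain ⟨h1, h2, h3⟩ := hind c e f (by simpa using hc)
    exact ⟨h1, rfl, h2, h3⟩
  obtain ⟨B, h0, h1, h2, h3⟩ := exists_basis_four hn x w y z hind'
  obtain ⟨a, b, c, d, hxw⟩ : ∃ a b c d : F, ⁅x, w⁆ = a • x + b • w + c • y + d • z := by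
    refine ⟨_, _, _, _, (?_ : _ = B.repr ⁅x, w⁆ 0 • x + B.repr ⁅x, w⁆ 1 • w +
      B.repr ⁅x, w⁆ 2 • y + B.repr ⁅x, w⁆ 3 • z)⟩
    conv_lhs => rw [← B.sum_repr ⁅x, w⁆, Fin.sum_univ_four, h0, h1, h2, h3]
  have hI : ∀ g : L, ∀ i ∈ Submodule.span F {y, z}, ⁅g, i⁆ ∈ Submodule.span F {y, z} := by
    intro g i hi
    obtain ⟨e, f, rfl⟩ := Submodule.mem_span_pair.1 hi
    obtain ⟨l, hl⟩ := hZ ⁅g, y⁆ (hy g)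
    refine Submodule.mem_span_pair.2 ⟨0, e * l, ?_⟩
    simp [hzc, hl, mul_smul]
  -- Modulo the ideal spanned by `y` and `z`, nilpotency of `ad x` removes the coefficient of `w` in
  -- `[x, w]`; nilpotency of `ad w` then removes that of `x`.
  have hb : b = 0 := by
    refine lie_coeff_eq_zero (Submodule.span F {y, z}) (hI x) (b := w) (c := a) ?_ ?_
    · intro e f hef
      obtain ⟨e', f', h'⟩ := Submodule.mem_span_pair.1 hef
      refine (hind' e f (-e') (-f') ?_).2.1
      rw [add_assoc, ← sub_eq_zero.2 h'.symm]
      simp only [neg_smul]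
      abel
    · refine Submodule.mem_span_pair.2 ⟨c, d, ?_⟩
      rw [hxw]
      abel
  have ha : -a = 0 := by
    refine lie_coeff_eq_zero (Submodule.span F {y, z}) (hI w) (b := x) (c := -b) ?_ ?_
    · intro e f hef
      obtain ⟨e', f', h'⟩ := Submodule.mem_span_pair.1 hef
      refine (hind' f e (-e') (-f') ?_).1
      rw [add_assoc, ← sub_eq_zero.2 h'.symm]
      simp only [neg_smul]
      abel
    · refine Submodule.mem_span_pair.2 ⟨-c, -d, ?_⟩
      rw [← lie_skew, hxw]
      simp only [neg_smul]
      abel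
  rw [neg_eq_zero] at ha
  subst ha hb
  simp only [zero_smul, zero_add] at hxw
  -- If `c = 0`, then `[x, w] = d z = [x, d y]`, so `w - d y` would be central and therefore a
  -- multiple of `z`.
  have hc : c ≠ 0 := by
    rintro rfl
    obtain ⟨l, hl⟩ := hZ (w - d • y) (by
      intro g
      have hg := B.sum_repr g
      rw [Fin.sum_univ_four, h0, h1, h2, h3] at hg
      have hyw : ⁅y, w⁆ = 0 := by rw [← lie_skew, hwy, neg_zero]
      rw [← hg]
      simp [hxw, hz, hwy, hyw, hzc', smul_comm d])
    refine hw 0 d l ?_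
    rw [sub_eq_iff_eq_add] at hl
    rw [hl, zero_smul, zero_add, add_comm]
  have hx3 : ⁅x, c • y + d • z⁆ = c • z := by simp [hz, hzc]
  -- The generators are `x` and `w`; the other two vectors are `[x, w]` and `[x, [x, w]]`.
  obtain ⟨B', h0, h1, h2, h3⟩ := exists_basis_four hn x w (c • y + d • z) (c • z) (by
    intro e f g k hk
    obtain ⟨e0, f0, g0, k0⟩ := hind' e f (g * c) (g * d + k * c) (by
      rw [← hk]
      simp only [smul_add, add_smul, mul_smul]
      abel)
    obtain rfl : g = 0 := by simpa [hc] using g0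
    exact ⟨e0, f0, rfl, by simpa [hc] using k0⟩)
  exact ⟨B', by rw [h0, h1, h2, hxw], by rw [h0, h2, h3, hx3], by rw [h3, lie_smul, hzc, smul_zero],
    by rw [h1, h2, lie_add, lie_smul, lie_smul, hwy, hzc, smul_zero, smul_zero, add_zero],
    by rw [h3, lie_smul, hzc, smul_zero], by rw [h3, lie_smul, hzc, smul_zero]⟩

end Structure

/-! ### Invariants of equivalence: nilpotency index and rank. -/

section Invariants

variable {F L : Type*} [Field F] [LieRing L] [LieAlgebra F L] {φ ψ : L → L}

lemma apply_iterate_eq_iterate_apply {A : L ≃ₗ⁅F⁆ L} (hA : ∀ a, A (φ a) = ψ (A a)) (n : ℕ)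
    (a : L) : A (φ^[n] a) = ψ^[n] (A a) := by
  induction n generalizing a with
  | zero => rfl
  | succ n ih => rw [Function.iterate_succ_apply, Function.iterate_succ_apply, ih, hA]

lemma forall_iterate_eq_zero_of_equivalent (h : Equivalent F φ ψ) {n : ℕ}
    (hφ : ∀ a, φ^[n] a = 0) (a : L) : ψ^[n] a = 0 := by
  obtain ⟨A, hA⟩ := h
  rw [← A.apply_symm_apply a, ← apply_iterate_eq_iterate_apply hA, hφ, map_zero]

lemma Equivalent.forall_iterate_iff (h : Equivalent F φ ψ) (n : ℕ) :
    (∀ a, φ^[n] a = 0) ↔ ∀ a, ψ^[n] a = 0 :=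
  ⟨forall_iterate_eq_zero_of_equivalent h, forall_iterate_eq_zero_of_equivalent h.symm⟩

lemma exists_forall_eq_smul_of_equivalent (h : Equivalent F φ ψ)
    (hφ : ∃ y : L, ∀ a, ∃ c : F, φ a = c • y) : ∃ y : L, ∀ a, ∃ c : F, ψ a = c • y := by
  obtain ⟨A, hA⟩ := h
  obtain ⟨y, hy⟩ := hφ
  refine ⟨A y, fun a => ?_⟩
  obtain ⟨c, hc⟩ := hy (A.symm a)
  exact ⟨c, by rw [← A.apply_symm_apply a, ← hA, hc, map_smul]⟩

lemma IsPMap.iterate_smul {p : ℕ} (h : IsPMap F p φ) (n : ℕ) (c : F) (a : L) :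
    φ^[n] (c • a) = c ^ p ^ n • φ^[n] a := by
  induction n generalizing c a with
  | zero => simp
  | succ n ih => simp only [Function.iterate_succ_apply, h.map_smul, ih, ← pow_mul, pow_succ']

lemma IsPNilpotent.exists_iterate_ne_zero [Nontrivial L] (hn : IsPNilpotent φ) :
    ∃ m, ∃ v : L, φ^[m] v ≠ 0 ∧ ∀ a, φ^[m + 1] a = 0 := by
  classical
  have h0 : Nat.find hn ≠ 0 := by
    intro h
    obtain ⟨a, ha⟩ := exists_ne (0 : L)
    have := Nat.find_spec hn a
    rw [h] at this
    exact ha this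
  obtain ⟨m, hm⟩ := Nat.exists_eq_succ_of_ne_zero h0
  have h1 := Nat.find_min hn (m := m) (by omega)
  push Not at h1
  obtain ⟨v, hv⟩ := h1
  refine ⟨m, v, hv, ?_⟩
  have := Nat.find_spec hn
  rwa [hm] at this

end Invariants

/-! ### Abelian algebras: normal forms of nilpotent `p`-semilinear maps. -/

section Abelian

variable {F L : Type*} [Field F] [LieRing L] [LieAlgebra F L] {p : ℕ} {φ ψ : L → L}
  [IsLieAbelian L] [Fact p.Prime]

lemma IsPMap.add_of_abelian (h : IsPMap F p φ) (a b : L) : φ (a + b) = φ a + φ b := by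
  rw [h.add, jacobsonSum_of_abelian (Fact.out : p.Prime).one_lt LieModule.IsTrivial.trivial, add_zero]

lemma isPMap_zero : IsPMap F p (fun _ : L => (0 : L)) where
  ad_pow a := by
    have : LieAlgebra.ad F L a = 0 := by
      ext b
      exact LieModule.IsTrivial.trivial a b
    rw [this, zero_pow (Fact.out : p.Prime).ne_zero, map_zero]
  map_smul c a := by simp
  map_add a b := by
    change _ = _ + _ + jacobsonSum F p a b
    rw [jacobsonSum_of_abelian (Fact.out : p.Prime).one_lt LieModule.IsTrivial.trivial]
    simp only [add_zero]

lemma IsPMap.iterate_add (h : IsPMap F p φ) (n : ℕ) (a b : L) :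
    φ^[n] (a + b) = φ^[n] a + φ^[n] b := by
  induction n generalizing a b with
  | zero => rfl
  | succ n ih => simp only [Function.iterate_succ_apply, h.add_of_abelian, ih]

lemma IsPMap.iterate_eq_zero_of_basis {ι : Type*} (x : Module.Basis ι F L) (h : IsPMap F p φ)
    {n : ℕ} (hx : ∀ k, φ^[n] (x k) = 0) (a : L) : φ^[n] a = 0 := by
  have hp : p ≠ 0 := (Fact.out : p.Prime).ne_zero
  have ha : a ∈ Submodule.span F (Set.range x) := by simp [x.span_eq]
  induction ha using Submodule.span_induction with
  | mem a ha => obtain ⟨k, rfl⟩ := ha; exact hx k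
  | zero => simpa [hp] using h.iterate_smul n 0 0
  | add a b _ _ iha ihb => rw [h.iterate_add, iha, ihb, add_zero]
  | smul c a _ iha => rw [h.iterate_smul, iha, smul_zero]

lemma IsPMap.forall_iterate_eq_zero_iff {ι : Type*} (x : Module.Basis ι F L) (h : IsPMap F p φ)
    (n : ℕ) : (∀ a, φ^[n] a = 0) ↔ ∀ k, φ^[n] (x k) = 0 :=
  ⟨fun h _ => h _, h.iterate_eq_zero_of_basis x⟩

/-- The shifted chain is independent by induction, and `v` is not in its span because the top
iterate kills that span but not `v`. -/
lemma IsPMap.linearIndependent_iterate (h : IsPMap F p φ) (m : ℕ) (v : L) (hv : φ^[m] v ≠ 0)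
    (hv' : φ^[m + 1] v = 0) : LinearIndependent F (fun i : Fin (m + 1) => φ^[i] v) := by
  induction m generalizing v with
  | zero => exact (linearIndependent_unique_iff (ι := Fin 1)).2 hv
  | succ m ih =>
    rw [linearIndependent_finSucc]
    refine ⟨ih (φ v) hv hv', fun hmem => hv ?_⟩
    have key : ∀ a ∈ Submodule.span F (Set.range (Fin.tail fun i : Fin (m + 1 + 1) => φ^[i] v)),
        φ^[m + 1] a = 0 := by
      intro a ha
      have hp : p ≠ 0 := (Fact.out : p.Prime).ne_zero
      induction ha using Submodule.span_induction with
      | mem a ha =>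
        obtain ⟨_, rfl⟩ := ha
        have h0 : ∀ n, φ^[n] 0 = 0 := fun n => by simpa [hp] using h.iterate_smul n 0 0
        simp only [Fin.tail, Fin.val_succ]
        rw [← Function.iterate_add_apply, Nat.add_left_comm,
          Function.iterate_add_apply, hv', h0]
      | zero => simpa [hp] using h.iterate_smul (m + 1) 0 0
      | add a b _ _ iha ihb => rw [h.iterate_add, iha, ihb, add_zero]
      | smul c a _ iha => rw [h.iterate_smul, iha, smul_zero]
    exact key _ hmem

lemma IsPMap.exists_chain [Module.Finite F L] [Nontrivial L] (h : IsPMap F p φ)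
    (hn : IsPNilpotent φ) : ∃ m < Module.finrank F L, (∃ v : L, φ^[m] v ≠ 0 ∧
      LinearIndependent F (fun i : Fin (m + 1) => φ^[i] v)) ∧ ∀ a, φ^[m + 1] a = 0 := by
  obtain ⟨m, v, hv, hm⟩ := hn.exists_iterate_ne_zero
  have hl := h.linearIndependent_iterate m v hv (hm v)
  refine ⟨m, ?_, ⟨v, hv, hl⟩, hm⟩
  simpa using hl.fintype_card_le_finrank

lemma IsPMap.exists_apply_sub_smul_eq_zero [CharP F p] [PerfectField F] (h : IsPMap F p φ)
    {v w : L} {c : F} (hw : φ w = c • φ v) : ∃ r : F, φ (w + r • v) = 0 := by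
  obtain ⟨r, hr⟩ := exists_pow_eq p (-c)
  exact ⟨r, by rw [h.add_of_abelian, h.map_smul, hr, hw, neg_smul, add_neg_cancel]⟩

/-- Applying `φ` to the relation leaves `c ^ p φ v + e ^ p φ w = 0`, so `c` and `e` vanish first,
and `d`, `f` afterwards. -/
lemma IsPMap.coeff_eq_zero_of_sq (h : IsPMap F p φ) (h2 : ∀ a, φ (φ a) = 0) {v w : L}
    (hv : φ v ≠ 0) (hw : ∀ c : F, φ w ≠ c • φ v) (c d e f : F)
    (hc : c • v + d • φ v + e • w + f • φ w = 0) : c = 0 ∧ d = 0 ∧ e = 0 ∧ f = 0 := by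
  have hp : p ≠ 0 := (Fact.out : p.Prime).ne_zero
  have h0 : φ 0 = 0 := h.map_zero hp
  have h1 : c ^ p • φ v + e ^ p • φ w = 0 := by
    have := congrArg φ hc
    simpa only [h.add_of_abelian, h.map_smul, h2, smul_zero, add_zero, h0] using this
  have key : ∀ a b : F, a • φ v + b • φ w = 0 → a = 0 ∧ b = 0 := by
    intro a b hab
    have hb : b = 0 := by
      by_contra hb
      have := eq_smul_of_add_smul_eq_zero hb hab
      rw [smul_smul] at this
      exact hw _ this
    subst hb
    exact ⟨by simpa [hv] using hab, rfl⟩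
  obtain ⟨hc0, he0⟩ := key _ _ h1
  rw [pow_eq_zero_iff hp] at hc0 he0
  subst hc0 he0
  obtain ⟨hd, hf⟩ := key d f (by simpa using hc)
  exact ⟨rfl, hd, rfl, hf⟩

lemma IsPMap.coeff_eq_zero_of_sq_two (h : IsPMap F p φ) (h2 : ∀ a, φ (φ a) = 0) {v : L}
    (hv : φ v ≠ 0) (c d : F) (hc : c • v + d • φ v = 0) : c = 0 ∧ d = 0 := by
  have hp : p ≠ 0 := (Fact.out : p.Prime).ne_zero
  have h0 : φ 0 = 0 := h.map_zero hp
  have h1 : c ^ p • φ v = 0 := by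
    have := congrArg φ hc
    simpa only [h.add_of_abelian, h.map_smul, h2, smul_zero, add_zero, h0] using this
  obtain rfl : c = 0 := by simpa [hv, hp] using h1
  exact ⟨rfl, by simpa [hv] using hc⟩

/-- Two independent values would produce four independent vectors, so the rank is one; a vector
outside the span of `v` and `φ v` is then moved into the kernel by a multiple of `v`. -/
lemma IsPMap.exists_basis_three_of_sq [CharP F p] [PerfectField F] (h : IsPMap F p φ)
    (hdim : Module.finrank F L = 3) (h2 : ∀ a, φ (φ a) = 0) {v : L} (hv : φ v ≠ 0) :
    ∃ y : Module.Basis (Fin 3) F L, φ (y 0) = y 1 ∧ φ (y 1) = 0 ∧ φ (y 2) = 0 := by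
  have : Module.Finite F L := Module.finite_of_finrank_pos (by omega)
  have hr : ∀ w, ∃ c : F, φ w = c • φ v := by
    by_contra! hw
    obtain ⟨w, hw⟩ := hw
    have hl : LinearIndependent F ![v, φ v, w, φ w] := by
      rw [Fintype.linearIndependent_iff]
      intro g hg
      simp only [Fin.sum_univ_four] at hg
      have := h.coeff_eq_zero_of_sq h2 hv hw _ _ _ _ hg
      intro i
      fin_cases i <;> simp [this]
    have := hl.fintype_card_le_finrank
    simp [hdim] at this
  obtain ⟨w, hw⟩ := exists_ne_smul_add_two (F := F) (by omega) v (φ v)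
  obtain ⟨c, hc⟩ := hr w
  obtain ⟨r, hrw⟩ := h.exists_apply_sub_smul_eq_zero hc
  obtain ⟨y, h0, h1, h2'⟩ := exists_basis_three hdim v (φ v) (w + r • v) (by
    intro c d e hc
    have he : e = 0 := by
      by_contra he
      have := eq_smul_of_add_smul_eq_zero he hc
      refine hw (-e⁻¹ * c - r) (-e⁻¹ * d) ?_
      rw [← eq_sub_iff_add_eq] at this
      rw [this, sub_smul, smul_add, mul_smul, mul_smul]
      abel
    subst he
    obtain ⟨hc, hd⟩ := h.coeff_eq_zero_of_sq_two h2 hv c d (by simpa using hc)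
    exact ⟨hc, hd, rfl⟩)
  exact ⟨y, by rw [h0, h1], by rw [h1, h2], by rw [h2', hrw]⟩

/-- The alternative for the third vector records whether the rank is one or two. -/
lemma IsPMap.exists_basis_four_of_sq [CharP F p] [PerfectField F] (h : IsPMap F p φ)
    (hdim : Module.finrank F L = 4) (h2 : ∀ a, φ (φ a) = 0) {v : L} (hv : φ v ≠ 0) :
    ∃ y : Module.Basis (Fin 4) F L, φ (y 0) = y 1 ∧ φ (y 1) = 0 ∧
      (φ (y 2) = 0 ∨ φ (y 2) = y 3) ∧ φ (y 3) = 0 := by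
  by_cases hr : ∀ w, ∃ c : F, φ w = c • φ v
  · have key : ∀ w, ∃ r : F, φ (w + r • v) = 0 := fun w => by
      obtain ⟨c, hc⟩ := hr w
      exact h.exists_apply_sub_smul_eq_zero hc
    obtain ⟨w, hw⟩ := exists_ne_smul_add_two (F := F) (by omega) v (φ v)
    obtain ⟨r, hr⟩ := key w
    obtain ⟨u, hu⟩ := exists_ne_smul_add_three (F := F) (by omega) v (φ v) w
    obtain ⟨s, hs⟩ := key u
    obtain ⟨y, h0, h1, h2', h3⟩ := exists_basis_four hdim v (φ v) (w + r • v) (u + s • v) (by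
      intro c d e f hc
      have hf : f = 0 := by
        by_contra hf
        have := eq_smul_of_add_smul_eq_zero hf hc
        refine hu (-f⁻¹ * c - f⁻¹ * e * r - s) (-f⁻¹ * d) (-f⁻¹ * e) ?_
        rw [← eq_sub_iff_add_eq] at this
        rw [this]
        module
      subst hf
      have he : e = 0 := by
        by_contra he
        have := eq_smul_of_add_smul_eq_zero (v := c • v + d • φ v) (w := w + r • v) he
          (by simpa only [zero_smul, add_zero] using hc)
        refine hw (-e⁻¹ * c - r) (-e⁻¹ * d) ?_
        rw [← eq_sub_iff_add_eq] at this
        rw [this]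
        module
      subst he
      obtain ⟨hc, hd⟩ := h.coeff_eq_zero_of_sq_two h2 hv c d (by simpa using hc)
      exact ⟨hc, hd, rfl, rfl⟩)
    exact ⟨y, by rw [h0, h1], by rw [h1, h2], by rw [h2', hr]; exact Or.inl rfl, by rw [h3, hs]⟩
  · push Not at hr
    obtain ⟨w, hw⟩ := hr
    obtain ⟨y, h0, h1, h2', h3⟩ := exists_basis_four hdim v (φ v) w (φ w)
      (h.coeff_eq_zero_of_sq h2 hv hw)
    exact ⟨y, by rw [h0, h1], by rw [h1, h2], by rw [h2', h3]; exact Or.inr rfl, by rw [h3, h2]⟩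

/-- A chain of length three leaves one further direction, which has to be corrected into the kernel
by elements of the chain. -/
lemma IsPMap.exists_basis_four_of_cube [CharP F p] [PerfectField F] (h : IsPMap F p φ)
    (hn : IsPNilpotent φ) (hdim : Module.finrank F L = 4) (h3 : ∀ a, φ (φ (φ a)) = 0) {v : L}
    (hv : φ (φ v) ≠ 0) : ∃ y : Module.Basis (Fin 4) F L, φ (y 0) = y 1 ∧ φ (y 1) = y 2 ∧
      φ (y 2) = 0 ∧ φ (y 3) = 0 := by
  have hp : p ≠ 0 := (Fact.out : p.Prime).ne_zero
  have hφ0 : φ 0 = 0 := h.map_zero hp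
  have hind : ∀ a b c : F, a • v + b • φ v + c • φ (φ v) = 0 → a = 0 ∧ b = 0 ∧ c = 0 := by
    intro a b c hc
    have h1 := congrArg φ hc
    have h2 := congrArg φ h1
    simp only [h.add_of_abelian, h.map_smul, h3, smul_zero, add_zero, hφ0] at h1 h2
    obtain rfl : a = 0 := by simpa [hv, hp] using h2
    obtain rfl : b = 0 := by simpa [hv, hp] using h1
    exact ⟨rfl, rfl, by simpa [hv] using hc⟩
  obtain ⟨w, hw⟩ := exists_ne_smul_add_three (F := F) (by omega) v (φ v) (φ (φ v))
  have hind4 : ∀ a b c d : F, a • v + b • φ v + c • φ (φ v) + d • w = 0 →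
      a = 0 ∧ b = 0 ∧ c = 0 ∧ d = 0 := by
    intro a b c d hc
    have hd : d = 0 := by
      by_contra hd
      have := eq_smul_of_add_smul_eq_zero hd hc
      refine hw (-d⁻¹ * a) (-d⁻¹ * b) (-d⁻¹ * c) ?_
      rw [this]
      module
    subst hd
    obtain ⟨h1, h2, h3⟩ := hind a b c (by simpa using hc)
    exact ⟨h1, h2, h3, rfl⟩
  obtain ⟨B, h0, h1, h2, h3'⟩ := exists_basis_four hdim _ _ _ _ hind4
  obtain ⟨a, b, c, d, hφw⟩ : ∃ a b c d : F,
      φ w = a • v + b • φ v + c • φ (φ v) + d • w := by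
    refine ⟨_, _, _, _, (?_ : _ = B.repr (φ w) 0 • v + B.repr (φ w) 1 • φ v +
      B.repr (φ w) 2 • φ (φ v) + B.repr (φ w) 3 • w)⟩
    conv_lhs => rw [← B.sum_repr (φ w), Fin.sum_univ_four, h0, h1, h2, h3']
  obtain rfl : d = 0 := by
    by_contra hd
    -- With `d ≠ 0`, the vectors having a nonzero coefficient at `w` form an invariant set avoiding
    -- zero.
    obtain ⟨a', b', c', e, he, h0⟩ := hn.zero_mem (a := w)
      (S := {u | ∃ a b c e : F, e ≠ 0 ∧ u = a • v + b • φ v + c • φ (φ v) + e • w}) (by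
        rintro _ ⟨a', b', c', e, he, rfl⟩
        refine ⟨e ^ p * a, a' ^ p + e ^ p * b, b' ^ p + e ^ p * c, e ^ p * d,
          mul_ne_zero (pow_ne_zero _ he) hd, ?_⟩
        simp only [h.add_of_abelian, h.map_smul, h3, hφw]
        module) ⟨0, 0, 0, 1, one_ne_zero, by simp⟩
    exact he (hind4 _ _ _ _ h0.symm).2.2.2
  -- The third iterate at `w` is `a ^ (p ^ 2)` times `φ (φ v)`.
  obtain rfl : a = 0 := by
    have := h3 w
    rw [hφw] at this
    simpa [h.add_of_abelian, h.map_smul, h3, hv, hp, hφ0] using this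
  -- Now `φ w = b φ v + c φ (φ v)`, and adding `r v + s φ v` with these roots cancels it.
  obtain ⟨r, hr⟩ := exists_pow_eq p (-b)
  obtain ⟨s, hs⟩ := exists_pow_eq p (-c)
  obtain ⟨y, h0, h1, h2, h3'⟩ := exists_basis_four hdim v (φ v) (φ (φ v))
    (w + (r • v + s • φ v)) (by
      intro c d e f hc
      obtain ⟨h1, h2, h3, rfl⟩ := hind4 (c + f * r) (d + f * s) e f (by rw [← hc]; module)
      exact ⟨by simpa using h1, by simpa using h2, h3, rfl⟩)
  refine ⟨y, by rw [h0, h1], by rw [h1, h2], by rw [h2, h3], ?_⟩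
  rw [h3', h.add_of_abelian, h.add_of_abelian, h.map_smul, h.map_smul, hr, hs, hφw]
  module

variable [CharP F p]

/-- Every bijection of bases respects the zero bracket, so only values matter; four iterations
suffice for all the tables below. -/
lemma classifies_of_isLieAbelian {n : ℕ} {ι : Type*}
    (v : Module.Basis (Fin n) F L → ι → Fin n → L)
    (hvS : ∀ (x y : Module.Basis (Fin n) F L) i k, x.equiv y (Equiv.refl _) (v x i k) = v y i k)
    (x : Module.Basis (Fin n) F L)
    (nilpotent : ∀ i φ, Realizes p x (v x i) φ → ∀ k, φ^[4] (x k) = 0)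
    (complete : ∀ φ : L → L, IsPMap F p φ → IsPNilpotent φ →
      ∃ i, ∃ y : Module.Basis (Fin n) F L, ∀ k, φ (y k) = v y i k)
    (necessary : ∀ i j φ ψ, Realizes p x (v x i) φ → Realizes p x (v x j) ψ →
      Equivalent F φ ψ → i = j) : Classifies p x (v x) (fun i j => i = j) :=
  classifies_of_tables (fun _ => True)
    (fun x y _ _ i j => by
      rw [LieModule.IsTrivial.trivial (x i), LieModule.IsTrivial.trivial (y i), map_zero])
    v hvS x trivial ⟨_, isPMap_zero, fun _ => rfl⟩ _
    (fun i k a => LieModule.IsTrivial.trivial _ _)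
    (fun i φ h => ⟨4, h.1.iterate_eq_zero_of_basis x (nilpotent i φ h)⟩)
    (fun φ h hn => by
      obtain ⟨i, y, hy⟩ := complete φ h hn
      exact ⟨i, y, trivial, hy⟩)
    (fun i j φ h h' => absurd h h') necessary

theorem classifies_one (x : Module.Basis (Fin 1) F L) :
    Classifies p x ![![0]] (fun i j : Fin 1 => i = j) := by
  refine classifies_of_isLieAbelian (fun _ => ![![0]]) ?_ x ?_ ?_ ?_
  · intro x y i k
    fin_cases i; fin_cases k; simp
  · intro i φ hi k
    have hφ0 : φ 0 = 0 := hi.1.map_zero (Fact.out : p.Prime).ne_zero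
    have h0 := hi.2
    fin_cases i
    simp only [Fin.forall_fin_one] at h0
    fin_cases k
    simp [Function.iterate_succ_apply, h0, hφ0]
  · intro φ h hn
    refine ⟨0, x, fun k => ?_⟩
    fin_cases k
    have := x.sum_repr (φ (x 0))
    rw [Fin.sum_univ_one] at this
    exact hn.eq_zero_of_apply_eq_smul h this.symm
  · intro i j _ _ _ _ _
    exact Subsingleton.elim i j

theorem classifies_two (x : Module.Basis (Fin 2) F L) :
    Classifies p x ![![0, 0], ![x 1, 0]] (fun i j : Fin 2 => i = j) := by
  have hdim : Module.finrank F L = 2 := by simp [Module.finrank_eq_card_basis x]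
  have : Nontrivial L := Module.nontrivial_of_finrank_pos (R := F) (by omega)
  have : Module.Finite F L := Module.finite_of_finrank_pos (R := F) (by omega)
  refine classifies_of_isLieAbelian (fun x => ![![0, 0], ![x 1, 0]]) ?_ x ?_ ?_ ?_
  · intro x y i k
    fin_cases i <;> fin_cases k <;> simp
  · intro i φ hi k
    have hφ0 : φ 0 = 0 := hi.1.map_zero (Fact.out : p.Prime).ne_zero
    have h0 := hi.2
    fin_cases i <;> simp only [Fin.forall_fin_two] at h0 <;> fin_cases k <;>
      simp_all [Function.iterate_succ_apply]
  · intro φ h hn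
    obtain ⟨m, hm, ⟨v, hv, hl⟩, h0⟩ := h.exists_chain hn
    rw [hdim] at hm
    interval_cases m
    · exact ⟨0, x, fun k => by fin_cases k <;> simpa using h0 _⟩
    · obtain ⟨y, hy⟩ := exists_basis_eq two_ne_zero hdim _ hl
      refine ⟨1, y, fun k => ?_⟩
      fin_cases k
      · simp [hy]
      · simpa [hy] using h0 v
  · intro i j φ ψ hi hj hE
    have h1 := hE.forall_iterate_iff 1
    rw [hi.1.forall_iterate_eq_zero_iff x, hj.1.forall_iterate_eq_zero_iff x] at h1
    have := x.ne_zero 1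
    have hi := hi.2
    have hj := hj.2
    fin_cases i <;> fin_cases j <;> simp_all [Fin.forall_fin_two]

variable [PerfectField F]

theorem classifies_three (x : Module.Basis (Fin 3) F L) :
    Classifies p x ![![0, 0, 0], ![x 1, 0, 0], ![x 1, x 2, 0]] (fun i j : Fin 3 => i = j) := by
  have hdim : Module.finrank F L = 3 := by simp [Module.finrank_eq_card_basis x]
  have : Nontrivial L := Module.nontrivial_of_finrank_pos (R := F) (by omega)
  have : Module.Finite F L := Module.finite_of_finrank_pos (R := F) (by omega)
  refine classifies_of_isLieAbelian
    (fun x => ![![0, 0, 0], ![x 1, 0, 0], ![x 1, x 2, 0]]) ?_ x ?_ ?_ ?_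
  · intro x y i k
    fin_cases i <;> fin_cases k <;> simp
  · intro i φ hi k
    have hφ0 : φ 0 = 0 := hi.1.map_zero (Fact.out : p.Prime).ne_zero
    have h0 := hi.2
    fin_cases i <;> simp [Fin.forall_fin_succ] at h0 <;> fin_cases k <;>
      simp_all [Function.iterate_succ_apply]
  · intro φ h hn
    obtain ⟨m, hm, ⟨v, hv, hl⟩, h0⟩ := h.exists_chain hn
    rw [hdim] at hm
    interval_cases m
    · exact ⟨0, x, fun k => by fin_cases k <;> simpa using h0 _⟩
    · obtain ⟨y, h1, h2, h3⟩ := h.exists_basis_three_of_sq hdim (by simpa using h0) hv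
      exact ⟨1, y, fun k => by fin_cases k <;> simpa⟩
    · obtain ⟨y, hy⟩ := exists_basis_eq three_ne_zero hdim _ hl
      refine ⟨2, y, fun k => ?_⟩
      fin_cases k
      · simp [hy]
      · simp [hy]
      · simpa [hy] using h0 v
  · intro i j φ ψ hi hj hE
    have h1 := hE.forall_iterate_iff 1
    have h2 := hE.forall_iterate_iff 2
    rw [hi.1.forall_iterate_eq_zero_iff x, hj.1.forall_iterate_eq_zero_iff x] at h1 h2
    have hφ0 : φ 0 = 0 := hi.1.map_zero (Fact.out : p.Prime).ne_zero
    have hψ0 : ψ 0 = 0 := hj.1.map_zero (Fact.out : p.Prime).ne_zero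
    have := x.ne_zero 1
    have := x.ne_zero 2
    have hi := hi.2
    have hj := hj.2
    fin_cases i <;> fin_cases j <;> simp_all [Fin.forall_fin_succ]

theorem classifies_four (x : Module.Basis (Fin 4) F L) :
    Classifies p x ![![0, 0, 0, 0], ![x 1, 0, 0, 0], ![x 1, 0, x 3, 0], ![x 1, x 2, 0, 0],
          ![x 1, x 2, x 3, 0]] (fun i j : Fin 5 => i = j) := by
  have hdim : Module.finrank F L = 4 := by simp [Module.finrank_eq_card_basis x]
  have : Nontrivial L := Module.nontrivial_of_finrank_pos (R := F) (by omega)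
  have : Module.Finite F L := Module.finite_of_finrank_pos (R := F) (by omega)
  refine classifies_of_isLieAbelian
    (fun x => ![![0, 0, 0, 0], ![x 1, 0, 0, 0], ![x 1, 0, x 3, 0], ![x 1, x 2, 0, 0],
          ![x 1, x 2, x 3, 0]]) ?_ x ?_ ?_ ?_
  · intro x y i k
    fin_cases i <;> fin_cases k <;> simp
  · intro i φ hi k
    have hφ0 : φ 0 = 0 := hi.1.map_zero (Fact.out : p.Prime).ne_zero
    have h0 := hi.2
    fin_cases i <;> simp [Fin.forall_fin_succ] at h0 <;> fin_cases k <;>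
      simp_all [Function.iterate_succ_apply]
  · intro φ h hn
    obtain ⟨m, hm, ⟨v, hv, hl⟩, h0⟩ := h.exists_chain hn
    rw [hdim] at hm
    interval_cases m
    · exact ⟨0, x, fun k => by fin_cases k <;> simpa using h0 _⟩
    · obtain ⟨y, h1, h2, h3 | h3, h4⟩ := h.exists_basis_four_of_sq hdim (by simpa using h0) hv
      · exact ⟨1, y, fun k => by fin_cases k <;> simpa⟩
      · exact ⟨2, y, fun k => by fin_cases k <;> simpa⟩
    · obtain ⟨y, h1, h2, h3, h4⟩ :=
        h.exists_basis_four_of_cube hn hdim (by simpa using h0) hv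
      exact ⟨3, y, fun k => by fin_cases k <;> simpa⟩
    · obtain ⟨y, hy⟩ := exists_basis_eq four_ne_zero hdim _ hl
      refine ⟨4, y, fun k => ?_⟩
      fin_cases k
      · simp [hy]
      · simp [hy]
      · simp [hy]
      · simpa [hy] using h0 v
  -- The five nilpotency indices are 1, 2, 2, 3, 4; the rank separates the two entries of index 2.
  · have rank : ∀ i χ, Realizes p x (![![0, 0, 0, 0], ![x 1, 0, 0, 0], ![x 1, 0, x 3, 0],
        ![x 1, x 2, 0, 0], ![x 1, x 2, x 3, 0]] i) χ →
        ((∃ y : L, ∀ a, ∃ c : F, χ a = c • y) ↔ i ≤ 1) := by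
      intro i χ h
      have hχ : ∀ a, χ a = x.repr a 0 ^ p • χ (x 0) + x.repr a 1 ^ p • χ (x 1) +
          x.repr a 2 ^ p • χ (x 2) + x.repr a 3 ^ p • χ (x 3) := by
        intro a
        conv_lhs => rw [← x.sum_repr a, Fin.sum_univ_four]
        simp only [h.1.add_of_abelian, h.1.map_smul]
      have rank_two : ∀ k l, k ≠ l → ∀ k' l', χ (x k') = x k → χ (x l') = x l →
          ¬ ∃ y : L, ∀ a, ∃ c : F, χ a = c • y := by
        rintro k l hkl k' l' h0 h2 ⟨y, hy⟩
        obtain ⟨c, hc⟩ := hy (x k')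
        obtain ⟨d, hd⟩ := hy (x l')
        rw [h0] at hc
        rw [h2] at hd
        have hl := Fintype.linearIndependent_iff.1 x.linearIndependent
          (Pi.single k d + Pi.single l (-c)) (by
          simp [add_smul, Finset.sum_add_distrib, Pi.single_apply, ite_smul, hc, hd,
            smul_comm c d]) l
        have hc0 : c = 0 := by simpa [Ne.symm hkl] using hl
        exact x.ne_zero k (by rw [hc, hc0, zero_smul])
      have hv := h.2
      fin_cases i
      · refine iff_of_true ⟨0, fun a => ⟨0, ?_⟩⟩ (by simp)
        rw [hχ, hv, hv, hv, hv]
        simp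
      · refine iff_of_true ⟨x 1, fun a => ⟨x.repr a 0 ^ p, ?_⟩⟩ (by simp)
        rw [hχ, hv, hv, hv, hv]
        simp
      · exact iff_of_false (rank_two 1 3 (by decide) 0 2 (hv 0) (hv 2)) (by decide)
      · exact iff_of_false (rank_two 1 2 (by decide) 0 1 (hv 0) (hv 1)) (by decide)
      · exact iff_of_false (rank_two 1 2 (by decide) 0 1 (hv 0) (hv 1)) (by decide)
    have iter : ∀ i χ, Realizes p x (![![0, 0, 0, 0], ![x 1, 0, 0, 0], ![x 1, 0, x 3, 0],
        ![x 1, x 2, 0, 0], ![x 1, x 2, x 3, 0]] i) χ →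
        ((∀ a, χ^[1] a = 0) ↔ i = 0) ∧ ((∀ a, χ^[2] a = 0) ↔ i ≤ 2) ∧
          ((∀ a, χ^[3] a = 0) ↔ i ≤ 3) := by
      intro i χ h
      rw [h.1.forall_iterate_eq_zero_iff x, h.1.forall_iterate_eq_zero_iff x,
        h.1.forall_iterate_eq_zero_iff x]
      have h0 : χ 0 = 0 := h.1.map_zero (Fact.out : p.Prime).ne_zero
      have hv := h.2
      have h1 := x.ne_zero 1
      have h2 := x.ne_zero 2
      have h3 := x.ne_zero 3
      clear rank h
      fin_cases i <;> simp [Fin.forall_fin_succ] at hv <;>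
        simp [Fin.forall_fin_succ, hv, h0, h1, h2, h3]
    intro i j φ ψ hi hj hE
    obtain ⟨i1, i2, i3⟩ := iter i φ hi
    obtain ⟨j1, j2, j3⟩ := iter j ψ hj
    have e1 := (i1.symm.trans (hE.forall_iterate_iff 1)).trans j1
    have e2 := (i2.symm.trans (hE.forall_iterate_iff 2)).trans j2
    have e3 := (i3.symm.trans (hE.forall_iterate_iff 3)).trans j3
    have e4 : i ≤ 1 ↔ j ≤ 1 := by
      rw [← rank i φ hi, ← rank j ψ hj]
      exact ⟨exists_forall_eq_smul_of_equivalent hE, exists_forall_eq_smul_of_equivalent hE.symm⟩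
    clear * - e1 e2 e3 e4
    revert i j
    decide

end Abelian

/-! ### Class two: the explicit `[p]`-map, and normal forms on two generators. -/

section ClassTwo

variable {F L : Type*} [Field F] [LieRing L] [LieAlgebra F L] {p : ℕ} {φ ψ : L → L}

/-- The coefficient of `[b, a]` in Jacobson's formula for a Lie algebra of class two. -/
def jacobsonScalar (F : Type*) [Field F] (p : ℕ) : F := if p = 2 then 1 else 0

lemma jacobsonSum_of_class_two' [Fact p.Prime] (hL : ∀ a b c : L, ⁅a, ⁅b, c⁆⁆ = 0) (a b : L) :
    jacobsonSum F p a b = jacobsonScalar F p • ⁅b, a⁆ := by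
  rw [jacobsonScalar]
  split_ifs with h
  · subst h
    rw [jacobsonSum_two, one_smul]
  · rw [jacobsonSum_of_class_two _ hL, zero_smul]
    have := (Fact.out : p.Prime).two_le
    omega

lemma jacobsonScalar_mul_pow (c : F) :
    jacobsonScalar F p * c ^ p = jacobsonScalar F p * c ^ 2 := by
  rw [jacobsonScalar]
  split_ifs with h
  · rw [h]
  · simp

lemma two_mul_jacobsonScalar [CharP F p] : 2 * jacobsonScalar F p = 0 := by
  rw [jacobsonScalar]
  split_ifs with h
  · subst h
    exact_mod_cast CharP.cast_eq_zero F 2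
  · simp

lemma ad_pow_eq_zero_of_class_two (hp : 2 ≤ p) (hL : ∀ a b c : L, ⁅a, ⁅b, c⁆⁆ = 0) (a : L) :
    (LieAlgebra.ad F L a) ^ p = 0 := by
  obtain ⟨k, rfl⟩ := Nat.exists_eq_add_of_le' hp
  have : (LieAlgebra.ad F L a) ^ 2 = 0 := by
    ext b
    rw [pow_two, Module.End.mul_apply, LieAlgebra.ad_apply, LieAlgebra.ad_apply, hL]
    rfl
  rw [pow_add, this, mul_zero]

/-- The bracket of `L` is `[a, b] = (a_i b_j - a_j b_i) x_k` in coordinates. -/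
structure IsHeisenbergType {ι : Type*} (x : Module.Basis ι F L) (i j k : ι) : Prop where
  ne_ij : i ≠ j
  ne_ik : i ≠ k
  ne_jk : j ≠ k
  lie_eq : ∀ a b : L,
    ⁅a, b⁆ = (x.repr a i * x.repr b j - x.repr a j * x.repr b i) • x k

variable {ι : Type*} {x : Module.Basis ι F L} {i j k : ι}

lemma IsHeisenbergType.lie_lie (hx : IsHeisenbergType x i j k) (a b c : L) : ⁅a, ⁅b, c⁆⁆ = 0 := by
  rw [hx.lie_eq b c, hx.lie_eq]
  simp [hx.ne_ik.symm, hx.ne_jk.symm]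

lemma IsHeisenbergType.lie_basis (hx : IsHeisenbergType x i j k) : ⁅x i, x j⁆ = x k := by
  rw [hx.lie_eq]
  simp [hx.ne_ij, hx.ne_ij.symm]

lemma IsHeisenbergType.lie_central (hx : IsHeisenbergType x i j k) (a : L) : ⁅x k, a⁆ = 0 := by
  rw [hx.lie_eq]
  simp [hx.ne_ik.symm, hx.ne_jk.symm]

lemma IsHeisenbergType.repr_central (hx : IsHeisenbergType x i j k) {z : L}
    (hz : ∀ a : L, ⁅z, a⁆ = 0) : x.repr z i = 0 ∧ x.repr z j = 0 := by
  have h1 := hz (x j)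
  have h2 := hz (x i)
  rw [hx.lie_eq] at h1 h2
  simpa [hx.ne_ij, hx.ne_ij.symm, x.ne_zero] using And.intro h1 h2

lemma IsHeisenbergType.isPMap_basis (hx : IsHeisenbergType x i j k) (l : ι) :
    -(jacobsonScalar F p * x.repr (x l) i * x.repr (x l) j) • x k = 0 := by
  by_cases hl : l = i
  · subst hl
    simp [hx.ne_ij]
  · simp [hl]

variable [Fact p.Prime]

lemma IsPMap.lie_eq_zero_of_class_two (h : IsPMap F p φ) (hL : ∀ a b c : L, ⁅a, ⁅b, c⁆⁆ = 0)
    (a b : L) : ⁅φ a, b⁆ = 0 :=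
  h.lie_eq_zero (ad_pow_eq_zero_of_class_two (Fact.out : p.Prime).two_le hL) a b

lemma IsPMap.map_comb (h : IsPMap F p φ) (hL : ∀ a b c : L, ⁅a, ⁅b, c⁆⁆ = 0) (a b : F)
    (u v : L) : φ (a • u + b • v) =
      a ^ p • φ u + b ^ p • φ v - (jacobsonScalar F p * a * b) • ⁅u, v⁆ := by
  rw [h.add, jacobsonSum_of_class_two' hL, h.map_smul, h.map_smul, smul_lie, lie_smul,
    ← lie_skew u v]
  module

lemma IsPMap.map_add_central (h : IsPMap F p φ) (hL : ∀ a b c : L, ⁅a, ⁅b, c⁆⁆ = 0) (a : L)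
    {z : L} (hz : ∀ b : L, ⁅z, b⁆ = 0) : φ (a + z) = φ a + φ z := by
  rw [h.add, jacobsonSum_of_class_two' hL, hz, smul_zero, add_zero]

lemma IsPMap.map_smul_add_central (h : IsPMap F p φ) (hL : ∀ a b c : L, ⁅a, ⁅b, c⁆⁆ = 0) (a : L)
    {z : L} (hz : ∀ b : L, ⁅z, b⁆ = 0) (r : F) : φ (a + r • z) = φ a + r ^ p • φ z := by
  rw [h.map_add_central hL a (fun b => by rw [smul_lie, hz, smul_zero]), h.map_smul]

variable [CharP F p]

/-- The `[p]`-map vanishing on the basis. -/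
lemma IsHeisenbergType.isPMap (hx : IsHeisenbergType x i j k) :
    IsPMap F p (fun a => -(jacobsonScalar F p * x.repr a i * x.repr a j) • x k) where
  ad_pow a := by
    rw [ad_pow_eq_zero_of_class_two (Fact.out : p.Prime).two_le hx.lie_lie]
    ext b
    rw [LieAlgebra.ad_apply, smul_lie, hx.lie_central, smul_zero]
    rfl
  map_smul c a := by
    -- The map is quadratic, but its coefficient is nonzero only for `p = 2`, where `c ^ p = c ^ 2`.
    have := jacobsonScalar_mul_pow (p := p) c
    rw [smul_smul, map_smul]
    congr 1
    simp only [Finsupp.smul_apply, smul_eq_mul]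
    linear_combination x.repr a i * x.repr a j * this
  map_add a b := by
    change _ = _ + _ + jacobsonSum F p a b
    have := two_mul_jacobsonScalar (p := p) (F := F)
    rw [jacobsonSum_of_class_two' hx.lie_lie, hx.lie_eq, map_add, smul_smul, ← add_smul,
      ← add_smul]
    congr 1
    simp only [Finsupp.add_apply]
    -- The symmetric cross terms of the quadratic map and the alternating bracket differ by twice
    -- the scalar times `b_i a_j`, which is zero.
    linear_combination (- x.repr b i * x.repr a j) * this

/-- The right-hand side is itself a `[p]`-map with the same values on the basis. -/
lemma IsPMap.apply_eq_of_isHeisenbergType [Fintype ι] (h : IsPMap F p φ)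
    (hx : IsHeisenbergType x i j k) (a : L) :
    φ a = ∑ l, x.repr a l ^ p • φ (x l) - (jacobsonScalar F p * x.repr a i * x.repr a j) • x k := by
  classical
  have hp : p ≠ 0 := (Fact.out : p.Prime).ne_zero
  have h' := hx.isPMap (p := p)
  have key : IsPMap F p (fun a => -(jacobsonScalar F p * x.repr a i * x.repr a j) • x k +
      semilinearExtension p x (fun l => φ (x l)) a) :=
    h'.add_semilinearExtension x _ fun l b => h.lie_eq_zero_of_class_two hx.lie_lie _ b
  rw [h.ext_basis hp x key fun l => by
    rw [hx.isPMap_basis, semilinearExtension_basis hp, zero_add]]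
  simp only [semilinearExtension_basis hp, hx.isPMap_basis, zero_add]
  rw [neg_smul, neg_add_eq_sub, semilinearExtension]

/-- Coordinates of two linearly independent combinations adapted to a `p`-semilinear functional. -/
lemma exists_adapted_combinations [PerfectField F] {α β : F} (hαβ : α ≠ 0 ∨ β ≠ 0) :
    ∃ a b c d : F, a * d - b * c ≠ 0 ∧ a ^ p * α + b ^ p * β = 0 ∧ c ^ p * α + d ^ p * β ≠ 0 := by
  have hp : p ≠ 0 := (Fact.out : p.Prime).ne_zero
  by_cases hβ : β = 0
  · subst hβ
    exact ⟨0, 1, -1, 0, by simp, by simp [hp], by simpa using hαβ⟩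
  · obtain ⟨r, hr⟩ := exists_pow_eq p (-α / β)
    refine ⟨1, r, 0, 1, by simp, ?_, by simpa [hp] using hβ⟩
    rw [hr]
    field_simp
    simp

/-- Normal form of a `[p]`-map on the span of `u`, `v` taking values in the multiples of
`[u, v]`. -/
lemma IsPMap.exists_normal_form [PerfectField F] (h : IsPMap F p φ)
    (hL : ∀ a b c : L, ⁅a, ⁅b, c⁆⁆ = 0) {u v w : L} (hw : ⁅u, v⁆ = w) {α β : F}
    (hu : φ u = α • w) (hv : φ v = β • w) :
    ∃ u' v' : L, ∃ D : F, D ≠ 0 ∧ ⁅u', v'⁆ = D • w ∧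
      (p ≠ 2 ∧ φ u' = 0 ∧ φ v' = 0 ∨ p ≠ 2 ∧ φ u' = 0 ∧ φ v' = ⁅u', v'⁆ ∨
        p = 2 ∧ φ u' = ⁅u', v'⁆ ∧ ∃ ξ : F, φ v' = ξ • ⁅u', v'⁆) := by
  by_cases hp : p = 2
  · subst hp
    have h2 : (2 : F) = 0 := by exact_mod_cast CharP.cast_eq_zero F 2
    -- In characteristic 2 some vector always has a nonzero value: `u` or `v` if `α` or `β` is
    -- nonzero, and otherwise `u + v`, whose value is `-w = w`. Scaling the second vector makes the
    -- bracket equal to that value.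
    by_cases hα : α = 0
    · by_cases hβ : β = 0
      · refine ⟨u + v, v, 1, one_ne_zero, by simp [hw], Or.inr (Or.inr ⟨rfl, ?_, 0, ?_⟩)⟩
        · have := h.map_comb hL 1 1 u v
          simp only [one_smul, hu, hv, hα, hβ, hw, jacobsonScalar] at this
          rw [this, add_lie, lie_self, hw, ← sub_eq_zero]
          trans (-2 : F) • w
          · simp only [if_true]
            module
          · rw [h2, neg_zero, zero_smul]
        · simp [hv, hβ]
      · refine ⟨v, -β • u, β, hβ, ?_, Or.inr (Or.inr ⟨rfl, ?_, 0, ?_⟩)⟩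
        · rw [lie_smul, ← lie_skew, hw]
          module
        · rw [lie_smul, ← lie_skew, hw, hv]
          module
        · rw [h.map_smul, hu, hα]
          module
    · refine ⟨u, α • v, α, hα, by rw [lie_smul, hw], Or.inr (Or.inr ⟨rfl, ?_, α * β, ?_⟩)⟩
      · rw [lie_smul, hw, hu]
      · rw [h.map_smul, lie_smul, hw, hv]
        module
  · by_cases hαβ : α ≠ 0 ∨ β ≠ 0
    · obtain ⟨a, b, c, d, hD, h1, h2⟩ := exists_adapted_combinations (p := p) hαβ
      have hlie : ⁅a • u + b • v, c • u + d • v⁆ = (a * d - b * c) • w := by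
        simp only [add_lie, lie_add, smul_lie, lie_smul, lie_self, hw]
        rw [← lie_skew v u, hw]
        module
      have h1' : φ (a • u + b • v) = 0 := by
        rw [h.map_comb hL, hu, hv, smul_smul, smul_smul, ← add_smul, h1]
        simp [jacobsonScalar, hp]
      have h2' : φ (c • u + d • v) = (c ^ p * α + d ^ p * β) • w := by
        rw [h.map_comb hL, hu, hv, smul_smul, smul_smul, ← add_smul]
        simp [jacobsonScalar, hp]
      refine ⟨((c ^ p * α + d ^ p * β) / (a * d - b * c)) • (a • u + b • v), c • u + d • v,
        c ^ p * α + d ^ p * β, h2, ?_, Or.inr (Or.inl ⟨hp, ?_, ?_⟩)⟩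
      · rw [smul_lie, hlie, smul_smul, div_mul_cancel₀ _ hD]
      · rw [h.map_smul, h1', smul_zero]
      · rw [smul_lie, hlie, smul_smul, div_mul_cancel₀ _ hD, h2']
    · push Not at hαβ
      exact ⟨u, v, 1, one_ne_zero, by rw [hw, one_smul], Or.inl ⟨hp, by simp [hu, hαβ],
        by simp [hv, hαβ]⟩⟩

end ClassTwo

/-! ### The Arf invariant in characteristic 2. -/

section Arf

variable {F L : Type*} [Field F] [LieRing L] [LieAlgebra F L] {φ ψ : L → L}
  {ι : Type*} [Fintype ι] {x : Module.Basis ι F L} {i j k : ι}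

/-- The form `a² + a b + ξ₂ b²` is the norm of `a + b θ` with `θ² = θ + ξ₂`. Multiplying one element
by the conjugate of the other expresses the product of the two values as `n² + n D + ξ₂ D²` with `n
= a c + a d + b d ξ₂`. This product is `ξ₁ D²`, so division by `D²` gives `δ = n / D`. -/
lemma add_mem_artinSchreier_of_eq {F : Type*} [Field F] [CharP F 2] {a b c d ξ₁ ξ₂ D : F}
    (hD : D = a * d - b * c) (hD0 : D ≠ 0) (h1 : D = a ^ 2 + ξ₂ * b ^ 2 + a * b)
    (h2 : ξ₁ * D = c ^ 2 + ξ₂ * d ^ 2 + c * d) : ξ₁ + ξ₂ ∈ artinSchreier F := by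
  have h0 : (2 : F) = 0 := by exact_mod_cast CharP.cast_eq_zero F 2
  refine ⟨(a * c + a * d + b * d * ξ₂) / D, ?_⟩
  field_simp
  have h3 : ξ₁ * D ^ 2 = (a ^ 2 + ξ₂ * b ^ 2 + a * b) * (c ^ 2 + ξ₂ * d ^ 2 + c * d) := by
    rw [← h1, ← h2]
    ring
  clear h1 h2
  subst hD
  linear_combination h3 + (ξ₂ * (a * d - b * c) ^ 2 -
    (a * c + a * d + b * d * ξ₂) * (a * d - b * c)) * h0

/-- The Arf invariant of the quadratic form `x ↦ (φ x)_k` is an invariant of `φ`. -/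
lemma Equivalent.add_mem_artinSchreier [CharP F 2] (hx : IsHeisenbergType x i j k)
    (hψ : IsPMap F 2 ψ) {ξ₁ ξ₂ : F} (hi : φ (x i) = x k)
    (hj : φ (x j) = ξ₁ • x k) (hi' : ψ (x i) = x k) (hj' : ψ (x j) = ξ₂ • x k)
    (hl' : ∀ l, l ≠ i → l ≠ j → x.repr (ψ (x l)) k = 0) (h : Equivalent F φ ψ) :
    ξ₁ + ξ₂ ∈ artinSchreier F := by
  classical
  obtain ⟨A, hA⟩ := h
  have h0 : (2 : F) = 0 := by exact_mod_cast CharP.cast_eq_zero F 2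
  have : Fact (Nat.Prime 2) := ⟨Nat.prime_two⟩
  have hψk : ∀ a, x.repr (ψ a) k =
      x.repr a i ^ 2 + ξ₂ * x.repr a j ^ 2 + x.repr a i * x.repr a j := by
    intro a
    rw [hψ.apply_eq_of_isHeisenbergType hx, map_sub, map_sum, Finsupp.sub_apply,
      Finsupp.finsetSum_apply, Finset.sum_eq_add i j hx.ne_ij
        (fun l _ hl => by rw [map_smul, Finsupp.smul_apply, hl' l hl.1 hl.2, smul_zero])
        (by simp) (by simp), hi', hj']
    simp [jacobsonScalar]
    linear_combination (-x.repr a i * x.repr a j) * h0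
  -- An automorphism multiplies `x k` by the determinant of its action on the two generators; this
  -- is the `D` of the preceding identity.
  have hk : A (x k) =
      (x.repr (A (x i)) i * x.repr (A (x j)) j - x.repr (A (x i)) j * x.repr (A (x j)) i) •
        x k := by
    rw [← hx.lie_eq, ← LieEquiv.map_lie, hx.lie_basis]
  have h1 := congrArg (fun a => x.repr a k) (hA (x i))
  have h2 := congrArg (fun a => x.repr a k) (hA (x j))
  simp only [hψk, hi, hj, map_smul, hk] at h1 h2
  refine add_mem_artinSchreier_of_eq rfl (fun hD => ?_) (by simpa using h1) (by simpa using h2)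
  rw [hD, zero_smul] at hk
  exact x.ne_zero k (A.injective (hk.trans (map_zero A).symm))

end Arf

/-! ### The Heisenberg algebra `L_{3,2}`, and bases of `L_{3,2}` and `L_{4,2}` from noncommuting
vectors. -/

section Heisenberg

variable {F L : Type*} [Field F] [LieRing L] [LieAlgebra F L] {p : ℕ} {φ ψ : L → L}

lemma IsHeisenbergType.equiv_lie {ι : Type*} {x y : Module.Basis ι F L} {i j k : ι}
    (hx : IsHeisenbergType x i j k) (hy : IsHeisenbergType y i j k) (l m : ι) :
    x.equiv y (Equiv.refl ι) ⁅x l, x m⁆ = ⁅y l, y m⁆ := by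
  rw [hx.lie_eq, hy.lie_eq]
  simp

lemma IsL32.isHeisenbergType {x : Module.Basis (Fin 3) F L} (hx : IsL32 x) :
    IsHeisenbergType x 0 1 2 where
  ne_ij := by decide
  ne_ik := by decide
  ne_jk := by decide
  lie_eq a b := by
    have h21 : ⁅x 1, x 0⁆ = -x 2 := by rw [← lie_skew, hx.lie_12]
    have h31 : ⁅x 2, x 0⁆ = 0 := by rw [← lie_skew, hx.lie_13, neg_zero]
    have h32 : ⁅x 2, x 1⁆ = 0 := by rw [← lie_skew, hx.lie_23, neg_zero]
    conv_lhs => rw [← x.sum_repr a, ← x.sum_repr b, Fin.sum_univ_three, Fin.sum_univ_three]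
    simp only [lie_add, add_lie, smul_lie, lie_smul, lie_self, hx.lie_12, hx.lie_13, hx.lie_23,
      h21, h31, h32]
    module

lemma IsL42.isHeisenbergType {x : Module.Basis (Fin 4) F L} (hx : IsL42 x) :
    IsHeisenbergType x 0 1 2 where
  ne_ij := by decide
  ne_ik := by decide
  ne_jk := by decide
  lie_eq a b := by
    have h21 : ⁅x 1, x 0⁆ = -x 2 := by rw [← lie_skew, hx.lie_12]
    have h31 : ⁅x 2, x 0⁆ = 0 := by rw [← lie_skew, hx.lie_13, neg_zero]
    have h32 : ⁅x 2, x 1⁆ = 0 := by rw [← lie_skew, hx.lie_23, neg_zero]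
    have h41 : ⁅x 3, x 0⁆ = 0 := by rw [← lie_skew, hx.lie_14, neg_zero]
    have h42 : ⁅x 3, x 1⁆ = 0 := by rw [← lie_skew, hx.lie_24, neg_zero]
    have h43 : ⁅x 3, x 2⁆ = 0 := by rw [← lie_skew, hx.lie_34, neg_zero]
    conv_lhs => rw [← x.sum_repr a, ← x.sum_repr b, Fin.sum_univ_four, Fin.sum_univ_four]
    simp only [lie_add, add_lie, smul_lie, lie_smul, lie_self, hx.lie_12, hx.lie_13, hx.lie_23,
      hx.lie_14, hx.lie_24, hx.lie_34, h21, h31, h32, h41, h42, h43]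
    module

lemma IsL32.exists_basis {x : Module.Basis (Fin 3) F L} (hx : IsL32 x) {u v : L}
    (huv : ⁅u, v⁆ ≠ 0) :
    ∃ y : Module.Basis (Fin 3) F L, IsL32 y ∧ y 0 = u ∧ y 1 = v ∧ y 2 = ⁅u, v⁆ := by
  have hL := hx.isHeisenbergType.lie_lie
  obtain ⟨y, h0, h1, h2⟩ := exists_basis_three (F := F) (by simp [Module.finrank_eq_card_basis x])
    u v ⁅u, v⁆ (by
      intro c d e hc
      obtain ⟨h1, h2, h3⟩ := coeff_eq_zero_of_lie rfl huv
        (fun a => by rw [lie_smul, hL, smul_zero]) hc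
      exact ⟨h1, h2, by simpa [huv] using h3⟩)
  exact ⟨y, ⟨by rw [h0, h1, h2], by rw [h2, hL], by rw [h2, hL]⟩, h0, h1, h2⟩

lemma IsL42.exists_basis {x : Module.Basis (Fin 4) F L} (hx : IsL42 x) {u v z : L}
    (huv : ⁅u, v⁆ ≠ 0) (hz : ∀ a : L, ⁅z, a⁆ = 0) (hz' : ∀ c : F, z ≠ c • ⁅u, v⁆) :
    ∃ y : Module.Basis (Fin 4) F L, IsL42 y ∧ y 0 = u ∧ y 1 = v ∧ y 2 = ⁅u, v⁆ ∧ y 3 = z := by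
  have hL := hx.isHeisenbergType.lie_lie
  have hz0 : ∀ a : L, ⁅a, z⁆ = 0 := fun a => by rw [← lie_skew, hz, neg_zero]
  obtain ⟨y, h0, h1, h2, h3⟩ := exists_basis_four (F := F) (by simp [Module.finrank_eq_card_basis x])
    u v ⁅u, v⁆ z (by
      intro c d e f hc
      rw [add_assoc] at hc
      obtain ⟨h1, h2, h3⟩ := coeff_eq_zero_of_lie rfl huv
        (fun a => by rw [lie_add, lie_smul, lie_smul, hL, hz0, smul_zero, smul_zero, add_zero]) hc
      have hf : f = 0 := by
        by_contra hf
        have := eq_smul_of_add_smul_eq_zero hf h3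
        rw [smul_smul] at this
        exact hz' _ this
      subst hf
      exact ⟨h1, h2, by simpa [huv] using h3, rfl⟩)
  exact ⟨y, ⟨by rw [h0, h1, h2], by rw [h2, hL], by rw [h3, hz0], by rw [h2, hL],
    by rw [h3, hz0], by rw [h3, hz0]⟩, h0, h1, h2, h3⟩

/-- Passing from `x₂ ↦ ξ₂ x₃` to `x₂ ↦ (ξ₂ + δ + δ²) x₃`. -/
lemma IsPMap.apply_add_smul_of_char_two [CharP F 2] (h : IsPMap F 2 φ)
    (hL : ∀ a b c : L, ⁅a, ⁅b, c⁆⁆ = 0) {u v w : L} (hw : ⁅u, v⁆ = w) {ξ₁ ξ₂ : F}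
    (hu : φ u = w) (hv : φ v = ξ₂ • w) (hξ : ξ₁ + ξ₂ ∈ artinSchreier F) :
    ∃ v' : L, ⁅u, v'⁆ = w ∧ φ v' = ξ₁ • w := by
  have h0 : (2 : F) = 0 := by exact_mod_cast CharP.cast_eq_zero F 2
  have : Fact (Nat.Prime 2) := ⟨Nat.prime_two⟩
  obtain ⟨δ, hδ⟩ := hξ
  -- The value at `δ u + v` is `(δ² + ξ₂ - δ) w`, and the signs do not matter.
  refine ⟨δ • u + (1 : F) • v, by simp [hw], ?_⟩
  rw [h.map_comb hL, hu, hv, hw, smul_smul, ← add_smul, ← sub_smul]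
  congr 1
  simp only [jacobsonScalar, if_true]
  linear_combination (-δ + ξ₂) * h0 - hδ

lemma IsL32.isPNilpotent [Fact p.Prime] {x : Module.Basis (Fin 3) F L} (hx : IsL32 x) (h : IsPMap F p φ)
    (h2 : φ (x 2) = 0) : IsPNilpotent φ := by
  have hH := hx.isHeisenbergType
  refine ⟨2, fun a => ?_⟩
  obtain ⟨h0, h1⟩ := hH.repr_central (h.lie_eq_zero_of_class_two hH.lie_lie a)
  have := x.sum_repr (φ a)
  rw [Fin.sum_univ_three, h0, h1] at this
  change φ (φ a) = 0
  rw [← this]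
  simp [h.map_smul, h2]

variable [Fact p.Prime] [CharP F p] [PerfectField F]

/-- All values lie in the centre `F x 2`, and nilpotency forces `φ (x 2) = 0`; the rest is the
normal form on two generators. -/
lemma IsL32.complete {x : Module.Basis (Fin 3) F L} (hx : IsL32 x) (h : IsPMap F p φ)
    (hn : IsPNilpotent φ) : ∃ y : Module.Basis (Fin 3) F L, IsL32 y ∧ φ (y 2) = 0 ∧
      (p ≠ 2 ∧ φ (y 0) = 0 ∧ φ (y 1) = 0 ∨ p ≠ 2 ∧ φ (y 0) = y 2 ∧ φ (y 1) = 0 ∨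
        p = 2 ∧ φ (y 0) = y 2 ∧ ∃ ξ : F, φ (y 1) = ξ • y 2) := by
  have hH := hx.isHeisenbergType
  have hφ : ∀ a, ∃ c : F, φ a = c • x 2 := fun a => by
    obtain ⟨h0, h1⟩ := hH.repr_central (h.lie_eq_zero_of_class_two hH.lie_lie a)
    have := x.sum_repr (φ a)
    rw [Fin.sum_univ_three, h0, h1] at this
    exact ⟨_, by simpa using this.symm⟩
  obtain ⟨c, hc⟩ := hφ (x 2)
  have h2 := hn.eq_zero_of_apply_eq_smul h hc
  obtain ⟨α, hα⟩ := hφ (x 0)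
  obtain ⟨β, hβ⟩ := hφ (x 1)
  obtain ⟨u, v, D, hD, huv, hcase⟩ := h.exists_normal_form hH.lie_lie hx.lie_12 hα hβ
  have huv0 : ⁅u, v⁆ ≠ 0 := by simp [huv, hD, x.ne_zero]
  have hφ2 : φ ⁅u, v⁆ = 0 := by rw [huv, h.map_smul, h2, smul_zero]
  rcases hcase with ⟨hp, hu, hv⟩ | ⟨hp, hu, hv⟩ | ⟨hp, hu, ξ, hv⟩
  · obtain ⟨y, hy, h0, h1, h2⟩ := hx.exists_basis huv0
    exact ⟨y, hy, by rw [h2, hφ2], Or.inl ⟨hp, by rw [h0, hu], by rw [h1, hv]⟩⟩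
  -- The normal form puts the nonzero value on the second vector and the list on the first; the swap
  -- `(v, -u)` preserves the bracket.
  · have huv' : ⁅v, (-1 : F) • u⁆ = ⁅u, v⁆ := by simp
    obtain ⟨y, hy, h0, h1, h2⟩ := hx.exists_basis (huv'.trans_ne huv0)
    rw [huv'] at h2
    exact ⟨y, hy, by rw [h2, hφ2], Or.inr (Or.inl ⟨hp, by rw [h0, h2, hv],
      by rw [h1, h.map_smul, hu, smul_zero]⟩)⟩
  · obtain ⟨y, hy, h0, h1, h2⟩ := hx.exists_basis huv0
    exact ⟨y, hy, by rw [h2, hφ2], Or.inr (Or.inr ⟨hp, by rw [h0, h2, hu], ξ,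
      by rw [h1, h2, hv]⟩)⟩

theorem IsL32.classifies {x : Module.Basis (Fin 3) F L} (hx : IsL32 x) (hp : 3 ≤ p) :
    Classifies p x ![![0, 0, 0], ![x 2, 0, 0]] (fun i j : Fin 2 => i = j) := by
  have hH := hx.isHeisenbergType
  refine classifies_of_tables IsL32
    (fun x y hx hy => hx.isHeisenbergType.equiv_lie hy.isHeisenbergType)
    (fun x => ![![0, 0, 0], ![x 2, 0, 0]])
    (fun x y i k => by fin_cases i <;> fin_cases k <;> simp) x hx
    ⟨_, hH.isPMap (p := p), hH.isPMap_basis⟩ _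
    (fun i k a => by fin_cases i <;> fin_cases k <;> simp [hH.lie_central])
    (fun i φ h => hx.isPNilpotent h.1 (by rw [h.2]; fin_cases i <;> simp)) ?_
    (fun i j φ h h' => absurd h h') ?_
  · intro φ h hn
    obtain ⟨y, hy, h2, ⟨-, h0, h1⟩ | ⟨-, h0, h1⟩ | ⟨hp2, -⟩⟩ := hx.complete h hn
    · exact ⟨0, y, hy, fun k => by fin_cases k <;> simpa⟩
    · exact ⟨1, y, hy, fun k => by fin_cases k <;> simpa⟩
    · omega
  · have key : ∀ i φ, Realizes p x (![![0, 0, 0], ![x 2, 0, 0]] i) φ →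
        ((∀ a, φ^[1] a = 0) ↔ i = 0) := by
      intro i φ h
      fin_cases i
      · refine iff_of_true (fun a => ?_) (by simp)
        have := h.1.apply_eq_of_isHeisenbergType hH a
        have hv := h.2
        simp [Fin.forall_fin_succ] at hv
        rw [Function.iterate_one, this]
        simp [Fin.sum_univ_three, hv, jacobsonScalar, show p ≠ 2 by omega]
      · refine iff_of_false (fun h' => x.ne_zero 2 ?_) (by simp)
        rw [← h' (x 0)]
        exact (h.2 0).symm
    intro i j φ ψ hi hj hE
    have := (key i φ hi).symm.trans ((hE.forall_iterate_iff 1).trans (key j ψ hj))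
    clear * - this
    revert i j
    decide

end Heisenberg

/-! ### `L_{3,2}` in characteristic 2. -/

section HeisenbergTwo

variable {F L : Type*} [Field F] [LieRing L] [LieAlgebra F L] {φ ψ : L → L}
  [CharP F 2] [PerfectField F]

theorem IsL32.classifies_two {x : Module.Basis (Fin 3) F L} (hx : IsL32 x) :
    Classifies 2 x (fun ξ : F => ![x 2, ξ • x 2, 0])
      (fun ξ₁ ξ₂ => ξ₁ + ξ₂ ∈ artinSchreier F) := by
  have hH := hx.isHeisenbergType
  have : Fact (Nat.Prime 2) := ⟨Nat.prime_two⟩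
  refine classifies_of_tables IsL32
    (fun x y hx hy => hx.isHeisenbergType.equiv_lie hy.isHeisenbergType)
    (fun x ξ => ![x 2, ξ • x 2, 0])
    (fun x y i k => by fin_cases k <;> simp) x hx
    ⟨_, hH.isPMap (p := 2), hH.isPMap_basis⟩ _
    (fun i k a => by fin_cases k <;> simp [hH.lie_central])
    (fun i φ h => hx.isPNilpotent h.1 (h.2 2)) ?_ ?_ ?_
  · intro φ h hn
    obtain ⟨y, hy, h2, ⟨h', -⟩ | ⟨h', -⟩ | ⟨-, h0, ξ, h1⟩⟩ := hx.complete h hn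
    · exact absurd rfl h'
    · exact absurd rfl h'
    · exact ⟨ξ, y, hy, fun k => by fin_cases k <;> simpa⟩
  · intro ξ₁ ξ₂ φ hξ _ h
    obtain ⟨v, hv, hφv⟩ :=
      h.1.apply_add_smul_of_char_two hH.lie_lie hx.lie_12 (h.2 0) (h.2 1) hξ
    obtain ⟨y, hy, h0, h1, h2⟩ := hx.exists_basis (u := x 0) (v := v) (by simp [hv, x.ne_zero])
    rw [hv] at h2
    refine ⟨y, hy, fun k => ?_⟩
    fin_cases k
    · simpa [h0, h2] using h.2 0
    · simpa [h1, h2] using hφv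
    · simpa [h2] using h.2 2
  · intro ξ₁ ξ₂ φ ψ h1 h2 hE
    refine hE.add_mem_artinSchreier hH h2.1 (h1.2 0) (h1.2 1) (h2.2 0) (h2.2 1) fun l h0 h1 => ?_
    rw [h2.2]
    fin_cases l <;> simp_all

end HeisenbergTwo

/-! ### `L_{4,2}`: normal forms according to the action on the centre. -/

section ClassTwoFour

variable {F L : Type*} [Field F] [LieRing L] [LieAlgebra F L] {p : ℕ} {φ ψ : L → L}

lemma IsL42.eq_of_central {x : Module.Basis (Fin 4) F L} (hx : IsL42 x) {z : L}
    (hz : ∀ a : L, ⁅z, a⁆ = 0) : z = x.repr z 2 • x 2 + x.repr z 3 • x 3 := by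
  obtain ⟨h0, h1⟩ := hx.isHeisenbergType.repr_central hz
  have := x.sum_repr z
  rw [Fin.sum_univ_four, h0, h1] at this
  simpa using this.symm

lemma IsL42.lie_four {x : Module.Basis (Fin 4) F L} (hx : IsL42 x) (a : L) : ⁅x 3, a⁆ = 0 := by
  rw [hx.isHeisenbergType.lie_eq]
  simp

lemma IsL42.coeff_eq_zero {x : Module.Basis (Fin 4) F L} {c d : F}
    (h : c • x 2 + d • x 3 = 0) : c = 0 ∧ d = 0 := by
  have h2 := congrArg (fun a => x.repr a 2) h
  have h3 := congrArg (fun a => x.repr a 3) h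
  exact ⟨by simpa using h2, by simpa using h3⟩

section

variable [Fact p.Prime]

lemma IsL42.apply_eq {x : Module.Basis (Fin 4) F L} (hx : IsL42 x) (h : IsPMap F p φ) (a : L) :
    φ a = x.repr (φ a) 2 • x 2 + x.repr (φ a) 3 • x 3 :=
  hx.eq_of_central (h.lie_eq_zero_of_class_two hx.isHeisenbergType.lie_lie a)

lemma IsL42.apply_central {x : Module.Basis (Fin 4) F L} (hx : IsL42 x) (h : IsPMap F p φ)
    (c d : F) : φ (c • x 2 + d • x 3) = c ^ p • φ (x 2) + d ^ p • φ (x 3) := by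
  have hH := hx.isHeisenbergType
  rw [h.map_smul_add_central hH.lie_lie _ hx.lie_four, h.map_smul]

/-- Every value is central and `φ` is semilinear on the centre, so vanishing of `φ²` on the centre
gives `φ³ = 0`. -/
lemma IsL42.isPNilpotent {x : Module.Basis (Fin 4) F L} (hx : IsL42 x) (h : IsPMap F p φ)
    (h' : φ (φ (x 2)) = 0 ∧ φ (φ (x 3)) = 0) : IsPNilpotent φ := by
  refine ⟨3, fun a => ?_⟩
  have hH := hx.isHeisenbergType
  change φ (φ (φ a)) = 0
  rw [hx.apply_eq h a, hx.apply_central h,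
    h.map_smul_add_central hH.lie_lie _ (h.lie_eq_zero_of_class_two hH.lie_lie _), h.map_smul,
    h'.1, h'.2, smul_zero, smul_zero, add_zero]

variable [CharP F p] [PerfectField F]

/-- The case in which the derived algebra is not annihilated. -/
lemma IsL42.complete_of_apply_three_ne_zero {x : Module.Basis (Fin 4) F L} (hx : IsL42 x)
    (h : IsPMap F p φ) (hn : IsPNilpotent φ) (h2 : φ (x 2) ≠ 0) :
    ∃ y : Module.Basis (Fin 4) F L, IsL42 y ∧ φ (y 2) = y 3 ∧ φ (y 3) = 0 ∧
      (p ≠ 2 ∧ φ (y 0) = 0 ∧ φ (y 1) = 0 ∨ p ≠ 2 ∧ φ (y 0) = 0 ∧ φ (y 1) = y 2 ∨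
        p = 2 ∧ φ (y 0) = y 2 ∧ ∃ ξ : F, φ (y 1) = ξ • y 2) := by
  have hH := hx.isHeisenbergType
  have hp : p ≠ 0 := (Fact.out : p.Prime).ne_zero
  have hφc := h.lie_eq_zero_of_class_two hH.lie_lie
  have hne : ∀ c : F, φ (x 2) ≠ c • x 2 := fun c hc =>
    h2 (hn.eq_zero_of_apply_eq_smul h hc)
  -- Nilpotency keeps `φ (x 2)` off the line of `x 2`, so it can serve as the fourth basis vector.
  obtain ⟨x', hx', e0, e1, e2, e3⟩ := hx.exists_basis (u := x 0) (v := x 1)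
    (by rw [hx.lie_12]; exact x.ne_zero 2) (hφc (x 2)) (by rw [hx.lie_12]; exact hne)
  rw [hx.lie_12] at e2
  have hH' := hx'.isHeisenbergType
  have h23 : φ (x' 2) = x' 3 := by rw [e2, e3]
  have h3 : φ (x' 3) = 0 := by
    have h3' := hx'.apply_eq h (x' 3)
    have hc : x'.repr (φ (x' 3)) 2 = 0 := by
      by_contra hc
      -- With this coefficient nonzero, `φ` sends nonzero central vectors to nonzero central
      -- vectors.
      obtain ⟨c, d, hcd, h0⟩ := hn.zero_mem (a := x' 2)
        (S := {a | ∃ c d : F, (c ≠ 0 ∨ d ≠ 0) ∧ a = c • x' 2 + d • x' 3}) (by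
          rintro _ ⟨c, d, hcd, rfl⟩
          refine ⟨d ^ p * x'.repr (φ (x' 3)) 2, c ^ p + d ^ p * x'.repr (φ (x' 3)) 3, ?_, ?_⟩
          · by_cases hd : d = 0
            · subst hd
              right
              simpa [hp] using hcd
            · exact Or.inl (mul_ne_zero (pow_ne_zero _ hd) hc)
          · rw [hx'.apply_central h, h23, h3']
            simp only [map_add, map_smul, Finsupp.add_apply, Finsupp.smul_apply,
              Module.Basis.repr_self]
            simp
            module) ⟨1, 0, by simp, by simp⟩
      obtain ⟨hc, hd⟩ := IsL42.coeff_eq_zero h0.symm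
      simp [hc, hd] at hcd
    rw [hc, zero_smul, zero_add] at h3'
    exact hn.eq_zero_of_apply_eq_smul h h3'
  -- Because `φ (x' 2) = x' 3`, a multiple of `x' 2` cancels the `x' 3`-component without changing
  -- brackets. Both generators then take values in `F x' 2`, as the normal form requires.
  have adjust : ∀ a : L, ∃ r α : F, φ (a + r • x' 2) = α • x' 2 := by
    intro a
    obtain ⟨r, hr⟩ := exists_pow_eq p (-(x'.repr (φ a) 3))
    refine ⟨r, x'.repr (φ a) 2, ?_⟩
    rw [h.map_smul_add_central hH.lie_lie _ hH'.lie_central, hr, h23, hx'.apply_eq h a]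
    simp
  obtain ⟨r, α, hα⟩ := adjust (x' 0)
  obtain ⟨s, β, hβ⟩ := adjust (x' 1)
  have hlie : ⁅x' 0 + r • x' 2, x' 1 + s • x' 2⁆ = x' 2 := by
    rw [hH'.lie_eq]
    simp
  obtain ⟨u, v, D, hD, huv, hcase⟩ := h.exists_normal_form hH'.lie_lie hlie hα hβ
  have huv0 : ⁅u, v⁆ ≠ 0 := by simp [huv, hD, x'.ne_zero]
  have hφ2 : φ ⁅u, v⁆ = D ^ p • x' 3 := by rw [huv, h.map_smul, h23]
  obtain ⟨y, hy, h0, h1, h2, h3'⟩ := hx'.exists_basis huv0 (hφc ⁅u, v⁆) (fun c hc => by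
    rw [hφ2, huv, smul_smul, ← sub_eq_zero] at hc
    refine pow_ne_zero p hD (IsL42.coeff_eq_zero (x := x') (c := -(c * D)) ?_).2
    rw [← hc]
    module)
  refine ⟨y, hy, by rw [h2, h3'], by rw [h3', hφ2, h.map_smul, h3, smul_zero], ?_⟩
  rw [h0, h1, h2]
  exact hcase

/-- The case in which the derived algebra, but not the centre, is annihilated. -/
lemma IsL42.complete_of_apply_four_ne_zero {x : Module.Basis (Fin 4) F L} (hx : IsL42 x)
    (h : IsPMap F p φ) (hn : IsPNilpotent φ) (h2 : φ (x 2) = 0) (h3 : φ (x 3) ≠ 0) :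
    ∃ y : Module.Basis (Fin 4) F L, IsL42 y ∧ φ (y 0) = 0 ∧ φ (y 2) = 0 ∧ φ (y 3) = y 2 ∧
      (φ (y 1) = 0 ∨ φ (y 1) = y 3) := by
  have hH := hx.isHeisenbergType
  have hp : p ≠ 0 := (Fact.out : p.Prime).ne_zero
  have hφc := h.lie_eq_zero_of_class_two hH.lie_lie
  obtain ⟨γ, hγ, h3γ⟩ : ∃ γ : F, γ ≠ 0 ∧ φ (x 3) = γ • x 2 := by
    have hd : x.repr (φ (x 3)) 3 = 0 := by
      by_contra hd
      obtain ⟨c, d, hd0, h0⟩ := hn.zero_mem (a := x 3)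
        (S := {a | ∃ c d : F, d ≠ 0 ∧ a = c • x 2 + d • x 3}) (by
          rintro _ ⟨c, d, hd0, rfl⟩
          refine ⟨d ^ p * x.repr (φ (x 3)) 2, d ^ p * x.repr (φ (x 3)) 3,
            mul_ne_zero (pow_ne_zero p hd0) hd, ?_⟩
          rw [hx.apply_central h, h2, mul_smul, mul_smul, ← smul_add, ← hx.apply_eq h, smul_zero,
            zero_add]) ⟨0, 1, by simp, by simp⟩
      exact hd0 (IsL42.coeff_eq_zero h0.symm).2
    have h3' := hx.apply_eq h (x 3)
    rw [hd, zero_smul, add_zero] at h3'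
    refine ⟨_, fun h0 => h3 ?_, h3'⟩
    rw [h3', h0, zero_smul]
  -- Here `φ (x 3)` spans `F x 2`, so a multiple of `x 3` cancels any value in the derived algebra.
  have adjust : ∀ a : L, x.repr (φ a) 3 = 0 → ∃ r : F, φ (a + r • x 3) = 0 := by
    intro a ha
    obtain ⟨r, hr⟩ := exists_pow_eq p (-(x.repr (φ a) 2) / γ)
    refine ⟨r, ?_⟩
    rw [h.map_smul_add_central hH.lie_lie _ hx.lie_four, hr, h3γ, hx.apply_eq h a, ha, smul_smul,
      div_mul_cancel₀ _ hγ]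
    simp
  by_cases hαβ : x.repr (φ (x 0)) 3 ≠ 0 ∨ x.repr (φ (x 1)) 3 ≠ 0
  · obtain ⟨a, b, c, d, hD, hab, hcd⟩ := exists_adapted_combinations (p := p) hαβ
    have hrepr : ∀ a b : F, x.repr (φ (a • x 0 + b • x 1)) 3 =
        a ^ p * x.repr (φ (x 0)) 3 + b ^ p * x.repr (φ (x 1)) 3 := by
      intro a b
      rw [h.map_comb hH.lie_lie, hx.lie_12]
      simp
    obtain ⟨r, hr⟩ := adjust (a • x 0 + b • x 1) (by rw [hrepr, hab])
    obtain ⟨κ, δ, hδ, hv⟩ : ∃ κ δ : F, δ ≠ 0 ∧ φ (c • x 0 + d • x 1) = κ • x 2 + δ • x 3 :=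
      ⟨_, _, by rw [hrepr]; exact hcd, hx.apply_eq h _⟩
    -- The factor `s` makes the bracket of the new generators equal to the image of the new fourth
    -- vector `φ (c x₁ + d x₂)`.
    obtain ⟨s, hs⟩ : ∃ s : F, s = δ ^ p * γ / (a * d - b * c) := ⟨_, rfl⟩
    have hs0 : s ≠ 0 := by
      rw [hs]
      exact div_ne_zero (mul_ne_zero (pow_ne_zero _ hδ) hγ) hD
    have hlie : ⁅s • (a • x 0 + b • x 1 + r • x 3), c • x 0 + d • x 1⁆ =
        (δ ^ p * γ) • x 2 := by
      rw [hH.lie_eq]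
      congr 1
      simp [hs]
      field_simp
    have hφz : φ (κ • x 2 + δ • x 3) = (δ ^ p * γ) • x 2 := by
      rw [hx.apply_central h, h2, h3γ]
      module
    obtain ⟨y, hy, h0, h1, h2', h3'⟩ := hx.exists_basis
      (u := s • (a • x 0 + b • x 1 + r • x 3)) (v := c • x 0 + d • x 1)
      (z := φ (c • x 0 + d • x 1)) (by rw [hlie]; simp [hδ, hγ, x.ne_zero]) (hφc _) (by
        intro e he
        rw [hv, hlie, smul_smul, ← sub_eq_zero] at he
        refine hδ (IsL42.coeff_eq_zero (x := x) (c := κ - e * (δ ^ p * γ)) ?_).2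
        rw [← he]
        module)
    refine ⟨y, hy, ?_, ?_, ?_, Or.inr ?_⟩
    · rw [h0, h.map_smul, hr, smul_zero]
    · rw [h2', hlie, h.map_smul, h2, smul_zero]
    · rw [h3', hv, hφz, h2', hlie]
    · rw [h1, h3']
  · push Not at hαβ
    obtain ⟨r, hr⟩ := adjust _ hαβ.1
    obtain ⟨s, hs⟩ := adjust _ hαβ.2
    -- Rescaling `x 3` by `t` makes its image exactly `x 2`.
    obtain ⟨t, ht⟩ := exists_pow_eq p γ⁻¹
    have ht0 : t ≠ 0 := by
      rintro rfl
      rw [zero_pow hp] at ht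
      exact inv_ne_zero hγ ht.symm
    have hlie : ⁅x 0 + r • x 3, x 1 + s • x 3⁆ = x 2 := by
      rw [hH.lie_eq]
      simp
    obtain ⟨y, hy, h0, h1, h2', h3'⟩ := hx.exists_basis (u := x 0 + r • x 3) (v := x 1 + s • x 3)
      (z := t • x 3) (by rw [hlie]; exact x.ne_zero 2)
      (fun a => by rw [smul_lie, hx.lie_four, smul_zero]) (by
        intro e he
        rw [hlie, ← sub_eq_zero] at he
        refine ht0 (IsL42.coeff_eq_zero (x := x) (c := -e) ?_).2
        rw [← he]
        module)
    refine ⟨y, hy, ?_, ?_, ?_, Or.inl ?_⟩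
    · rw [h0, hr]
    · rw [h2', hlie, h2]
    · rw [h3', h.map_smul, ht, h3γ, smul_smul, inv_mul_cancel₀ hγ, one_smul, h2', hlie]
    · rw [h1, hs]

/-- The case in which the centre is annihilated. -/
lemma IsL42.complete_of_apply_center_eq_zero {x : Module.Basis (Fin 4) F L} (hx : IsL42 x)
    (h : IsPMap F p φ) (h2 : φ (x 2) = 0) (h3 : φ (x 3) = 0) :
    ∃ y : Module.Basis (Fin 4) F L, IsL42 y ∧ φ (y 2) = 0 ∧ φ (y 3) = 0 ∧
      ((p ≠ 2 ∧ φ (y 0) = 0 ∧ φ (y 1) = 0 ∨ p ≠ 2 ∧ φ (y 0) = y 2 ∧ φ (y 1) = 0 ∨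
        p = 2 ∧ φ (y 0) = y 2 ∧ ∃ ξ : F, φ (y 1) = ξ • y 2) ∨
      φ (y 0) = y 3 ∧ φ (y 1) = 0 ∨ φ (y 0) = y 2 ∧ φ (y 1) = y 3) := by
  have hH := hx.isHeisenbergType
  have hp : p ≠ 0 := (Fact.out : p.Prime).ne_zero
  have hφc := h.lie_eq_zero_of_class_two hH.lie_lie
  have hz : ∀ z : L, (∀ a : L, ⁅z, a⁆ = 0) → φ z = 0 := fun z hz => by
    rw [hx.eq_of_central hz, hx.apply_central h, h2, h3]
    simp
  have hLc : ∀ a b c : L, ⁅⁅a, b⁆, c⁆ = 0 := fun a b c => by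
    rw [← lie_skew, hH.lie_lie, neg_zero]
  by_cases hαβ : x.repr (φ (x 0)) 3 ≠ 0 ∨ x.repr (φ (x 1)) 3 ≠ 0
  · obtain ⟨a, b, c, d, hD, hab, hcd⟩ := exists_adapted_combinations (p := p) hαβ
    have hrepr : ∀ a b : F, x.repr (φ (a • x 0 + b • x 1)) 3 =
        a ^ p * x.repr (φ (x 0)) 3 + b ^ p * x.repr (φ (x 1)) 3 := by
      intro a b
      rw [h.map_comb hH.lie_lie, hx.lie_12]
      simp
    obtain ⟨κ, hu⟩ : ∃ κ : F, φ (a • x 0 + b • x 1) = κ • x 2 := by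
      have := hx.apply_eq h (a • x 0 + b • x 1)
      rw [hrepr, hab, zero_smul, add_zero] at this
      exact ⟨_, this⟩
    obtain ⟨μ, δ, hδ, hv⟩ : ∃ μ δ : F, δ ≠ 0 ∧ φ (c • x 0 + d • x 1) = μ • x 2 + δ • x 3 :=
      ⟨_, _, by rw [hrepr]; exact hcd, hx.apply_eq h _⟩
    have hlie : ⁅a • x 0 + b • x 1, c • x 0 + d • x 1⁆ = (a * d - b * c) • x 2 := by
      rw [hH.lie_eq]
      simp
    obtain ⟨u, hu'⟩ : ∃ u, a • x 0 + b • x 1 = u := ⟨_, rfl⟩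
    obtain ⟨v, hv'⟩ : ∃ v, c • x 0 + d • x 1 = v := ⟨_, rfl⟩
    obtain ⟨D, hD'⟩ : ∃ D, a * d - b * c = D := ⟨_, rfl⟩
    rw [hu'] at hu hlie
    rw [hv'] at hv hlie
    rw [hD'] at hD hlie
    have hne : ∀ t : F, t ≠ 0 → ∀ e : F, t • φ v ≠ e • x 2 := by
      intro t ht e he
      refine mul_ne_zero ht hδ (IsL42.coeff_eq_zero (x := x) (c := t * μ - e) ?_).2
      rw [hv, ← sub_eq_zero] at he
      rw [← he]
      module
    -- The value at `v` leaves the derived algebra and becomes the fourth vector. If `u` is killed,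
    -- the generators are interchanged; otherwise `v` is scaled so that the bracket equals the value
    -- at `u`.
    by_cases hκ : κ = 0
    · subst hκ
      have hvu : ⁅v, u⁆ = (-D) • x 2 := by rw [← lie_skew, hlie, neg_smul]
      obtain ⟨y, hy, h0, h1, h2', h3'⟩ := hx.exists_basis (u := v) (v := u) (z := φ v)
        (by simp [hvu, hD, x.ne_zero]) (hφc _) (fun e he => by
          rw [hvu, smul_smul] at he
          exact hne 1 one_ne_zero _ (by rwa [one_smul]))
      exact ⟨y, hy, by rw [h2', hz _ (hLc _ _)], by rw [h3', hz _ (hφc _)],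
        Or.inr (Or.inl ⟨by rw [h0, h3'], by rw [h1, hu, zero_smul]⟩)⟩
    · have ht : κ / D ≠ 0 := div_ne_zero hκ hD
      have huv : ⁅u, (κ / D) • v⁆ = κ • x 2 := by
        rw [lie_smul, hlie, smul_smul, div_mul_cancel₀ _ hD]
      obtain ⟨y, hy, h0, h1, h2', h3'⟩ := hx.exists_basis (u := u) (v := (κ / D) • v)
        (z := φ ((κ / D) • v)) (by simp [huv, hκ, x.ne_zero]) (hφc _) (fun e he => by
          rw [huv, smul_smul, h.map_smul] at he
          exact hne _ (pow_ne_zero _ ht) _ he)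
      exact ⟨y, hy, by rw [h2', hz _ (hLc _ _)], by rw [h3', hz _ (hφc _)],
        Or.inr (Or.inr ⟨by rw [h0, hu, h2', huv], by rw [h1, h3']⟩)⟩
  · push Not at hαβ
    have hα := hx.apply_eq h (x 0)
    have hβ := hx.apply_eq h (x 1)
    rw [hαβ.1, zero_smul, add_zero] at hα
    rw [hαβ.2, zero_smul, add_zero] at hβ
    obtain ⟨u, v, D, hD, huv, hcase⟩ := h.exists_normal_form hH.lie_lie hx.lie_12 hα hβ
    have huv0 : ⁅u, v⁆ ≠ 0 := by simp [huv, hD, x.ne_zero]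
    have hne : ∀ c : F, x 3 ≠ c • ⁅u, v⁆ := by
      intro c hc
      rw [huv, smul_smul, ← sub_eq_zero] at hc
      refine one_ne_zero (α := F) (IsL42.coeff_eq_zero (x := x) (c := -(c * D)) ?_).2
      rw [← hc]
      module
    rcases hcase with ⟨hp, hu, hv⟩ | ⟨hp, hu, hv⟩ | ⟨hp, hu, ξ, hv⟩
    · obtain ⟨y, hy, h0, h1, h2', h3'⟩ := hx.exists_basis huv0 hx.lie_four hne
      exact ⟨y, hy, by rw [h2', hz _ (hLc _ _)], by rw [h3', h3],
        Or.inl (Or.inl ⟨hp, by rw [h0, hu], by rw [h1, hv]⟩)⟩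
    · have huv' : ⁅v, (-1 : F) • u⁆ = ⁅u, v⁆ := by simp
      obtain ⟨y, hy, h0, h1, h2', h3'⟩ := hx.exists_basis (huv'.trans_ne huv0) hx.lie_four
        (by rwa [huv'])
      rw [huv'] at h2'
      exact ⟨y, hy, by rw [h2', hz _ (hLc _ _)], by rw [h3', h3],
        Or.inl (Or.inr (Or.inl ⟨hp, by rw [h0, h2', hv], by rw [h1, h.map_smul, hu, smul_zero]⟩))⟩
    · obtain ⟨y, hy, h0, h1, h2', h3'⟩ := hx.exists_basis huv0 hx.lie_four hne
      exact ⟨y, hy, by rw [h2', hz _ (hLc _ _)], by rw [h3', h3],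
        Or.inl (Or.inr (Or.inr ⟨hp, by rw [h0, h2', hu], ξ, by rw [h1, h2', hv]⟩))⟩

end

end ClassTwoFour

/-! ### Invariants relative to the centre and to brackets. -/

section LieInvariants

variable {F L : Type*} [Field F] [LieRing L] [LieAlgebra F L] {φ ψ : L → L}

lemma Equivalent.forall_central_iff (h : Equivalent F φ ψ) :
    (∀ z, (∀ a : L, ⁅z, a⁆ = 0) → φ z = 0) ↔ ∀ z, (∀ a : L, ⁅z, a⁆ = 0) → ψ z = 0 := by
  have key : ∀ φ ψ : L → L, Equivalent F φ ψ → (∀ z, (∀ a : L, ⁅z, a⁆ = 0) → φ z = 0) →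
      ∀ z, (∀ a : L, ⁅z, a⁆ = 0) → ψ z = 0 := by
    rintro φ ψ ⟨A, hA⟩ h z hz
    rw [← A.apply_symm_apply z, ← hA, h, map_zero]
    intro a
    rw [← A.symm_apply_apply a, ← LieEquiv.map_lie, hz, map_zero]
  exact ⟨key φ ψ h, key ψ φ h.symm⟩

lemma Equivalent.forall_lie_iff (h : Equivalent F φ ψ) :
    (∀ a b : L, φ ⁅a, b⁆ = 0) ↔ ∀ a b : L, ψ ⁅a, b⁆ = 0 := by
  have key : ∀ φ ψ : L → L, Equivalent F φ ψ → (∀ a b : L, φ ⁅a, b⁆ = 0) →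
      ∀ a b : L, ψ ⁅a, b⁆ = 0 := by
    rintro φ ψ ⟨A, hA⟩ h a b
    rw [← A.apply_symm_apply a, ← A.apply_symm_apply b, ← LieEquiv.map_lie, ← hA, h, map_zero]
  exact ⟨key φ ψ h, key ψ φ h.symm⟩

lemma Equivalent.forall_exists_lie_iff (h : Equivalent F φ ψ) :
    (∀ a, ∃ b c : L, φ a = ⁅b, c⁆) ↔ ∀ a, ∃ b c : L, ψ a = ⁅b, c⁆ := by
  have key : ∀ φ ψ : L → L, Equivalent F φ ψ → (∀ a, ∃ b c : L, φ a = ⁅b, c⁆) →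
      ∀ a, ∃ b c : L, ψ a = ⁅b, c⁆ := by
    rintro φ ψ ⟨A, hA⟩ h a
    obtain ⟨b, c, hbc⟩ := h (A.symm a)
    exact ⟨A b, A c, by rw [← LieEquiv.map_lie, ← hbc, hA, A.apply_symm_apply]⟩
  exact ⟨key φ ψ h, key ψ φ h.symm⟩

/-- For `L_{4,2}` this invariant says that the image of the map meets the derived algebra only in
zero. -/
lemma Equivalent.forall_eq_zero_iff (h : Equivalent F φ ψ) :
    (∀ a, (∃ b c : L, φ a = ⁅b, c⁆) → φ a = 0) ↔ ∀ a, (∃ b c : L, ψ a = ⁅b, c⁆) → ψ a = 0 := by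
  have key : ∀ φ ψ : L → L, Equivalent F φ ψ → (∀ a, (∃ b c : L, φ a = ⁅b, c⁆) → φ a = 0) →
      ∀ a, (∃ b c : L, ψ a = ⁅b, c⁆) → ψ a = 0 := by
    rintro φ ψ ⟨A, hA⟩ h a ⟨b, c, hbc⟩
    rw [← A.apply_symm_apply a, ← hA, h, map_zero]
    refine ⟨A.symm b, A.symm c, ?_⟩
    apply A.injective
    change A (φ _) = A ⁅_, _⁆
    rw [hA, LieEquiv.map_lie]
    simp only [A.apply_symm_apply, hbc]
  exact ⟨key φ ψ h, key ψ φ h.symm⟩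

end LieInvariants

/-! ### `L_{4,2}` in odd characteristic. -/

section ClassTwoFour

variable {F L : Type*} [Field F] [LieRing L] [LieAlgebra F L] {p : ℕ} {φ ψ : L → L}
  {x : Module.Basis (Fin 4) F L}

lemma IsL42.forall_lie_iff (hx : IsL42 x) (h : IsPMap F p φ) :
    (∀ a b : L, φ ⁅a, b⁆ = 0) ↔ φ (x 2) = 0 := by
  refine ⟨fun h' => by rw [← hx.lie_12, h'], fun h' a b => ?_⟩
  rw [hx.isHeisenbergType.lie_eq, h.map_smul, h', smul_zero]

variable [Fact p.Prime]

lemma IsL42.forall_central_iff (hx : IsL42 x) (h : IsPMap F p φ) :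
    (∀ z, (∀ a : L, ⁅z, a⁆ = 0) → φ z = 0) ↔ φ (x 2) = 0 ∧ φ (x 3) = 0 := by
  refine ⟨fun h' => ⟨h' _ hx.isHeisenbergType.lie_central, h' _ hx.lie_four⟩,
    fun h' z hz => ?_⟩
  rw [hx.eq_of_central hz, hx.apply_central h, h'.1, h'.2]
  simp

/-- The derived algebra is the line `F x 2`, and each of its elements is a single bracket, so no
span of brackets is needed. -/
lemma IsL42.exists_lie_iff (hx : IsL42 x) (h : IsPMap F p φ) (a : L) :
    (∃ b c : L, φ a = ⁅b, c⁆) ↔ x.repr (φ a) 3 = 0 := by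
  constructor
  · rintro ⟨b, c, hbc⟩
    rw [hbc, hx.isHeisenbergType.lie_eq]
    simp
  · intro h'
    have := hx.apply_eq h a
    rw [h', zero_smul, add_zero] at this
    exact ⟨x.repr (φ a) 2 • x 0, x 1, by rw [smul_lie, hx.lie_12, ← this]⟩

variable [CharP F p]

lemma IsL42.repr_apply (hx : IsL42 x) (h : IsPMap F p φ) (a : L) :
    x.repr (φ a) 3 = x.repr a 0 ^ p * x.repr (φ (x 0)) 3 + x.repr a 1 ^ p * x.repr (φ (x 1)) 3 +
      x.repr a 2 ^ p * x.repr (φ (x 2)) 3 + x.repr a 3 ^ p * x.repr (φ (x 3)) 3 := by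
  conv_lhs => rw [h.apply_eq_of_isHeisenbergType hx.isHeisenbergType a, Fin.sum_univ_four]
  simp

lemma IsL42.forall_exists_lie_iff (hx : IsL42 x) (h : IsPMap F p φ) :
    (∀ a, ∃ b c : L, φ a = ⁅b, c⁆) ↔ ∀ k, x.repr (φ (x k)) 3 = 0 := by
  refine ⟨fun h' k => (hx.exists_lie_iff h _).1 (h' _), fun h' a => ?_⟩
  rw [hx.exists_lie_iff h, hx.repr_apply h, h', h', h', h']
  simp

lemma IsL42.not_forall_eq_zero (hx : IsL42 x) (h0 : φ (x 0) = x 2) :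
    ¬ ∀ a, (∃ b c : L, φ a = ⁅b, c⁆) → φ a = 0 := fun h' =>
  x.ne_zero 2 (by rw [← h0, h' (x 0) ⟨x 0, x 1, by rw [h0, hx.lie_12]⟩])

lemma IsL42.forall_eq_zero (hx : IsL42 x) (h : IsPMap F p φ) (h0 : φ (x 0) = x 3)
    (h1 : φ (x 1) = 0) (h2 : φ (x 2) = 0) (h3 : φ (x 3) = 0) :
    ∀ a, (∃ b c : L, φ a = ⁅b, c⁆) → φ a = 0 := by
  intro a ha
  have hp : p ≠ 0 := (Fact.out : p.Prime).ne_zero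
  rw [hx.exists_lie_iff h, hx.repr_apply h, h0, h1, h2, h3] at ha
  have ha0 : x.repr a 0 = 0 := by simpa [hp] using ha
  rw [h.apply_eq_of_isHeisenbergType hx.isHeisenbergType a, Fin.sum_univ_four, h0, h1, h2, h3, ha0]
  simp [hp]

variable [PerfectField F]

/-- The hypotheses encode, in order: the centre is killed; the derived algebra is killed; the image
lies in it; the image meets it trivially; the square is zero. The last two are compared only where
the first holds, respectively fails, for both entries. -/
lemma eq_of_invariants (i j : Fin 8) (e1 : i ≤ 3 ↔ j ≤ 3) (e2 : i ≤ 3 ∨ 6 ≤ i ↔ j ≤ 3 ∨ 6 ≤ j)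
    (e3 : i = 0 ∨ i = 1 ∨ i = 6 ↔ j = 0 ∨ j = 1 ∨ j = 6)
    (e4 : i ≤ 3 → j ≤ 3 → (i = 0 ∨ i = 2 ↔ j = 0 ∨ j = 2))
    (e5 : 4 ≤ i → 4 ≤ j → (i = 4 ∨ i = 6 ↔ j = 4 ∨ j = 6)) : i = j := by
  omega

theorem IsL42.classifies (hx : IsL42 x) (hp : 3 ≤ p) :
    Classifies p x ![![0, 0, 0, 0], ![x 2, 0, 0, 0], ![x 3, 0, 0, 0], ![x 2, x 3, 0, 0],
          ![0, 0, x 3, 0], ![0, x 2, x 3, 0], ![0, 0, 0, x 2], ![0, x 3, 0, x 2]]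
        (fun i j : Fin 8 => i = j) := by
  have hH := hx.isHeisenbergType
  have hp0 : p ≠ 0 := by omega
  have hp2 : p ≠ 2 := by omega
  refine classifies_of_tables IsL42
    (fun x y hx hy => hx.isHeisenbergType.equiv_lie hy.isHeisenbergType)
    (fun x => ![![0, 0, 0, 0], ![x 2, 0, 0, 0], ![x 3, 0, 0, 0], ![x 2, x 3, 0, 0],
          ![0, 0, x 3, 0], ![0, x 2, x 3, 0], ![0, 0, 0, x 2], ![0, x 3, 0, x 2]])
    (fun x y i k => by fin_cases i <;> fin_cases k <;> simp) x hx
    ⟨_, hH.isPMap (p := p), hH.isPMap_basis⟩ _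
    (fun i k a => by fin_cases i <;> fin_cases k <;> simp [hH.lie_central, hx.lie_four])
    (fun i φ h => hx.isPNilpotent h.1 ?_) ?_
    (fun i j φ h h' => absurd h h') ?_
  · have h2 := h.2 2
    have h3 := h.2 3
    have hφ0 := h.1.map_zero hp0
    clear h
    rw [h2, h3]
    fin_cases i <;> simp at h2 h3 ⊢ <;> simp [h2, h3, hφ0]
  · intro φ h hn
    by_cases h2 : φ (x 2) = 0
    · by_cases h3 : φ (x 3) = 0
      · obtain ⟨y, hy, h2, h3, (⟨-, h0, h1⟩ | ⟨-, h0, h1⟩ | ⟨h', -⟩) | ⟨h0, h1⟩ | ⟨h0, h1⟩⟩ :=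
          hx.complete_of_apply_center_eq_zero h h2 h3
        · exact ⟨0, y, hy, fun k => by fin_cases k <;> simpa⟩
        · exact ⟨1, y, hy, fun k => by fin_cases k <;> simpa⟩
        · exact absurd h' hp2
        · exact ⟨2, y, hy, fun k => by fin_cases k <;> simpa⟩
        · exact ⟨3, y, hy, fun k => by fin_cases k <;> simpa⟩
      · obtain ⟨y, hy, h0, h2, h3, h1 | h1⟩ := hx.complete_of_apply_four_ne_zero h hn h2 h3
        · exact ⟨6, y, hy, fun k => by fin_cases k <;> simpa⟩
        · exact ⟨7, y, hy, fun k => by fin_cases k <;> simpa⟩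
    · obtain ⟨y, hy, h2, h3, ⟨-, h0, h1⟩ | ⟨-, h0, h1⟩ | ⟨h', -⟩⟩ :=
        hx.complete_of_apply_three_ne_zero h hn h2
      · exact ⟨4, y, hy, fun k => by fin_cases k <;> simpa⟩
      · exact ⟨5, y, hy, fun k => by fin_cases k <;> simpa⟩
      · exact absurd h' hp2
  · have key : ∀ i χ, Realizes p x (![![0, 0, 0, 0], ![x 2, 0, 0, 0], ![x 3, 0, 0, 0],
          ![x 2, x 3, 0, 0], ![0, 0, x 3, 0], ![0, x 2, x 3, 0], ![0, 0, 0, x 2],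
          ![0, x 3, 0, x 2]] i) χ →
        ((∀ z, (∀ a : L, ⁅z, a⁆ = 0) → χ z = 0) ↔ i ≤ 3) ∧
        ((∀ a b : L, χ ⁅a, b⁆ = 0) ↔ i ≤ 3 ∨ 6 ≤ i) ∧
        ((∀ a, ∃ b c : L, χ a = ⁅b, c⁆) ↔ i = 0 ∨ i = 1 ∨ i = 6) := by
      intro i χ h
      rw [hx.forall_central_iff h.1, hx.forall_lie_iff h.1, hx.forall_exists_lie_iff h.1]
      have hv := h.2
      have h2 := x.ne_zero 2
      have h3 := x.ne_zero 3
      clear h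
      fin_cases i <;> simp [Fin.forall_fin_succ] at hv <;>
        simp [Fin.forall_fin_succ, hv, h2, h3]
    have key₂ : ∀ i χ, Realizes p x (![![0, 0, 0, 0], ![x 2, 0, 0, 0], ![x 3, 0, 0, 0],
          ![x 2, x 3, 0, 0], ![0, 0, x 3, 0], ![0, x 2, x 3, 0], ![0, 0, 0, x 2],
          ![0, x 3, 0, x 2]] i) χ → i ≤ 3 →
        ((∀ a, (∃ b c : L, χ a = ⁅b, c⁆) → χ a = 0) ↔ i = 0 ∨ i = 2) := by
      intro i χ h hi
      have hv := h.2
      fin_cases i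
      · refine iff_of_true (fun a _ => ?_) (by simp)
        rw [h.1.apply_eq_of_isHeisenbergType hH a, Fin.sum_univ_four, hv, hv, hv, hv]
        simp [jacobsonScalar, hp2]
      · exact iff_of_false (hx.not_forall_eq_zero (hv 0)) (by decide)
      · exact iff_of_true (hx.forall_eq_zero h.1 (hv 0) (hv 1) (hv 2) (hv 3)) (by simp)
      · exact iff_of_false (hx.not_forall_eq_zero (hv 0)) (by decide)
      all_goals exact absurd hi (by decide)
    have key₃ : ∀ i χ, Realizes p x (![![0, 0, 0, 0], ![x 2, 0, 0, 0], ![x 3, 0, 0, 0],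
          ![x 2, x 3, 0, 0], ![0, 0, x 3, 0], ![0, x 2, x 3, 0], ![0, 0, 0, x 2],
          ![0, x 3, 0, x 2]] i) χ → 4 ≤ i →
        ((∀ a, χ^[2] a = 0) ↔ i = 4 ∨ i = 6) := by
      intro i χ h hi
      have hv := h.2
      have hχ : ∀ a, χ a = ∑ l, x.repr a l ^ p • χ (x l) := by
        intro a
        rw [h.1.apply_eq_of_isHeisenbergType hH a]
        simp [jacobsonScalar, hp2]
      fin_cases i
      iterate 4 exact absurd hi (by decide)
      · refine iff_of_true (fun a => ?_) (by simp)
        change χ (χ a) = 0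
        rw [hχ a, Fin.sum_univ_four, hv, hv, hv, hv]
        simp [h.1.map_smul, hv]
      · refine iff_of_false (fun h' => x.ne_zero 3 ?_) (by decide)
        rw [← h' (x 1)]
        change _ = χ (χ (x 1))
        rw [hv]
        exact (hv 2).symm
      · refine iff_of_true (fun a => ?_) (by simp)
        change χ (χ a) = 0
        rw [hχ a, Fin.sum_univ_four, hv, hv, hv, hv]
        simp [h.1.map_smul, hv]
      · refine iff_of_false (fun h' => x.ne_zero 2 ?_) (by decide)
        rw [← h' (x 1)]
        change _ = χ (χ (x 1))
        rw [hv]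
        exact (hv 3).symm
    intro i j φ ψ hi hj hE
    obtain ⟨i1, i2, i3⟩ := key i φ hi
    obtain ⟨j1, j2, j3⟩ := key j ψ hj
    have e1 := (i1.symm.trans hE.forall_central_iff).trans j1
    have e2 := (i2.symm.trans hE.forall_lie_iff).trans j2
    have e3 := (i3.symm.trans hE.forall_exists_lie_iff).trans j3
    have e4 : i ≤ 3 → j ≤ 3 → (i = 0 ∨ i = 2 ↔ j = 0 ∨ j = 2) := fun hi' hj' =>
      ((key₂ i φ hi hi').symm.trans hE.forall_eq_zero_iff).trans (key₂ j ψ hj hj')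
    have e5 : 4 ≤ i → 4 ≤ j → (i = 4 ∨ i = 6 ↔ j = 4 ∨ j = 6) := fun hi' hj' =>
      ((key₃ i φ hi hi').symm.trans (hE.forall_iterate_iff 2)).trans (key₃ j ψ hj hj')
    exact eq_of_invariants i j e1 e2 e3 e4 e5

end ClassTwoFour

/-! ### `L_{4,2}` in characteristic 2. -/

section ClassTwoFourTwo

variable {F L : Type*} [Field F] [LieRing L] [LieAlgebra F L] {φ ψ : L → L}
  [CharP F 2] [PerfectField F] {x : Module.Basis (Fin 4) F L}

theorem IsL42.classifies_two (hx : IsL42 x) :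
    Classifies 2 x (Index42Two.values x) Index42Two.Rel := by
  have hH := hx.isHeisenbergType
  have : Fact (Nat.Prime 2) := ⟨Nat.prime_two⟩
  refine classifies_of_tables IsL42
    (fun x y hx hy => hx.isHeisenbergType.equiv_lie hy.isHeisenbergType)
    Index42Two.values
    (fun x y i k => by cases i <;> fin_cases k <;> simp [Index42Two.values]) x hx
    ⟨_, hH.isPMap (p := 2), hH.isPMap_basis⟩ _
    (fun i k a => by
      cases i <;> fin_cases k <;> simp [Index42Two.values, hH.lie_central, hx.lie_four])
    (fun i φ h => hx.isPNilpotent h.1 ?_) ?_ ?_ ?_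
  · have h2 := h.2 2
    have h3 := h.2 3
    have hφ0 := h.1.map_zero two_ne_zero
    clear h
    rw [h2, h3]
    cases i <;> simp [Index42Two.values] at h2 h3 ⊢ <;> simp [h2, h3, hφ0]
  · intro φ h hn
    by_cases h2 : φ (x 2) = 0
    · by_cases h3 : φ (x 3) = 0
      · obtain ⟨y, hy, h2, h3, (⟨h', -⟩ | ⟨h', -⟩ | ⟨-, h0, ξ, h1⟩) | ⟨h0, h1⟩ | ⟨h0, h1⟩⟩ :=
          hx.complete_of_apply_center_eq_zero h h2 h3
        · exact absurd rfl h'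
        · exact absurd rfl h'
        · exact ⟨.a ξ, y, hy, fun k => by fin_cases k <;> simpa⟩
        · exact ⟨.b, y, hy, fun k => by fin_cases k <;> simpa⟩
        · exact ⟨.c, y, hy, fun k => by fin_cases k <;> simpa⟩
      · obtain ⟨y, hy, h0, h2, h3, h1 | h1⟩ := hx.complete_of_apply_four_ne_zero h hn h2 h3
        · exact ⟨.e, y, hy, fun k => by fin_cases k <;> simpa⟩
        · exact ⟨.f, y, hy, fun k => by fin_cases k <;> simpa⟩
    · obtain ⟨y, hy, h2, h3, ⟨h', -⟩ | ⟨h', -⟩ | ⟨-, h0, ξ, h1⟩⟩ :=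
        hx.complete_of_apply_three_ne_zero h hn h2
      · exact absurd rfl h'
      · exact absurd rfl h'
      · exact ⟨.d ξ, y, hy, fun k => by fin_cases k <;> simpa⟩
  · intro i j φ hr hij h
    -- Only the second generator changes; the two central basis vectors are kept, so both parametric
    -- families are treated at once.
    have key : ∀ ξ₁ ξ₂ : F, ξ₁ + ξ₂ ∈ artinSchreier F → φ (x 0) = x 2 → φ (x 1) = ξ₂ • x 2 →
        ∃ y : Module.Basis (Fin 4) F L, IsL42 y ∧ φ (y 0) = y 2 ∧ φ (y 1) = ξ₁ • y 2 ∧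
          y 2 = x 2 ∧ y 3 = x 3 := by
      intro ξ₁ ξ₂ hξ h0 h1
      obtain ⟨v, hv, hφv⟩ :=
        h.1.apply_add_smul_of_char_two hH.lie_lie hx.lie_12 h0 h1 hξ
      obtain ⟨y, hy, h0', h1', h2', h3'⟩ := hx.exists_basis (u := x 0) (v := v) (z := x 3)
        (by simp [hv, x.ne_zero]) hx.lie_four (fun c hc => by
          rw [hv, ← sub_eq_zero] at hc
          refine one_ne_zero (α := F) (IsL42.coeff_eq_zero (x := x) (c := -c) ?_).2
          rw [← hc]
          module)
      rw [hv] at h2'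
      exact ⟨y, hy, by rw [h0', h0, h2'], by rw [h1', hφv, h2'], h2', h3'⟩
    cases i <;> cases j <;> first | exact absurd hr id | exact absurd rfl hij | skip
    · obtain ⟨y, hy, h0, h1, h2, h3⟩ := key _ _ hr (h.2 0) (h.2 1)
      refine ⟨y, hy, fun k => ?_⟩
      fin_cases k
      · exact h0
      · exact h1
      · exact (congrArg φ h2).trans (h.2 2)
      · exact (congrArg φ h3).trans (h.2 3)
    · obtain ⟨y, hy, h0, h1, h2, h3⟩ := key _ _ hr (h.2 0) (h.2 1)
      refine ⟨y, hy, fun k => ?_⟩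
      fin_cases k
      · exact h0
      · exact h1
      · exact (congrArg φ h2).trans ((h.2 2).trans h3.symm)
      · exact (congrArg φ h3).trans (h.2 3)
  · have key : ∀ i χ, Realizes 2 x (Index42Two.values x i) χ →
        ((∀ z, (∀ a : L, ⁅z, a⁆ = 0) → χ z = 0) ↔ (∃ ξ, i = .a ξ) ∨ i = .b ∨ i = .c) ∧
        ((∀ a b : L, χ ⁅a, b⁆ = 0) ↔ ¬ ∃ ξ, i = .d ξ) ∧
        ((∀ a, ∃ b c : L, χ a = ⁅b, c⁆) ↔ (∃ ξ, i = .a ξ) ∨ i = .e) := by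
      intro i χ h
      rw [hx.forall_central_iff h.1, hx.forall_lie_iff h.1, hx.forall_exists_lie_iff h.1]
      have hv := h.2
      have h2 := x.ne_zero 2
      have h3 := x.ne_zero 3
      clear h
      cases i <;> simp [Fin.forall_fin_succ, Index42Two.values] at hv <;>
        simp [Fin.forall_fin_succ, hv, h2, h3]
    have key₂ : ∀ i χ, Realizes 2 x (Index42Two.values x i) χ →
        (∃ ξ, i = .a ξ) ∨ i = .b ∨ i = .c →
        ((∀ a, (∃ b c : L, χ a = ⁅b, c⁆) → χ a = 0) ↔ i = .b) := by
      rintro i χ h (⟨ξ, rfl⟩ | rfl | rfl)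
      · exact iff_of_false (hx.not_forall_eq_zero (h.2 0)) (by simp)
      · exact iff_of_true (hx.forall_eq_zero h.1 (h.2 0) (h.2 1) (h.2 2) (h.2 3)) rfl
      · exact iff_of_false (hx.not_forall_eq_zero (h.2 0)) (by simp)
    intro i j φ ψ hi hj hE
    obtain ⟨i1, i2, i3⟩ := key i φ hi
    obtain ⟨j1, j2, j3⟩ := key j ψ hj
    have e1 := (i1.symm.trans hE.forall_central_iff).trans j1
    have e2 := (i2.symm.trans hE.forall_lie_iff).trans j2
    have e3 := (i3.symm.trans hE.forall_exists_lie_iff).trans j3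
    have e4 := fun hi' hj' =>
      ((key₂ i φ hi hi').symm.trans hE.forall_eq_zero_iff).trans (key₂ j ψ hj hj')
    clear i1 i2 i3 j1 j2 j3 key key₂
    -- The invariants separate the six families; the two cases that remain are a parametric family
    -- against itself, where the Arf invariant decides.
    cases i <;> cases j <;> first | exact trivial | (exfalso; simp at e1 e2 e3 e4; done) | skip
    · refine hE.add_mem_artinSchreier hH hj.1 (hi.2 0) (hi.2 1) (hj.2 0) (hj.2 1)
        fun l h0 h1 => ?_
      rw [hj.2]
      fin_cases l <;> simp_all [Index42Two.values]
    · refine hE.add_mem_artinSchreier hH hj.1 (hi.2 0) (hi.2 1) (hj.2 0) (hj.2 1)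
        fun l h0 h1 => ?_
      rw [hj.2]
      fin_cases l <;> simp_all [Index42Two.values]

end ClassTwoFourTwo

/-! ### The filiform algebra `L_{4,3}`: explicit `[p]`-maps and changes of generators. -/

section Filiform

variable {F L : Type*} [Field F] [LieRing L] [LieAlgebra F L] {p : ℕ} {φ ψ : L → L}
  {x : Module.Basis (Fin 4) F L}

lemma IsL43.lie_eq (hx : IsL43 x) (a b : L) :
    ⁅a, b⁆ = (x.repr a 0 * x.repr b 1 - x.repr a 1 * x.repr b 0) • x 2 +
      (x.repr a 0 * x.repr b 2 - x.repr a 2 * x.repr b 0) • x 3 := by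
  have h21 : ⁅x 1, x 0⁆ = -x 2 := by rw [← lie_skew, hx.lie_12]
  have h31 : ⁅x 2, x 0⁆ = -x 3 := by rw [← lie_skew, hx.lie_13]
  have h32 : ⁅x 2, x 1⁆ = 0 := by rw [← lie_skew, hx.lie_23, neg_zero]
  have h41 : ⁅x 3, x 0⁆ = 0 := by rw [← lie_skew, hx.lie_14, neg_zero]
  have h42 : ⁅x 3, x 1⁆ = 0 := by rw [← lie_skew, hx.lie_24, neg_zero]
  have h43 : ⁅x 3, x 2⁆ = 0 := by rw [← lie_skew, hx.lie_34, neg_zero]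
  conv_lhs => rw [← x.sum_repr a, ← x.sum_repr b, Fin.sum_univ_four, Fin.sum_univ_four]
  simp only [lie_add, add_lie, smul_lie, lie_smul, lie_self, hx.lie_12, hx.lie_13, hx.lie_23,
    hx.lie_14, hx.lie_24, hx.lie_34, h21, h31, h32, h41, h42, h43]
  module

lemma IsL43.equiv_lie {y : Module.Basis (Fin 4) F L} (hx : IsL43 x) (hy : IsL43 y)
    (l m : Fin 4) : x.equiv y (Equiv.refl _) ⁅x l, x m⁆ = ⁅y l, y m⁆ := by
  rw [hx.lie_eq, hy.lie_eq]
  simp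

lemma IsL43.lie_lie (hx : IsL43 x) (a b c : L) : ⁅a, ⁅b, c⁆⁆ =
    (x.repr a 0 * (x.repr b 0 * x.repr c 1 - x.repr b 1 * x.repr c 0)) • x 3 := by
  rw [hx.lie_eq b c, hx.lie_eq]
  simp

lemma IsL43.lie_four (hx : IsL43 x) (a : L) : ⁅x 3, a⁆ = 0 := by
  rw [hx.lie_eq]
  simp

lemma IsL43.lie_lie_lie (hx : IsL43 x) (a b c d : L) : ⁅a, ⁅b, ⁅c, d⁆⁆⁆ = 0 := by
  rw [hx.lie_lie b, lie_smul, ← lie_skew, hx.lie_four, neg_zero, smul_zero]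

lemma IsL43.eq_of_central (hx : IsL43 x) {z : L} (hz : ∀ a : L, ⁅z, a⁆ = 0) :
    z = x.repr z 3 • x 3 := by
  have h0 := congrArg (fun a => x.repr a 2) (hz (x 1))
  have h1 := congrArg (fun a => x.repr a 2) (hz (x 0))
  have h2 := congrArg (fun a => x.repr a 3) (hz (x 0))
  simp only [hx.lie_eq] at h0 h1 h2
  simp at h0 h1 h2
  conv_lhs => rw [← x.sum_repr z, Fin.sum_univ_four, h0, h1, h2]
  simp

lemma IsL43.ad_pow_eq_zero (hx : IsL43 x) (hp : 3 ≤ p) (a : L) :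
    (LieAlgebra.ad F L a) ^ p = 0 := by
  obtain ⟨k, rfl⟩ := Nat.exists_eq_add_of_le' hp
  have : (LieAlgebra.ad F L a) ^ 3 = 0 := by
    ext b
    simp only [pow_succ, pow_zero, one_mul, Module.End.mul_apply, LieAlgebra.ad_apply,
      hx.lie_lie_lie]
    rfl
  rw [pow_add, this, mul_zero]

/-- A basis with the brackets of `L_{4,3}` from two generators. -/
lemma IsL43.exists_basis (hx : IsL43 x) {u v w z : L} (hw : ⁅u, v⁆ = w) (hz : ⁅u, w⁆ = z)
    (hz0 : z ≠ 0) (hvw : ⁅v, w⁆ = 0) :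
    ∃ y : Module.Basis (Fin 4) F L, IsL43 y ∧ y 0 = u ∧ y 1 = v ∧ y 2 = w ∧ y 3 = z := by
  have hL : ∀ a : L, ⁅a, z⁆ = 0 := fun a => by rw [← hz, ← hw, hx.lie_lie_lie]
  have hwu : ⁅w, u⁆ = -z := by rw [← lie_skew, hz]
  have hwv : ⁅w, v⁆ = 0 := by rw [← lie_skew, hvw, neg_zero]
  obtain ⟨y, h0, h1, h2, h3⟩ := exists_basis_four (F := F)
    (by simp [Module.finrank_eq_card_basis x]) u v w z (by
      intro c d e f h
      -- Bracketing with `w` kills every vector except `u`; bracketing with `u` afterwards moves the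
      -- rest down the chain `v`, `w`, `z`.
      have hc : c = 0 := by
        have := congrArg (fun a => ⁅w, a⁆) h
        simpa [lie_add, lie_smul, hwu, hwv, hL, hz0] using this
      subst hc
      have hde : d • w + e • z = 0 := by
        have := congrArg (fun a => ⁅u, a⁆) h
        simpa [lie_add, lie_smul, hw, hz, hL] using this
      have hd : d = 0 := by
        have := congrArg (fun a => ⁅u, a⁆) hde
        simpa [lie_add, lie_smul, hz, hL, hz0] using this
      subst hd
      have he : e = 0 := by simpa [hz0] using hde
      subst he
      exact ⟨rfl, rfl, rfl, by simpa [hz0] using h⟩)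
  exact ⟨y, ⟨by rw [h0, h1, h2, hw], by rw [h0, h2, h3, hz], by rw [h3, hL], by rw [h1, h2, hvw],
    by rw [h3, hL], by rw [h3, hL]⟩, h0, h1, h2, h3⟩

/-- The coefficient of `[b, [b, a]] + [a, [a, b]]` in Jacobson's formula for a Lie algebra of
class three in odd characteristic. -/
def jacobsonScalarThree (F : Type*) [Field F] (p : ℕ) : F := if p = 3 then 1 else 0

lemma jacobsonScalarThree_mul_pow (c : F) :
    jacobsonScalarThree F p * c ^ p = jacobsonScalarThree F p * c ^ 3 := by
  rw [jacobsonScalarThree]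
  split_ifs with h
  · rw [h]
  · simp

lemma IsL43.isPMap_basis (k : Fin 4) :
    (jacobsonScalarThree F p * x.repr (x k) 0 ^ 2 * x.repr (x k) 1) • x 3 = 0 := by
  fin_cases k <;> simp

lemma IsL43.exists_apply_eq_smul (hx : IsL43 x) (hp : 3 ≤ p) (h : IsPMap F p φ)
    (hn : IsPNilpotent φ) : ∃ f : Fin 4 → F, (∀ k, φ (x k) = f k • x 3) ∧ f 3 = 0 := by
  have hf : ∀ k, φ (x k) = x.repr (φ (x k)) 3 • x 3 := fun k =>
    hx.eq_of_central (h.lie_eq_zero (hx.ad_pow_eq_zero hp) _)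
  refine ⟨fun k => x.repr (φ (x k)) 3, hf, ?_⟩
  change x.repr (φ (x 3)) 3 = 0
  rw [hn.eq_zero_of_apply_eq_smul h (hf 3)]
  simp

lemma IsL43.isPNilpotent (hx : IsL43 x) (hp : 3 ≤ p) (h : IsPMap F p φ) (h3 : φ (x 3) = 0) :
    IsPNilpotent φ := by
  refine ⟨2, fun a => ?_⟩
  change φ (φ a) = 0
  rw [hx.eq_of_central (h.lie_eq_zero (hx.ad_pow_eq_zero hp) a), h.map_smul, h3, smul_zero]

variable [CharP F p]

lemma three_mul_jacobsonScalarThree : 3 * jacobsonScalarThree F p = 0 := by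
  rw [jacobsonScalarThree]
  split_ifs with h
  · subst h
    exact_mod_cast CharP.cast_eq_zero F 3
  · simp

lemma jacobsonSum_of_class_three' (hp : 3 ≤ p) (hL : ∀ a b c d : L, ⁅a, ⁅b, ⁅c, d⁆⁆⁆ = 0)
    (a b : L) :
    jacobsonSum F p a b = jacobsonScalarThree F p • (⁅b, ⁅b, a⁆⁆ + ⁅a, ⁅a, b⁆⁆) := by
  rw [jacobsonScalarThree]
  split_ifs with h
  · subst h
    rw [jacobsonSum_three, one_smul]
  · rw [jacobsonSum_of_class_three (by omega) hL, zero_smul]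

/-- The `[p]`-map vanishing on the basis. -/
lemma IsL43.isPMap (hx : IsL43 x) (hp : 3 ≤ p) :
    IsPMap F p
      (fun a => (jacobsonScalarThree F p * x.repr a 0 ^ 2 * x.repr a 1) • x 3) where
  ad_pow a := by
    rw [hx.ad_pow_eq_zero hp]
    ext b
    rw [LieAlgebra.ad_apply, smul_lie, hx.lie_four, smul_zero]
    rfl
  map_smul c a := by
    have := jacobsonScalarThree_mul_pow (p := p) c
    rw [smul_smul, map_smul]
    congr 1
    simp only [Finsupp.smul_apply, smul_eq_mul]
    linear_combination -x.repr a 0 ^ 2 * x.repr a 1 * this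
  map_add a b := by
    change _ = _ + _ + jacobsonSum F p a b
    have := three_mul_jacobsonScalarThree (p := p) (F := F)
    rw [jacobsonSum_of_class_three' hp hx.lie_lie_lie, hx.lie_lie, hx.lie_lie, map_add, ← add_smul,
      ← add_smul, smul_smul, ← add_smul]
    congr 1
    simp only [Finsupp.add_apply]
    -- The cross terms of `(a₀ + b₀)² (a₁ + b₁)` exceed the double brackets by `3 a₀ b₀ (a₁ + b₁)`.
    linear_combination
      (x.repr a 0 * x.repr b 0 * x.repr a 1 + x.repr a 0 * x.repr b 0 * x.repr b 1) * this

variable [Fact p.Prime]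

lemma IsPMap.apply_eq_of_isL43 (h : IsPMap F p φ) (hx : IsL43 x) (hp : 3 ≤ p)
    {f : Fin 4 → F} (hf : ∀ k, φ (x k) = f k • x 3) (a : L) :
    φ a = (∑ k, x.repr a k ^ p * f k +
      jacobsonScalarThree F p * x.repr a 0 ^ 2 * x.repr a 1) • x 3 := by
  have hp0 : p ≠ 0 := by omega
  have key : IsPMap F p
      (fun a => (jacobsonScalarThree F p * x.repr a 0 ^ 2 * x.repr a 1) • x 3 +
        semilinearExtension p x (fun l => φ (x l)) a) :=
    (hx.isPMap hp).add_semilinearExtension x _ fun l b =>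
      h.lie_eq_zero (hx.ad_pow_eq_zero hp) _ b
  rw [h.ext_basis hp0 x key fun l => by
    rw [IsL43.isPMap_basis, semilinearExtension_basis hp0, zero_add]]
  simp only [semilinearExtension, hf, smul_smul]
  rw [add_smul, Finset.sum_smul, add_comm]

/-- The table of a `[p]`-map after a change of the generators `x₁`, `x₂`. -/
lemma IsL43.exists_basis_apply (hx : IsL43 x) (hp : 3 ≤ p) (h : IsPMap F p φ)
    {f : Fin 4 → F} (hf : ∀ k, φ (x k) = f k • x 3) (hf3 : f 3 = 0)
    {s t : F} (hs : s ≠ 0) (ht : t ≠ 0) (e r q : F) :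
    ∃ y : Module.Basis (Fin 4) F L, IsL43 y ∧ y 3 = (s ^ 2 * t) • x 3 ∧
      φ (y 0) = (s ^ p * f 0 + e ^ p * f 1 + r ^ p * f 2 +
        jacobsonScalarThree F p * s ^ 2 * e) • x 3 ∧
      φ (y 1) = (t ^ p * f 1 + q ^ p * f 2) • x 3 ∧ φ (y 2) = ((s * t) ^ p * f 2) • x 3 ∧
      φ (y 3) = 0 := by
  have hp0 : p ≠ 0 := by omega
  have hw : ⁅s • x 0 + e • x 1 + r • x 2, t • x 1 + q • x 2⁆ =
      (s * t) • x 2 + (s * q) • x 3 := by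
    rw [hx.lie_eq]
    simp
  have hz : ⁅s • x 0 + e • x 1 + r • x 2, (s * t) • x 2 + (s * q) • x 3⁆ =
      (s ^ 2 * t) • x 3 := by
    rw [hx.lie_eq]
    simp
    ring_nf
  obtain ⟨y, hy, h0, h1, h2, h3⟩ := hx.exists_basis hw hz (by simp [hs, ht, x.ne_zero]) (by
    rw [hx.lie_eq]
    simp)
  have key := h.apply_eq_of_isL43 hx hp hf
  refine ⟨y, hy, h3, ?_, ?_, ?_, ?_⟩
  · rw [key, h0, Fin.sum_univ_four]
    simp [hf3]
  · rw [key, h1, Fin.sum_univ_four]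
    simp [hf3, hp0]
  · rw [key, h2, Fin.sum_univ_four]
    simp [hf3, hp0]
  · rw [h3, h.map_smul, hf, hf3, zero_smul, smul_zero]

/-- The relations between the tables of equivalent `[p]`-maps. -/
lemma Equivalent.exists_coeff_eq (hE : Equivalent F φ ψ) (hx : IsL43 x) (hp : 3 ≤ p)
    (hψ : IsPMap F p ψ) {f g : Fin 4 → F} (hf : ∀ k, φ (x k) = f k • x 3)
    (hg : ∀ k, ψ (x k) = g k • x 3) (hg3 : g 3 = 0) :
    ∃ s t e r q : F, s ≠ 0 ∧ t ≠ 0 ∧ f 2 * (s ^ 2 * t) = (s * t) ^ p * g 2 ∧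
      f 1 * (s ^ 2 * t) = t ^ p * g 1 + q ^ p * g 2 ∧
      f 0 * (s ^ 2 * t) = s ^ p * g 0 + e ^ p * g 1 + r ^ p * g 2 +
        jacobsonScalarThree F p * s ^ 2 * e := by
  have hp0 : p ≠ 0 := by omega
  obtain ⟨A, hA⟩ := hE
  have key := hψ.apply_eq_of_isL43 hx hp hg
  have h2 := congrArg A hx.lie_12.symm
  rw [LieEquiv.map_lie, hx.lie_eq] at h2
  have h3 := congrArg A hx.lie_13.symm
  rw [LieEquiv.map_lie, ← hx.lie_12, LieEquiv.map_lie, hx.lie_lie] at h3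
  -- This relation forces the image of `x 1` to have no `x 0`-component, so automorphisms are
  -- triangular on the generators.
  have h12 := congrArg A hx.lie_23
  rw [LieEquiv.map_lie, ← hx.lie_12, LieEquiv.map_lie, hx.lie_lie, map_zero A] at h12
  have hA3 : A (x 3) ≠ 0 := fun h => x.ne_zero 3 (A.injective (h.trans (map_zero A).symm))
  have e0 := hA (x 0)
  have e1 := hA (x 1)
  have e2 := hA (x 2)
  rw [hf, map_smul, h3, smul_smul] at e0 e1 e2
  rw [h2] at e2
  rw [key, Fin.sum_univ_four, hg3] at e0 e1 e2
  rw [h3] at hA3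
  generalize x.repr (A (x 0)) 0 = s, x.repr (A (x 0)) 1 = e, x.repr (A (x 0)) 2 = r,
    x.repr (A (x 1)) 0 = t₀, x.repr (A (x 1)) 1 = t, x.repr (A (x 1)) 2 = q at *
  obtain ⟨hs, hD⟩ : s ≠ 0 ∧ s * t - e * t₀ ≠ 0 := by
    simpa [x.ne_zero, not_or] using hA3
  have ht₀ : t₀ = 0 := by simpa [x.ne_zero, hD] using h12
  subst ht₀
  have hinj : ∀ c d : F, c • x 3 = d • x 3 → c = d := fun c d h =>
    smul_left_injective F (x.ne_zero 3) h
  replace e0 := hinj _ _ e0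
  replace e1 := hinj _ _ e1
  replace e2 := hinj _ _ e2
  simp [hp0] at hD e0 e1 e2
  refine ⟨s, t, e, r, q, hs, hD.2, ?_, ?_, ?_⟩
  · linear_combination e2
  · linear_combination e1
  · linear_combination e0

end Filiform

/-! ### Tables for `L_{4,3}`, and the classification for `p ≥ 5`. -/

section FiliformLists

variable {F L : Type*} [Field F] [LieRing L] [LieAlgebra F L] {p : ℕ} {φ ψ : L → L}
  {x : Module.Basis (Fin 4) F L}

/-- The coefficients of `x₄` in the table with a given index. -/
def Index43Big.coeff : Index43Big F → Fin 4 → F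
  | .a => 0
  | .b => ![1, 0, 0, 0]
  | .c ξ => ![0, ξ, 0, 0]
  | .d => ![0, 0, 1, 0]

lemma Index43Big.values_eq (i : Index43Big F) (k : Fin 4) :
    i.values x k = i.coeff k • x 3 := by
  cases i <;> fin_cases k <;> simp [values, coeff]

lemma Index43Big.coeff_three (i : Index43Big F) : i.coeff 3 = 0 := by
  cases i <;> rfl

/-- The coefficients of `x₄` in the table with a given index. -/
def Index43Three.coeff : Index43Three F → Fin 4 → F
  | .a => 0
  | .b => ![0, 0, 1, 0]
  | .c α β => ![α, β, 0, 0]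

lemma Index43Three.values_eq (i : Index43Three F) (k : Fin 4) :
    i.values x k = i.coeff k • x 3 := by
  cases i <;> fin_cases k <;> simp [values, coeff]

lemma Index43Three.coeff_three (i : Index43Three F) : i.coeff 3 = 0 := by
  cases i <;> rfl

/-- Normal form when `x₃` is not mapped to zero. -/
lemma IsL43.complete_of_apply_three_ne_zero [Fact p.Prime] [CharP F p] [PerfectField F]
    (hx : IsL43 x) (hp : 3 ≤ p) (h : IsPMap F p φ) {f : Fin 4 → F}
    (hf : ∀ k, φ (x k) = f k • x 3) (hf3 : f 3 = 0) (h2 : f 2 ≠ 0) :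
    ∃ y : Module.Basis (Fin 4) F L, IsL43 y ∧ φ (y 0) = 0 ∧ φ (y 1) = 0 ∧ φ (y 2) = y 3 ∧
      φ (y 3) = 0 := by
  obtain ⟨r, hr⟩ := exists_pow_eq p (-(f 2 ^ p * f 0) / f 2)
  obtain ⟨q, hq⟩ := exists_pow_eq p (-((f 2)⁻¹ ^ p * f 1) / f 2)
  obtain ⟨y, hy, hy3, h0, h1, h2', h3⟩ :=
    -- With `s = f 2` and `t = s⁻¹`, both `y 3` and the image of `y 2` equal `f 2 • x 3`; the roots
    -- `r`, `q` kill the values at the generators.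
    hx.exists_basis_apply hp h hf hf3 h2 (inv_ne_zero h2) 0 r q
  refine ⟨y, hy, ?_, ?_, ?_, h3⟩
  · rw [h0, hr, div_mul_cancel₀ _ h2]
    simp [(Fact.out : p.Prime).ne_zero]
  · rw [h1, hq, div_mul_cancel₀ _ h2]
    simp
  · rw [h2', hy3, mul_inv_cancel₀ h2, one_pow, one_mul, pow_two, mul_assoc, mul_inv_cancel₀ h2,
      mul_one]

theorem IsL43.classifies [Fact p.Prime] [CharP F p] [PerfectField F] (hx : IsL43 x)
    (hp : 5 ≤ p) : Classifies p x (Index43Big.values x) Index43Big.Rel := by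
  have hp0 : p ≠ 0 := by omega
  have hp3 : 3 ≤ p := by omega
  have hκ : jacobsonScalarThree F p = 0 := if_neg (by omega)
  refine classifies_of_tables IsL43 (fun x y hx hy => hx.equiv_lie hy) Index43Big.values
    (fun x y i k => by simp [Index43Big.values_eq]) x hx
    ⟨_, hx.isPMap (p := p) hp3, IsL43.isPMap_basis⟩ _
    (fun i k a => by rw [Index43Big.values_eq, smul_lie, hx.lie_four, smul_zero])
    (fun i φ h => hx.isPNilpotent hp3 h.1
      (by rw [h.2, Index43Big.values_eq, Index43Big.coeff_three, zero_smul])) ?_ ?_ ?_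
  · intro φ h hn
    obtain ⟨f, hf, hf3⟩ := hx.exists_apply_eq_smul hp3 h hn
    by_cases h2 : f 2 = 0
    · by_cases h1 : f 1 = 0
      · by_cases h0 : f 0 = 0
        · exact ⟨.a, x, hx, fun k => by
            rw [hf]
            fin_cases k <;> simp [Index43Big.values, h0, h1, h2, hf3]⟩
        · obtain ⟨y, hy, hy3, h0', h1', h2', h3'⟩ :=
            hx.exists_basis_apply hp3 h hf hf3 one_ne_zero h0 0 0 0
          refine ⟨.b, y, hy, fun k => ?_⟩
          fin_cases k
          iterate 3 simp [Index43Big.values, *]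
          exact h3'
      · obtain ⟨e, he⟩ := exists_pow_eq p (-f 0 / f 1)
        obtain ⟨y, hy, hy3, h0', h1', h2', h3'⟩ :=
          hx.exists_basis_apply hp3 h hf hf3 one_ne_zero one_ne_zero e 0 0
        refine ⟨.c (Units.mk0 _ h1), y, hy, fun k => ?_⟩
        fin_cases k <;> simp [Index43Big.values, *]
    · obtain ⟨y, hy, h0', h1', h2', h3'⟩ := hx.complete_of_apply_three_ne_zero hp3 h hf hf3 h2
      refine ⟨.d, y, hy, fun k => ?_⟩
      fin_cases k <;> simpa [Index43Big.values]
  · intro i j φ hr hij h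
    cases i <;> cases j <;> first | exact absurd hr id | exact absurd rfl hij | skip
    rename_i ξ₁ ξ₂
    obtain ⟨s, hs⟩ : IsSquare ((ξ₁ : F) * (ξ₂ : F)⁻¹) := hr
    have hξ₁ := ξ₁.ne_zero
    have hξ₂ := ξ₂.ne_zero
    have hs0 : s ≠ 0 := by
      rintro rfl
      simp at hs
    obtain ⟨y, hy, hy3, h0', h1', h2', h3'⟩ :=
      hx.exists_basis_apply hp3 h.1 (fun k => (h.2 k).trans (Index43Big.values_eq _ k))
        (Index43Big.coeff_three _) (inv_ne_zero hs0) one_ne_zero 0 0 0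
    refine ⟨y, hy, fun k => ?_⟩
    fin_cases k
    · simpa [Index43Big.coeff, Index43Big.values, hp0] using h0'
    · refine h1'.trans ?_
      have : (ξ₂ : F) = ξ₁ * (s⁻¹) ^ 2 := by
        field_simp
        field_simp at hs
        linear_combination -hs
      simp [Index43Big.coeff, Index43Big.values, hp0, hy3, smul_smul, this]
    · simpa [Index43Big.coeff, Index43Big.values] using h2'
    · exact h3'
  · intro i j φ ψ hi hj hE
    obtain ⟨s, t, e, r, q, hs, ht, e2, e1, e0⟩ := hE.exists_coeff_eq hx hp3 hj.1
      (fun k => (hi.2 k).trans (Index43Big.values_eq i k))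
      (fun k => (hj.2 k).trans (Index43Big.values_eq j k)) (Index43Big.coeff_three j)
    rw [hκ] at e0
    clear hi hj hE
    cases i <;> cases j <;>
      first | exact trivial | (exfalso; simp [Index43Big.coeff, hs, ht, hp0, eq_comm (a := (0 : F))] at e0 e1 e2; done) | skip
    rename_i ξ₁ ξ₂
    -- Since `p - 1 = 2 m`, the relation `ξ₁ s² = t ^ (p - 1) ξ₂` exhibits the square root `t ^ m /
    -- s`.
    obtain ⟨m, hm⟩ := (Fact.out : p.Prime).odd_of_ne_two (by omega)
    refine ⟨t ^ m / s, ?_⟩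
    have hξ₂ := ξ₂.ne_zero
    have e1' : (ξ₁ : F) * s ^ 2 = t ^ (2 * m) * ξ₂ := by
      refine mul_right_cancel₀ ht ?_
      have e1 : (ξ₁ : F) * (s ^ 2 * t) = t ^ p * ξ₂ := by simpa [Index43Big.coeff] using e1
      rw [hm, pow_succ] at e1
      linear_combination e1
    field_simp
    rw [e1']
    ring

end FiliformLists

/-! ### `L_{4,3}` in characteristic 3. -/

section FiliformThree

variable {F L : Type*} [Field F] [LieRing L] [LieAlgebra F L] {x : Module.Basis (Fin 4) F L}

theorem IsL43.classifies_three [CharP F 3] [PerfectField F] (hx : IsL43 x) :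
    Classifies 3 x (Index43Three.values x) Index43Three.Rel := by
  have : Fact (Nat.Prime 3) := ⟨Nat.prime_three⟩
  have hκ : jacobsonScalarThree F 3 = 1 := if_pos rfl
  refine classifies_of_tables IsL43 (fun x y hx hy => hx.equiv_lie hy) Index43Three.values
    (fun x y i k => by simp [Index43Three.values_eq]) x hx
    ⟨_, hx.isPMap (p := 3) le_rfl, IsL43.isPMap_basis⟩ _
    (fun i k a => by rw [Index43Three.values_eq, smul_lie, hx.lie_four, smul_zero])
    (fun i φ h => hx.isPNilpotent le_rfl h.1
      (by rw [h.2, Index43Three.values_eq, Index43Three.coeff_three, zero_smul])) ?_ ?_ ?_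
  · intro φ h hn
    obtain ⟨f, hf, hf3⟩ := hx.exists_apply_eq_smul le_rfl h hn
    by_cases h2 : f 2 = 0
    · by_cases h1 : f 1 = 0
      -- The Jacobson term is linear in `e`, so `e = -f 0` kills the value at the first generator;
      -- hence no analogue of entry (b) for `p ≥ 5`.
      · obtain ⟨y, hy, hy3, h0', h1', h2', h3'⟩ :=
          hx.exists_basis_apply le_rfl h hf hf3 one_ne_zero one_ne_zero (-f 0) 0 0
        refine ⟨.a, y, hy, fun k => ?_⟩
        fin_cases k <;> simp [Index43Three.values, *]
      · exact ⟨.c (f 0) (Units.mk0 _ h1), x, hx, fun k => by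
          rw [hf]
          fin_cases k <;> simp [Index43Three.values, h2, hf3]⟩
    · obtain ⟨y, hy, h0', h1', h2', h3'⟩ := hx.complete_of_apply_three_ne_zero le_rfl h hf hf3 h2
      refine ⟨.b, y, hy, fun k => ?_⟩
      fin_cases k <;> simpa [Index43Three.values]
  · intro i j φ hr hij h
    have key : ∀ (α₁ α₂ : F) (β₁ β₂ : Fˣ) (s : F), s ^ 2 = (β₂ : F) / β₁ →
        α₁ - α₂ * s ∈ cubicSubspace (β₁ : F) →
        (∀ k, φ (x k) = Index43Three.coeff (.c α₂ β₂) k • x 3) →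
        ∃ y : Module.Basis (Fin 4) F L, IsL43 y ∧
          ∀ k, φ (y k) = Index43Three.values y (.c α₁ β₁) k := by
      rintro α₁ α₂ β₁ β₂ s hs ⟨δ, hδ⟩ hf
      have hβ₁ := β₁.ne_zero
      have hβ₂ := β₂.ne_zero
      rw [eq_div_iff hβ₁] at hs
      have hs0 : s ≠ 0 := by
        rintro rfl
        simp at hs
        exact hβ₂ hs.symm
      obtain ⟨y, hy, hy3, h0', h1', h2', h3'⟩ :=
        -- For `t = 1` and `e = δ` the new value is `(s³ α₂ + δ³ β₂ + s² δ) x₄`, while `x₄` is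
        -- scaled by `s²`; with `β₂ = s² β₁` this is the membership condition.
        hx.exists_basis_apply le_rfl h.1 hf (Index43Three.coeff_three _) hs0 one_ne_zero δ 0 0
      refine ⟨y, hy, fun k => ?_⟩
      fin_cases k
      · refine h0'.trans ?_
        simp only [Index43Three.coeff, Index43Three.values, hκ, hy3, smul_smul, Fin.zero_eta,
          Matrix.cons_val, mul_one, one_mul, mul_zero, add_zero]
        congr 1
        linear_combination -s ^ 2 * hδ - δ ^ 3 * hs
      · refine h1'.trans ?_
        simp only [Index43Three.coeff, Index43Three.values, hy3, smul_smul, Fin.mk_one,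
          Matrix.cons_val, mul_one, one_mul, mul_zero, add_zero, one_pow]
        congr 1
        linear_combination -hs
      · simpa [Index43Three.coeff, Index43Three.values] using h2'
      · exact h3'
    cases i <;> cases j <;> first | exact absurd hr id | exact absurd rfl hij | skip
    rename_i α₁ β₁ α₂ β₂
    have hf := fun k => (h.2 k).trans (Index43Three.values_eq _ k)
    obtain ⟨s, hs, hα | hα⟩ := hr
    · exact key α₁ α₂ β₁ β₂ (-s) (by rw [neg_sq, hs]) (by rwa [mul_neg, sub_neg_eq_add]) hf
    · exact key α₁ α₂ β₁ β₂ s hs hα hf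
  · intro i j φ ψ hi hj hE
    obtain ⟨s, t, e, r, q, hs, ht, e2, e1, e0⟩ := hE.exists_coeff_eq hx le_rfl hj.1
      (fun k => (hi.2 k).trans (Index43Three.values_eq i k))
      (fun k => (hj.2 k).trans (Index43Three.values_eq j k)) (Index43Three.coeff_three j)
    rw [hκ] at e0
    clear hi hj hE
    cases i <;> cases j <;>
      first | exact trivial | (exfalso; simp [Index43Three.coeff, hs, ht, eq_comm (a := (0 : F))] at e0 e1 e2; done) | skip
    rename_i α₁ β₁ α₂ β₂
    have hβ₁ := β₁.ne_zero
    have e1' : (β₁ : F) * s ^ 2 = t ^ 2 * β₂ := by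
      refine mul_right_cancel₀ ht ?_
      have e1 : (β₁ : F) * (s ^ 2 * t) = t ^ 3 * β₂ := by simpa [Index43Three.coeff] using e1
      linear_combination e1
    have e0' : α₁ * (s ^ 2 * t) = s ^ 3 * α₂ + e ^ 3 * β₂ + s ^ 2 * e := by
      simpa [Index43Three.coeff] using e0
    have hs2 : (s / t) ^ 2 = (β₂ : F) / β₁ := by
      field_simp
      linear_combination e1'
    -- One sign is enough, as the other amounts to replacing the square root by its negative.
    refine ⟨s / t, hs2, Or.inr ⟨e / t, ?_⟩⟩
    field_simp
    refine mul_right_cancel₀ (pow_ne_zero 2 hs) ?_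
    linear_combination t ^ 2 * e0' - e ^ 3 * e1'

end FiliformThree

/-! ### `L_{4,3}` in characteristic 2. -/

section FiliformTwo

variable {F L : Type*} [Field F] [LieRing L] [LieAlgebra F L] {x : Module.Basis (Fin 4) F L}

/-- The square of `ad (x 0)` sends `x 1` to `x 3`, whereas a bracket with `x 1` is always a multiple
of `x 2`. -/
lemma IsL43.not_restrictable_two (hx : IsL43 x) : ¬ Restrictable F L 2 := by
  rintro ⟨φ, h⟩
  have h' := LinearMap.congr_fun (h.ad_pow (x 0)) (x 1)
  rw [pow_two, Module.End.mul_apply, LieAlgebra.ad_apply, LieAlgebra.ad_apply,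
    LieAlgebra.ad_apply, hx.lie_12, hx.lie_13, hx.lie_eq] at h'
  simpa using congrArg (fun a => x.repr a 3) h'

end FiliformTwo

end RestrictedLie

/-! ### Assembly of the cases. -/

theorem mainTheorem1 (p : ℕ) [Fact p.Prime] (F : Type*) [Field F] [CharP F p] [PerfectField F]
    (L : Type*) [LieRing L] [LieAlgebra F L] [LieRing.IsNilpotent L]
    (hpos : 1 ≤ Module.finrank F L) (hdim : Module.finrank F L ≤ 4) :
    -- the underlying Lie algebra is one of those listed
    ((Module.finrank F L = 1 ∧ IsLieAbelian L) ∨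
      (Module.finrank F L = 2 ∧ IsLieAbelian L) ∨
      (Module.finrank F L = 3 ∧ IsLieAbelian L) ∨
      (∃ x : Module.Basis (Fin 3) F L, RestrictedLie.IsL32 x) ∨
      (Module.finrank F L = 4 ∧ IsLieAbelian L) ∨
      (∃ x : Module.Basis (Fin 4) F L, RestrictedLie.IsL42 x) ∨
      (∃ x : Module.Basis (Fin 4) F L, RestrictedLie.IsL43 x)) ∧
    -- dimension 1
    (∀ x : Module.Basis (Fin 1) F L,
      RestrictedLie.Classifies p x ![![0]] (fun i j : Fin 1 => i = j)) ∧
    -- dimension 2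
    (∀ x : Module.Basis (Fin 2) F L,
      RestrictedLie.Classifies p x ![![0, 0], ![x 1, 0]] (fun i j : Fin 2 => i = j)) ∧
    -- dimension 3, abelian
    (∀ x : Module.Basis (Fin 3) F L, IsLieAbelian L →
      RestrictedLie.Classifies p x ![![0, 0, 0], ![x 1, 0, 0], ![x 1, x 2, 0]]
        (fun i j : Fin 3 => i = j)) ∧
    -- dimension 3, Heisenberg
    (∀ x : Module.Basis (Fin 3) F L, RestrictedLie.IsL32 x →
      (3 ≤ p → RestrictedLie.Classifies p x ![![0, 0, 0], ![x 2, 0, 0]]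
        (fun i j : Fin 2 => i = j)) ∧
      (p = 2 → RestrictedLie.Classifies p x (fun ξ : F => ![x 2, ξ • x 2, 0])
        (fun ξ₁ ξ₂ => ξ₁ + ξ₂ ∈ RestrictedLie.artinSchreier F))) ∧
    -- dimension 4, abelian
    (∀ x : Module.Basis (Fin 4) F L, IsLieAbelian L →
      RestrictedLie.Classifies p x
        ![![0, 0, 0, 0], ![x 1, 0, 0, 0], ![x 1, 0, x 3, 0], ![x 1, x 2, 0, 0],
          ![x 1, x 2, x 3, 0]]
        (fun i j : Fin 5 => i = j)) ∧
    -- dimension 4, class 2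
    (∀ x : Module.Basis (Fin 4) F L, RestrictedLie.IsL42 x →
      (3 ≤ p → RestrictedLie.Classifies p x
        ![![0, 0, 0, 0], ![x 2, 0, 0, 0], ![x 3, 0, 0, 0], ![x 2, x 3, 0, 0],
          ![0, 0, x 3, 0], ![0, x 2, x 3, 0], ![0, 0, 0, x 2], ![0, x 3, 0, x 2]]
        (fun i j : Fin 8 => i = j)) ∧
      (p = 2 → RestrictedLie.Classifies p x (RestrictedLie.Index42Two.values x)
        RestrictedLie.Index42Two.Rel)) ∧
    -- dimension 4, class 3
    (∀ x : Module.Basis (Fin 4) F L, RestrictedLie.IsL43 x →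
      (5 ≤ p → RestrictedLie.Classifies p x (RestrictedLie.Index43Big.values x)
        RestrictedLie.Index43Big.Rel) ∧
      (p = 3 → RestrictedLie.Classifies p x (RestrictedLie.Index43Three.values x)
        RestrictedLie.Index43Three.Rel) ∧
      (p = 2 → ¬ RestrictedLie.Restrictable F L p)) := by
  have : Module.Finite F L := Module.finite_of_finrank_pos hpos
  have card : ∀ {n : ℕ}, Module.Basis (Fin n) F L → Module.finrank F L = n := fun x => by
    simp [Module.finrank_eq_card_basis x]
  have abelian : Module.finrank F L ≤ 2 → IsLieAbelian L := fun h => by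
    by_contra hL
    obtain ⟨x, -⟩ | ⟨x, -⟩ | ⟨x, -⟩ :=
      RestrictedLie.exists_basis_of_not_isLieAbelian (F := F) hpos hdim hL <;>
    · have := card x
      omega
  refine ⟨?_, fun x => ?_, fun x => ?_, fun x hL => ?_, fun x hx => ⟨fun hp => ?_, fun hp => ?_⟩,
    fun x hL => ?_, fun x hx => ⟨fun hp => ?_, fun hp => ?_⟩,
    fun x hx => ⟨fun hp => ?_, fun hp => ?_, fun hp => ?_⟩⟩
  · by_cases hL : IsLieAbelian L
    · have : Module.finrank F L = 1 ∨ Module.finrank F L = 2 ∨ Module.finrank F L = 3 ∨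
          Module.finrank F L = 4 := by omega
      tauto
    · have := RestrictedLie.exists_basis_of_not_isLieAbelian (F := F) hpos hdim hL
      tauto
  · have := abelian (by rw [card x]; norm_num)
    exact RestrictedLie.classifies_one x
  · have := abelian (by rw [card x])
    exact RestrictedLie.classifies_two x
  · exact RestrictedLie.classifies_three x
  · exact hx.classifies hp
  · subst hp
    exact hx.classifies_two
  · exact RestrictedLie.classifies_four x
  · exact hx.classifies hp
  · subst hp
    exact hx.classifies_two
  · exact hx.classifies hp
  · subst hp
    exact hx.classifies_three
  · subst hp
    exact hx.not_restrictable_two
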